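/- **Setting.** Let $\Omega=(0,2\pi)$, and for an integer $m\ge 0$ let $\|v\|_{m,\infty}=\max_{0\le i\le m}\|v^{(i)}\|_{L^\infty(\Omega)}$ (weak derivatives) be the norm of $W^{m,\infty}(\Omega)$. Let $T>0$ and let $u$, continuous on $[0,2\pi]\times[0,T]$, solve $u_t=u_{xx}$ on $[0,2\pi]\times(0,T]$, $u(\cdot,0)=u_0$. Put $q=u_x$. The boundary condition is, for $t\in[0,T]$, either * periodic: $u(0,t)=u(2\pi,t)$ and $q(0,t)=q(2\pi,t)$; or * mixed: $u(0,t)=g_0(t),\ q(2\pi,t)=g_1(t)$ if the fluxes (a) below are used, and $q(0,t)=g_0(t),\ u(2\pi,t)=g_1(t)$ if the fluxes (b) are used. **Scheme.** Let $k\ge 1$, let $0=x_{1/2}<x_{3/2}<\dots<x_{N+1/2}=2\pi$ be a mesh with cells $\tau_j=(x_{j-1/2},x_{j+1/2})$, $h_j=|\tau_j|$, $\bar h_j=h_j/2$, $h=\max_j h_j$, and suppose that $h\le c\,h_j$ for all $j$. Let $P_k(\tau_j)$ be the polynomials of degree at most $k$ on $\tau_j$ and $V_h=\{v: v|_{\tau_j}\in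 P_k(\tau_j)\ \forall j\}$, and write $(\cdot,\cdot)_j$ for the $L^2(\tau_j)$ inner product. Functions $u_h(\cdot,t),q_h(\cdot,t)\in V_h$, $t\in[0,T]$, with $u_h$ differentiable in $t$, solve the LDG scheme if for all $t\in[0,T]$, all $j$ and all $v,w\in P_k(\tau_j)$ $$(u_{ht},v)_j=-(q_h,v_x)_j+\hat q_hv^-|_{j+\frac12}-\hat q_hv^+|_{j-\frac12},\qquad (q_h,w)_j=-(u_h,w_x)_j+\hat u_hw^-|_{j+\frac12}-\hat u_hw^+|_{j-\frac12},$$ where the alternating fluxes are either (a) $\hat u_h=u_h^-,\ \hat q_h=q_h^+$ or (b) $\hat u_h=u_h^+,\ \hat q_h=q_h^-$ at all nodes. A one-sided limit from outside $[0,2\pi]$ is that of the periodic extension in the periodic case, and the prescribed boundary value ($g_0(t)$ at $0$, $g_1(t)$ at $2\pi$) in the mixed case. **Initial value.** On $\tau_j$, $P_h^-v$ (resp. $P_h^+v$) is the polynomial in $P_k(\tau_j)$ with $(P_h^\mp v,w)_j=(v,w)_j$ for all $w\in P_{k-1}(\tau_j)$ that agrees with $v$ at $x_{j+1/2}^-$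 (resp. at $x_{j-1/2}^+$). Let $L_{j,m}$ be the Legendre polynomial of degree $m$ on $\tau_j$ with $L_{j,m}(x_{j+1/2})=1$, let $D_s^{-1}v(x)=\bar h_j^{-1}\int_{x_{j-1/2}}^xv\,dx'$ on $\tau_j$, and $$F_{1,1}=P_h^+D_s^{-1}L_{j,k},\quad \bar F_{1,i}=P_h^-D_s^{-1}F_{1,i},\quad F_{1,i+1}=P_h^+D_s^{-1}\bar F_{1,i},$$ $$F_{2,1}=P_h^-D_s^{-1}L_{j,k},\quad \bar F_{2,i}=P_h^+D_s^{-1}F_{2,i},\quad F_{2,i+1}=P_h^-D_s^{-1}\bar F_{2,i}\qquad(i\ge1).$$ Let $\bar v_{j,k}$ and $\tilde v_{j,k}$ be the coefficients of $L_{j,k}$ in the Legendre expansions on $\tau_j$ of $v-P_h^-v$ and $v-P_h^+v$, that is, $$\bar v_{j,k}=-v(x_{j+\frac12}^-)+\frac1{h_j}\int_{\tau_j}v\sum_{m=0}^k(2m+1)L_{j,m}\,dx,\quad \tilde v_{j,k}=(-1)^{k+1}v(x_{j-\frac12}^+)+\frac1{h_j}\int_{\tau_j}v\sum_{m=0}^k(-1)^{k+m}(2m+1)L_{j,m}\,dx.$$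 Define on each $\tau_j$, for the fluxes (a), with $G_i=\frac{d^i}{dt^i}\bar u_{j,k}$ and $Q_i=\frac{d^i}{dt^i}\tilde q_{j,k}$, $$u_I^k=P_h^-u-\sum_{i=1}^{\lfloor k/2\rfloor}\bar h_j^{2i}G_i\bar F_{1,i}-\sum_{i=1}^{\lceil k/2\rceil}\bar h_j^{2i-1}Q_{i-1}F_{2,i},$$ and for the fluxes (b), with $G_i=\frac{d^i}{dt^i}\tilde u_{j,k}$ and $Q_i=\frac{d^i}{dt^i}\bar q_{j,k}$, $$u_I^k=P_h^+u-\sum_{i=1}^{\lfloor k/2\rfloor}\bar h_j^{2i}G_i\bar F_{2,i}-\sum_{i=1}^{\lceil k/2\rceil}\bar h_j^{2i-1}Q_{i-1}F_{1,i}.$$ **Averages.** For $e_u=u-u_h$, at time $t$, put $$\|e_u\|_d=\Big|\frac1{2\pi}\int_0^{2\pi}e_u\,dx\Big|,\qquad \|e_u\|_c=\Big(\frac1N\sum_{j=1}^N\Big(\frac1{h_j}\int_{\tau_j}e_u\,dx\Big)^2\Big)^{1/2},$$ and likewise for $e_q=q-q_h$. **Theorem.** For all $k\ge1$ and $c$ there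 is a constant $C$, depending only on $k$ and $c$, such that the following holds for every mesh, flux choice, boundary condition, $T$ and $u$ as above with $\sup_{0\le s\le T}\|u(\cdot,s)\|_{2k+2,\infty}<\infty$. Let $(u_h,q_h)$ solve the LDG scheme with $u_h(\cdot,0)=u_I^k(\cdot,0)$. Then for all $t\in[0,T]$, with $M_t=\sup_{0\le s\le t}\|u(\cdot,s)\|_{2k+2,\infty}$, $$\|e_u\|_c\le C(h+t^{3/2}+t)h^{2k}M_t,\qquad \|e_q\|_c\le C(1+t)h^{2k}M_t.$$ In addition, for the periodic boundary condition, $$\|e_u\|_d\le Ch^{2k+1}M_t,\qquad \|e_q\|_d=0,$$ and for the mixed boundary condition, $$\|e_u\|_d\le C(h^{1/2}+t^{3/2}+t)h^{2k+1/2}M_t,\qquad \|e_q\|_d\le C(1+t)h^{2k+1/2}M_t.$$ -/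

import Mathlib

open MeasureTheory Set Polynomial
open scoped ENNReal ContDiff

namespace LDG

noncomputable section

/-! ## The Sobolev norm of `W^{m,∞}(0, 2π)` -/

/-- `g` is the weak derivative of order `j` of `f` on the open interval `(a, b)`. -/
def IsWeakDeriv (a b : ℝ) (j : ℕ) (f g : ℝ → ℝ) : Prop :=
  LocallyIntegrableOn f (Ioo a b) ∧ LocallyIntegrableOn g (Ioo a b) ∧
    ∀ φ : ℝ → ℝ, ContDiff ℝ ∞ φ → HasCompactSupport φ → tsupport φ ⊆ Ioo a b →
      ∫ x in Ioo a b, f x * iteratedDeriv j φ x = (-1) ^ j * ∫ x in Ioo a b, g x * φ x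

/-- The norm `‖f‖_{m,∞}` of `W^{m,∞}(0, 2π)`: the maximum over `j ≤ m` of the essential suprema
of the weak derivatives of order `j`. It is `∞` if some weak derivative does not exist or is not
essentially bounded, so `f ∈ W^{m,∞}(0, 2π)` means that the norm is finite. (The infimum runs over
the weak derivatives of order `j`, which all agree almost everywhere.) -/
def sobolevNorm (m : ℕ) (f : ℝ → ℝ) : ℝ≥0∞ :=
  ⨆ j ∈ Finset.range (m + 1), ⨅ (g : ℝ → ℝ) (_ : IsWeakDeriv 0 (2 * Real.pi) j f g),
    eLpNorm g ∞ (volume.restrict (Ioo 0 (2 * Real.pi)))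

/-- `sup_{0 ≤ s ≤ t} ‖u(·, s)‖_{m,∞}` for a function `u = u(x, t)`. -/
def supSobolevNorm (m : ℕ) (u : ℝ → ℝ → ℝ) (t : ℝ) : ℝ≥0∞ :=
  ⨆ s ∈ Icc (0 : ℝ) t, sobolevNorm m (fun x => u x s)

/-! ## Meshes of `[0, 2π]` -/

/-- A mesh `0 = x_{1/2} < x_{3/2} < ⋯ < x_{N+1/2} = 2π` with `N` cells; `node n` is `x_{n+1/2}`,
and the cell with index `j : Fin N` is `(node j.castSucc, node j.succ)`. -/
structure Mesh (N : ℕ) where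
  node : Fin (N + 1) → ℝ
  strictMono : StrictMono node
  first : node 0 = 0
  last : node (Fin.last N) = 2 * Real.pi

namespace Mesh

variable {N : ℕ} (𝒯 : Mesh N)

/-- Left end of a cell. -/
def left (j : Fin N) : ℝ := 𝒯.node j.castSucc

/-- Right end of a cell. -/
def right (j : Fin N) : ℝ := 𝒯.node j.succ

/-- Length `h_j` of a cell. -/
def len (j : Fin N) : ℝ := 𝒯.right j - 𝒯.left j

/-- Mesh size `h = max_j h_j`. -/
def size : ℝ := ⨆ j : Fin N, 𝒯.len j

/-- Quasi-uniformity with constant `c`. -/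
def QuasiUniform (c : ℝ) : Prop := ∀ j : Fin N, 𝒯.size ≤ c * 𝒯.len j

end Mesh

/-! ## Boundary conditions, the continuous problem -/

/-- The two alternating fluxes: `minusPlus` is `û = u⁻, q̂ = q⁺`,
and `plusMinus` is `û = u⁺, q̂ = q⁻`. -/
inductive Flux
  | minusPlus
  | plusMinus

/-- The boundary conditions. For mixed conditions `g₀` is the datum at `x = 0` and `g₁` the datum
at `x = 2π`; which of them is a Dirichlet and which a Neumann datum goes with the flux,
see `BC.Holds`. -/
inductive BC
  | periodic
  | mixed (g₀ g₁ : ℝ → ℝ)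

/-- The auxiliary variable `q = u_x` on `[0, 2π]` (one-sided derivatives at the ends). -/
def auxQ (u : ℝ → ℝ → ℝ) (x t : ℝ) : ℝ :=
  derivWithin (fun y => u y t) (Icc 0 (2 * Real.pi)) x

/-- The boundary condition at time `t`. -/
def BC.Holds (u : ℝ → ℝ → ℝ) (t : ℝ) : Flux → BC → Prop
  | _, .periodic => u 0 t = u (2 * Real.pi) t ∧ auxQ u 0 t = auxQ u (2 * Real.pi) t
  | .minusPlus, .mixed g₀ g₁ => u 0 t = g₀ t ∧ auxQ u (2 * Real.pi) t = g₁ t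
  | .plusMinus, .mixed g₀ g₁ => auxQ u 0 t = g₀ t ∧ u (2 * Real.pi) t = g₁ t

/-- `u` is a classical solution of `u_t = u_xx` on `[0, 2π] × (0, T]`, `u(·, 0) = u₀`, with the
given boundary condition, continuous up to `t = 0`. -/
structure IsHeatSolution (F : Flux) (bc : BC) (T : ℝ) (u₀ : ℝ → ℝ) (u : ℝ → ℝ → ℝ) : Prop where
  continuousOn : ContinuousOn (fun z : ℝ × ℝ => u z.1 z.2) (Icc 0 (2 * Real.pi) ×ˢ Icc 0 T)
  pde : ∀ x ∈ Icc 0 (2 * Real.pi), ∀ t ∈ Ioc 0 T,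
    HasDerivWithinAt (fun s => u x s)
      (iteratedDerivWithin 2 (fun y => u y t) (Icc 0 (2 * Real.pi)) x) (Icc 0 T) t
  initial : ∀ x ∈ Icc 0 (2 * Real.pi), u x 0 = u₀ x
  boundary : ∀ t ∈ Icc 0 T, bc.Holds u t F

/-! ## The LDG scheme

A function of the finite element space `V_h` at a fixed time is given by its polynomial on each
cell, a family `Fin N → ℝ[X]` with values in `degreeLT ℝ (k + 1)`, that is, of degree at most
`k`. -/

section Scheme

variable {N : ℕ} (𝒯 : Mesh N)

/-- The left limits `v⁻` at all nodes; `β` stands for the value from outside at `x = 0`. -/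
def traceMinus (β : ℝ) (v : Fin N → ℝ[X]) : Fin (N + 1) → ℝ :=
  Fin.cons β (fun j => (v j).eval (𝒯.right j))

/-- The right limits `v⁺` at all nodes; `β` stands for the value from outside at `x = 2π`. -/
def tracePlus (β : ℝ) (v : Fin N → ℝ[X]) : Fin (N + 1) → ℝ :=
  Fin.snoc (fun j => (v j).eval (𝒯.left j)) β

/-- The left limits at all nodes of the periodic extension. -/
def traceMinusPer [NeZero N] (v : Fin N → ℝ[X]) : Fin (N + 1) → ℝ :=
  traceMinus 𝒯 ((v (Fin.rev 0)).eval (2 * Real.pi)) v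

/-- The right limits at all nodes of the periodic extension. -/
def tracePlusPer [NeZero N] (v : Fin N → ℝ[X]) : Fin (N + 1) → ℝ :=
  tracePlus 𝒯 ((v 0).eval 0) v

/-- The numerical flux `û_h` at all nodes, at time `t`. -/
def fluxU [NeZero N] (t : ℝ) (v : Fin N → ℝ[X]) : Flux → BC → Fin (N + 1) → ℝ
  | .minusPlus, .periodic => traceMinusPer 𝒯 v
  | .minusPlus, .mixed g₀ _ => traceMinus 𝒯 (g₀ t) v
  | .plusMinus, .periodic => tracePlusPer 𝒯 v
  | .plusMinus, .mixed _ g₁ => tracePlus 𝒯 (g₁ t) v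

/-- The numerical flux `q̂_h` at all nodes, at time `t`. -/
def fluxQ [NeZero N] (t : ℝ) (v : Fin N → ℝ[X]) : Flux → BC → Fin (N + 1) → ℝ
  | .minusPlus, .periodic => tracePlusPer 𝒯 v
  | .minusPlus, .mixed _ g₁ => tracePlus 𝒯 (g₁ t) v
  | .plusMinus, .periodic => traceMinusPer 𝒯 v
  | .plusMinus, .mixed g₀ _ => traceMinus 𝒯 (g₀ t) v

/-- `(u_h, q_h)` solves the LDG scheme on `[0, T]`. -/
structure IsLDGSolution [NeZero N] (k : ℕ) (F : Flux) (bc : BC) (T : ℝ)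
    (uh qh : ℝ → Fin N → ℝ[X]) : Prop where
  uh_mem : ∀ t ∈ Icc 0 T, ∀ j, uh t j ∈ degreeLT ℝ (k + 1)
  qh_mem : ∀ t ∈ Icc 0 T, ∀ j, qh t j ∈ degreeLT ℝ (k + 1)
  differentiable : ∀ j n, DifferentiableOn ℝ (fun s => (uh s j).coeff n) (Icc 0 T)
  eq_u : ∀ t ∈ Icc 0 T, ∀ j, ∀ v ∈ degreeLT ℝ (k + 1),
    ∫ x in 𝒯.left j..𝒯.right j, derivWithin (fun s => (uh s j).eval x) (Icc 0 T) t * v.eval x =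
      -(∫ x in 𝒯.left j..𝒯.right j, (qh t j).eval x * v.derivative.eval x)
        + fluxQ 𝒯 t (qh t) F bc j.succ * v.eval (𝒯.right j)
        - fluxQ 𝒯 t (qh t) F bc j.castSucc * v.eval (𝒯.left j)
  eq_q : ∀ t ∈ Icc 0 T, ∀ j, ∀ w ∈ degreeLT ℝ (k + 1),
    ∫ x in 𝒯.left j..𝒯.right j, (qh t j).eval x * w.eval x =
      -(∫ x in 𝒯.left j..𝒯.right j, (uh t j).eval x * w.derivative.eval x)
        + fluxU 𝒯 t (uh t) F bc j.succ * w.eval (𝒯.right j)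
        - fluxU 𝒯 t (uh t) F bc j.castSucc * w.eval (𝒯.left j)

end Scheme

/-! ## Gauss-Radau projections and the special interpolation function -/

/-- `p` is the polynomial of degree at most `k` that has the same moments on `(a, b)` as `v`
against all polynomials of degree less than `k`, and the same value as `v` at the point `c`. -/
def IsRadau (k : ℕ) (a b c : ℝ) (v : ℝ → ℝ) (p : ℝ[X]) : Prop :=
  p ∈ degreeLT ℝ (k + 1) ∧
    (∀ w ∈ degreeLT ℝ k, ∫ x in a..b, p.eval x * w.eval x = ∫ x in a..b, v x * w.eval x) ∧
    p.eval c = v c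

theorem IsRadau.eq_zero {k : ℕ} {a b c : ℝ} (hab : a < b) (hc : c = a ∨ c = b) {p : ℝ[X]}
    (hp : p ∈ degreeLT ℝ (k + 1))
    (hm : ∀ w ∈ degreeLT ℝ k, ∫ x in a..b, p.eval x * w.eval x = 0) (hpc : p.eval c = 0) :
    p = 0 := by
  obtain ⟨r, rfl⟩ := dvd_iff_isRoot.2 hpc
  by_cases hr : r = 0
  · simp [hr]
  exfalso
  have hdeg : r ∈ degreeLT ℝ k := by
    rw [mem_degreeLT] at hp ⊢
    rw [degree_mul, degree_X_sub_C, degree_eq_natDegree hr] at hp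
    rw [degree_eq_natDegree hr]
    have h1 : ((1 + r.natDegree : ℕ) : WithBot ℕ) < ((k + 1 : ℕ) : WithBot ℕ) := by
      push_cast; exact_mod_cast hp
    have h2 : 1 + r.natDegree < k + 1 := Nat.cast_lt.1 h1
    exact Nat.cast_lt.2 (by omega)
  have h0 := hm r hdeg
  obtain ⟨y, hy, hry, hyc⟩ : ∃ y ∈ Ioo a b, r.eval y ≠ 0 ∧ y ≠ c := by
    have hinf : (Ioo a b \ (r.roots.toFinset : Set ℝ)).Infinite :=
      (Ioo_infinite hab).sdiff (Finset.finite_toSet _)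
    obtain ⟨y, hy⟩ := hinf.nonempty
    refine ⟨y, hy.1, fun h => hy.2 (by simp [hr, h]), ?_⟩
    rcases hc with rfl | rfl
    · exact hy.1.1.ne'
    · exact hy.1.2.ne
  rcases hc with rfl | rfl
  · have hpos : 0 < ∫ x in c..b, ((X - C c) * r).eval x * r.eval x := by
      apply intervalIntegral.integral_pos hab
      · fun_prop
      · intro x hx
        have : 0 ≤ x - c := by linarith [hx.1]
        have h2 := mul_nonneg this (mul_self_nonneg (r.eval x))
        simp only [eval_mul, eval_sub, eval_X, eval_C]
        linarith
      · refine ⟨y, ⟨hy.1.le, hy.2.le⟩, ?_⟩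
        have : 0 < y - c := by linarith [hy.1]
        have h2 := mul_pos this (mul_self_pos.2 hry)
        simp only [eval_mul, eval_sub, eval_X, eval_C]
        linarith
    linarith
  · have hpos : 0 < ∫ x in a..c, -(((X - C c) * r).eval x * r.eval x) := by
      apply intervalIntegral.integral_pos hab
      · fun_prop
      · intro x hx
        have : 0 ≤ c - x := by linarith [hx.2]
        have h2 := mul_nonneg this (mul_self_nonneg (r.eval x))
        simp only [eval_mul, eval_sub, eval_X, eval_C]
        linarith
      · refine ⟨y, ⟨hy.1.le, hy.2.le⟩, ?_⟩
        have : 0 < c - y := by linarith [hy.2]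
        have h2 := mul_pos this (mul_self_pos.2 hry)
        simp only [eval_mul, eval_sub, eval_X, eval_C]
        linarith
    rw [intervalIntegral.integral_neg] at hpos
    linarith

/-- The Gauss-Radau projections are well defined. -/
theorem existsUnique_isRadau {k : ℕ} {a b c : ℝ} (hab : a < b) (hc : c = a ∨ c = b)
    {v : ℝ → ℝ} (hv : IntervalIntegrable v volume a b) : ∃! p, IsRadau k a b c v p := by
  have hpi : ∀ p w : ℝ[X], IntervalIntegrable (fun x => p.eval x * w.eval x) volume a b :=
    fun p w => (by fun_prop : Continuous fun x => p.eval x * w.eval x).intervalIntegrable _ _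
  have hvi : ∀ w : ℝ[X], IntervalIntegrable (fun x => v x * w.eval x) volume a b :=
    fun w => hv.mul_continuousOn (by fun_prop)
  let Φ : degreeLT ℝ (k + 1) →ₗ[ℝ] Module.Dual ℝ (degreeLT ℝ k) × ℝ :=
    { toFun := fun p =>
        ({ toFun := fun w => ∫ x in a..b, p.1.eval x * w.1.eval x
           map_add' := fun w₁ w₂ => by
            rw [← intervalIntegral.integral_add (hpi _ _) (hpi _ _)]
            simp [mul_add]
           map_smul' := fun s w => by
            simp only [RingHom.id_apply, smul_eq_mul]
            rw [← intervalIntegral.integral_const_mul]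
            simp [mul_left_comm] }, p.1.eval c)
      map_add' := fun p₁ p₂ => by
        ext w
        · simp only [LinearMap.coe_mk, AddHom.coe_mk, Prod.fst_add, LinearMap.add_apply]
          rw [← intervalIntegral.integral_add (hpi _ _) (hpi _ _)]
          simp [add_mul]
        · simp
      map_smul' := fun s p => by
        ext w
        · simp only [LinearMap.coe_mk, AddHom.coe_mk, Prod.smul_fst, LinearMap.smul_apply,
            RingHom.id_apply, smul_eq_mul]
          rw [← intervalIntegral.integral_const_mul]
          simp [mul_assoc]
        · simp }
  have hfin : ∀ n, Module.finrank ℝ (degreeLT ℝ n) = n := fun n => by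
    rw [(degreeLTEquiv ℝ n).finrank_eq]; simp
  have : ∀ n, FiniteDimensional ℝ (degreeLT ℝ n) := fun n =>
    Module.Finite.equiv (degreeLTEquiv ℝ n).symm
  have hinj : Function.Injective Φ := by
    rw [injective_iff_map_eq_zero]
    intro p hp
    have h1 := congrArg Prod.fst hp
    have h2 : p.1.eval c = 0 := congrArg Prod.snd hp
    exact Subtype.ext (IsRadau.eq_zero hab hc p.2
      (fun w hw => LinearMap.congr_fun h1 ⟨w, hw⟩) h2)
  have hsurj : Function.Surjective Φ := by
    refine (LinearMap.injective_iff_surjective_of_finrank_eq_finrank ?_).1 hinj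
    rw [Module.finrank_prod, Subspace.dual_finrank_eq, hfin, hfin, Module.finrank_self]
  let ℓ : Module.Dual ℝ (degreeLT ℝ k) :=
    { toFun := fun w => ∫ x in a..b, v x * w.1.eval x
      map_add' := fun w₁ w₂ => by
        rw [← intervalIntegral.integral_add (hvi _) (hvi _)]
        simp [mul_add]
      map_smul' := fun s w => by
        simp only [RingHom.id_apply, smul_eq_mul]
        rw [← intervalIntegral.integral_const_mul]
        simp [mul_left_comm] }
  obtain ⟨p, hp⟩ := hsurj (ℓ, v c)
  have hp1 := congrArg Prod.fst hp
  refine ⟨p.1, ⟨p.2, fun w hw => LinearMap.congr_fun hp1 ⟨w, hw⟩, congrArg Prod.snd hp⟩, ?_⟩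
  rintro p' ⟨h1, h2, h3⟩
  have : Φ ⟨p', h1⟩ = Φ p := by
    rw [hp]
    ext w
    · exact h2 w.1 w.2
    · exact h3
  exact congrArg Subtype.val (hinj this)

/-- The Gauss-Radau projection with matching point `c`; see `existsUnique_isRadau`. -/
def radau (k : ℕ) (a b c : ℝ) (v : ℝ → ℝ) : ℝ[X] := Classical.epsilon (IsRadau k a b c v)

/-- `P_h⁻` on the cell `(a, b)`. -/
def radauMinus (k : ℕ) (a b : ℝ) (v : ℝ → ℝ) : ℝ[X] := radau k a b b v

/-- `P_h⁺` on the cell `(a, b)`. -/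
def radauPlus (k : ℕ) (a b : ℝ) (v : ℝ → ℝ) : ℝ[X] := radau k a b a v

/-- The Legendre polynomial of degree `m` on `(a, b)`, with value `1` at `b` (Mathlib's
`shiftedLegendre m` lives on `[0, 1]` and has value `1` at `0`). -/
def legendre (a b : ℝ) (m : ℕ) (x : ℝ) : ℝ := aeval ((b - x) / (b - a)) (shiftedLegendre m)

/-- The operator `D_s⁻¹` on the cell `(a, b)`. -/
def Dinv (a b : ℝ) (v : ℝ → ℝ) (x : ℝ) : ℝ := ((b - a) / 2)⁻¹ * ∫ y in a..x, v y

/-- The coefficient of `L_{j,k}` in the Legendre expansion of `v - P_h⁻ v` on `(a, b)`. -/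
def coefMinus (k : ℕ) (a b : ℝ) (v : ℝ → ℝ) : ℝ :=
  -v b + (b - a)⁻¹ *
    ∫ x in a..b, v x * ∑ m ∈ Finset.range (k + 1), (2 * m + 1 : ℝ) * legendre a b m x

/-- The coefficient of `L_{j,k}` in the Legendre expansion of `v - P_h⁺ v` on `(a, b)`. -/
def coefPlus (k : ℕ) (a b : ℝ) (v : ℝ → ℝ) : ℝ :=
  (-1) ^ (k + 1) * v a + (b - a)⁻¹ *
    ∫ x in a..b, v x *
      ∑ m ∈ Finset.range (k + 1), (-1) ^ (k + m) * (2 * m + 1 : ℝ) * legendre a b m x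

/-- `F1 k a b i` is the function `F_{1,i+1}` of the cell `(a, b)`. -/
def F1 (k : ℕ) (a b : ℝ) : ℕ → ℝ[X]
  | 0 => radauPlus k a b (Dinv a b (legendre a b k))
  | i + 1 => radauPlus k a b (Dinv a b fun x =>
      (radauMinus k a b (Dinv a b fun y => (F1 k a b i).eval y)).eval x)

/-- `F2 k a b i` is the function `F_{2,i+1}` of the cell `(a, b)`. -/
def F2 (k : ℕ) (a b : ℝ) : ℕ → ℝ[X]
  | 0 => radauMinus k a b (Dinv a b (legendre a b k))
  | i + 1 => radauMinus k a b (Dinv a b fun x =>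
      (radauPlus k a b (Dinv a b fun y => (F2 k a b i).eval y)).eval x)

/-- `F1bar k a b i` is the function `P_h⁻ D_s⁻¹ F_{1,i+1}` of the cell `(a, b)`. -/
def F1bar (k : ℕ) (a b : ℝ) (i : ℕ) : ℝ[X] :=
  radauMinus k a b (Dinv a b fun y => (F1 k a b i).eval y)

/-- `F2bar k a b i` is the function `P_h⁺ D_s⁻¹ F_{2,i+1}` of the cell `(a, b)`. -/
def F2bar (k : ℕ) (a b : ℝ) (i : ℕ) : ℝ[X] :=
  radauPlus k a b (Dinv a b fun y => (F2 k a b i).eval y)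

/-- `D_t^i` of the coefficient `coefMinus` of `v(·, t)`, for a function `v` on
`[0, 2π] × [0, T]`. -/
def dtCoefMinus (k : ℕ) (T : ℝ) (a b : ℝ) (v : ℝ → ℝ → ℝ) (i : ℕ) (t : ℝ) : ℝ :=
  iteratedDerivWithin i (fun s => coefMinus k a b (fun x => v x s)) (Icc 0 T) t

/-- `D_t^i` of the coefficient `coefPlus` of `v(·, t)`, for a function `v` on
`[0, 2π] × [0, T]`. -/
def dtCoefPlus (k : ℕ) (T : ℝ) (a b : ℝ) (v : ℝ → ℝ → ℝ) (i : ℕ) (t : ℝ) : ℝ :=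
  iteratedDerivWithin i (fun s => coefPlus k a b (fun x => v x s)) (Icc 0 T) t

/-- The correction function `W_2^l(·, t)` on the cell `(a, b)` (the summation index is shifted by
one; `l / 2` and `(l + 1) / 2` are the floor and the ceiling of `l/2`). -/
def correction (k l : ℕ) (T : ℝ) (u : ℝ → ℝ → ℝ) (t a b : ℝ) : Flux → ℝ[X]
  | .minusPlus =>
      ∑ i ∈ Finset.range (l / 2),
        C (((b - a) / 2) ^ (2 * i + 2) * dtCoefMinus k T a b u (i + 1) t) * F1bar k a b i +
      ∑ i ∈ Finset.range ((l + 1) / 2),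
        C (((b - a) / 2) ^ (2 * i + 1) * dtCoefPlus k T a b (auxQ u) i t) * F2 k a b i
  | .plusMinus =>
      ∑ i ∈ Finset.range (l / 2),
        C (((b - a) / 2) ^ (2 * i + 2) * dtCoefPlus k T a b u (i + 1) t) * F2bar k a b i +
      ∑ i ∈ Finset.range ((l + 1) / 2),
        C (((b - a) / 2) ^ (2 * i + 1) * dtCoefMinus k T a b (auxQ u) i t) * F1 k a b i

/-- The Gauss-Radau projection that goes with `u` for the given flux. -/
def radauU (k : ℕ) (a b : ℝ) (v : ℝ → ℝ) : Flux → ℝ[X]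
  | .minusPlus => radauMinus k a b v
  | .plusMinus => radauPlus k a b v

/-- The special interpolation function `u_I^l(·, t)`, given by its polynomial on each cell. -/
def interpU {N : ℕ} (𝒯 : Mesh N) (k l : ℕ) (F : Flux) (T : ℝ) (u : ℝ → ℝ → ℝ) (t : ℝ)
    (j : Fin N) : ℝ[X] :=
  radauU k (𝒯.left j) (𝒯.right j) (fun x => u x t) F
    - correction k l T u t (𝒯.left j) (𝒯.right j) F

/-! ## Domain and cell averages of the error -/

section Averages

variable {N : ℕ} (𝒯 : Mesh N)

/-- `∫_{τ_j} (v - v_h) dx`. -/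
def cellIntegral (v : ℝ → ℝ) (vh : Fin N → ℝ[X]) (j : Fin N) : ℝ :=
  ∫ x in 𝒯.left j..𝒯.right j, (v x - (vh j).eval x)

/-- The domain average `‖v - v_h‖_d`. -/
def domainAvg (v : ℝ → ℝ) (vh : Fin N → ℝ[X]) : ℝ :=
  |(2 * Real.pi)⁻¹ * ∑ j, cellIntegral 𝒯 v vh j|

/-- The cell average `‖v - v_h‖_c`. -/
def cellAvg (v : ℝ → ℝ) (vh : Fin N → ℝ[X]) : ℝ :=
  Real.sqrt ((N : ℝ)⁻¹ * ∑ j, ((𝒯.len j)⁻¹ * cellIntegral 𝒯 v vh j) ^ 2)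

end Averages

end

end LDG

/-!
The corrections in the initial value are chosen such that the interpolation functions of `u` and of
`q = u_x` nearly satisfy the scheme. Write `ξ` for the difference of `u_h` and the interpolation
function of `u`, as an element of the Hilbert space `V_h` (`DGSpace`), and `D` for the discrete
derivative on `V_h` with the flux of `u` (`DGSpace.opD`). The discrete derivative with the flux of
`q` is `-D†`, by the duality of the alternating fluxes (`sum_cellForm_swap`). The projection error
of a function acts on polynomials of degree at most `k` like a multiple of one Legendre polynomial
(`integral_sub_radauU_mul`), and each correction is such that its pairing with a derivative cancels
the preceding one (`integral_chain_succ_mul_derivative`). The time derivatives in the corrections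
are space derivatives by the heat equation (`HeatJet.correction_eq`), so that the corrections of `u`
and of `q` telescope (`integral_jetInterp_shift_mul`), and what remains is
`ξ' = -D†(Dξ + R₂) + R₁` with `ξ(0) = 0` (`DGSpace.exists_perturbedHeat`).

With `h` the mesh size, `R₂ = O(h^(2k+1))`, while `R₁` is only `O(h^(2k))`, since one derivative
less is available for it. But `R₁ = B'` with `B = O(h^(2k+1))`
(`DGSpace.hasDerivWithinAt_residual`). The corrections but the last one have mean zero on each cell,
hence the cell averages of `u - u_h` and `q - q_h` are those of `B - ξ` and `-Dξ`
(`DGSpace.cellIntegral_eq_integral`).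

The rest is a parabolic estimate in an abstract Hilbert space (`PerturbedHeat`). It pairs `ξ(t)`
with a fixed element `v` and moves the evolution to `v` by Duhamel's formula with the semigroup
`exp(-τ D†D)`, whose smoothing estimates hold for every bounded operator `D`
(`heatSemigroup_smoothing`).
* For the cell averages, the direct bound of `ξ` (`PerturbedHeat.norm_le`) and the bound of `Dξ`
  that combines smoothing with the inverse inequality `‖D‖ = O(1/h)` (`PerturbedHeat.norm_D_le`)
  suffice.
* For the mean of `ξ`, `v` comes from the constant function `1`, and `R₁ = B'` is integrated by
  parts in time. In the periodic case `D 1 = 0`, so that the mean of `ξ - B` is conserved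
  (`PerturbedHeat.abs_inner_le_of_D_eq_zero`), and a full power of `h` is gained. In the mixed case
  `1` violates the Dirichlet condition. With `ℓ` comparable to `min t 1` it is split into a part of
  norm `ℓ^(1/2)` near the Dirichlet end and a part on which `D` has norm `ℓ^(-1/2)`
  (`DGSpace.exists_cutoff`, `PerturbedHeat.abs_inner_le_of_split`), which leaves a factor
  `log (t/h)` that is absorbed by a power `(t/h)^(1/2)`.
* The mean of `-Dξ` is a difference of two boundary fluxes. It vanishes in the periodic case, and
  duality with `D†1 = O(h^(-1/2))` gives half a power of `h` in the mixed case.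
-/

namespace LDG

/-! ### Integrals of polynomials -/

theorem intervalIntegrable_eval (p : ℝ[X]) (a b : ℝ) :
    IntervalIntegrable (fun x => p.eval x) volume a b :=
  (by fun_prop : Continuous fun x => p.eval x).intervalIntegrable _ _

theorem intervalIntegrable_eval_mul (p q : ℝ[X]) (a b : ℝ) :
    IntervalIntegrable (fun x => p.eval x * q.eval x) volume a b :=
  (by fun_prop : Continuous fun x => p.eval x * q.eval x).intervalIntegrable _ _

theorem integral_eval_derivative (p : ℝ[X]) (a b : ℝ) :
    ∫ x in a..b, p.derivative.eval x = p.eval b - p.eval a :=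
  intervalIntegral.integral_eq_sub_of_hasDerivAt (fun x _ => p.hasDerivAt x)
    (intervalIntegrable_eval _ _ _)

theorem integral_derivative_mul (p q : ℝ[X]) (a b : ℝ) :
    ∫ x in a..b, p.derivative.eval x * q.eval x =
      p.eval b * q.eval b - p.eval a * q.eval a -
        ∫ x in a..b, p.eval x * q.derivative.eval x := by
  have h := integral_eval_derivative (p * q) a b
  simp only [derivative_mul, eval_add, eval_mul] at h
  rw [intervalIntegral.integral_add (intervalIntegrable_eval_mul _ _ _ _)
    (intervalIntegrable_eval_mul _ _ _ _)] at h
  linarith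

theorem derivative_mem_degreeLT {n : ℕ} {w : ℝ[X]} (hw : w ∈ degreeLT ℝ (n + 1)) :
    w.derivative ∈ degreeLT ℝ n := by
  rw [mem_degreeLT] at hw ⊢
  by_cases h0 : w = 0
  · simp [h0]
  · have h1 := degree_derivative_lt h0
    rw [degree_eq_natDegree h0] at hw h1
    have h2 : w.natDegree < n + 1 := by exact_mod_cast hw
    exact h1.trans_le (by exact_mod_cast Nat.lt_succ_iff.1 h2)

theorem integral_sq_eval_nonneg {a b : ℝ} (hab : a ≤ b) (p : ℝ[X]) :
    0 ≤ ∫ x in a..b, p.eval x * p.eval x :=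
  intervalIntegral.integral_nonneg hab fun _ _ => mul_self_nonneg _

/-- The Cauchy-Schwarz inequality. -/
theorem sq_integral_eval_mul_le {a b : ℝ} (hab : a ≤ b) (p q : ℝ[X]) :
    (∫ x in a..b, p.eval x * q.eval x) ^ 2 ≤
      (∫ x in a..b, p.eval x * p.eval x) * ∫ x in a..b, q.eval x * q.eval x := by
  have h : ∀ t : ℝ, 0 ≤ (∫ x in a..b, q.eval x * q.eval x) * (t * t)
      + (2 * ∫ x in a..b, p.eval x * q.eval x) * t + ∫ x in a..b, p.eval x * p.eval x := by
    intro t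
    have h1 := integral_sq_eval_nonneg hab (p + C t * q)
    have h2 : (fun x => (p + C t * q).eval x * (p + C t * q).eval x) = fun x =>
        (t * t * (q.eval x * q.eval x) + 2 * t * (p.eval x * q.eval x)) + p.eval x * p.eval x := by
      funext x; simp; ring
    rw [h2, intervalIntegral.integral_add, intervalIntegral.integral_add,
      intervalIntegral.integral_const_mul, intervalIntegral.integral_const_mul] at h1
    · linarith
    all_goals exact Continuous.intervalIntegrable (by fun_prop) _ _
  have := discrim_le_zero h
  rw [discrim] at this
  linarith

/-! ### Legendre polynomials on a cell -/

/-- The orthogonality relation for Rodrigues polynomials: the boundary terms of all `i` integrations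
by parts vanish. -/
theorem integral_iterate_derivative_mul_eq_zero {n i : ℕ} (hi : i ≤ n) {w : ℝ[X]}
    (hw : w ∈ degreeLT ℝ i) :
    ∫ x in (0 : ℝ)..1, (derivative^[i] ((X * (1 - X)) ^ n : ℝ[X])).eval x * w.eval x = 0 := by
  induction i generalizing w with
  | zero =>
    have : w = 0 := by
      rw [mem_degreeLT] at hw
      simpa using hw
    simp [this]
  | succ i ih =>
    have hz : ∀ y : ℝ, y * (1 - y) = 0 →
        (derivative^[i] ((X * (1 - X)) ^ n : ℝ[X])).eval y = 0 := by
      intro y hy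
      obtain ⟨r, hr⟩ := pow_sub_dvd_iterate_derivative_pow (X * (1 - X) : ℝ[X]) n i
      rw [hr, eval_mul, eval_pow]
      simp [hy, Nat.sub_ne_zero_of_lt (Nat.lt_of_succ_le hi)]
    rw [Function.iterate_succ_apply', integral_derivative_mul, hz 0 (by simp), hz 1 (by simp),
      ih (by omega) (derivative_mem_degreeLT hw)]
    simp

/-- The polynomial underlying `legendre a b m`. -/
noncomputable def legP (a b : ℝ) (m : ℕ) : ℝ[X] :=
  ((shiftedLegendre m).map (Int.castRingHom ℝ)).comp (C (b / (b - a)) - C (1 / (b - a)) * X)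

theorem eval_legP (a b : ℝ) (m : ℕ) (x : ℝ) : (legP a b m).eval x = legendre a b m x := by
  rw [legP, legendre, eval_comp]
  simp only [eval_sub, eval_C, eval_mul, eval_X, eval_map]
  rw [aeval_def, eval₂_eq_eval_map, eval₂_eq_eval_map]
  congr 1
  ring

section

variable {a b : ℝ}

theorem natDegree_legP (hab : a < b) (m : ℕ) : (legP a b m).natDegree = m := by
  have h1 : (C (b / (b - a)) - C (1 / (b - a)) * X : ℝ[X]).natDegree = 1 := by
    have : (C (b / (b - a)) - C (1 / (b - a)) * X : ℝ[X]) =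
        C (-(1 / (b - a))) * X + C (b / (b - a)) := by
      simp only [map_neg]; ring
    rw [this]
    refine natDegree_linear ?_
    have : b - a ≠ 0 := by linarith
    simpa using this
  rw [legP, natDegree_comp, h1, mul_one, natDegree_map_eq_of_injective
    (RingHom.injective_int _), natDegree_shiftedLegendre]

theorem legP_ne_zero (hab : a < b) (m : ℕ) : legP a b m ≠ 0 := by
  cases m with
  | zero => simp [legP, shiftedLegendre]
  | succ m =>
    intro h
    have := natDegree_legP hab (m + 1)
    simp [h] at this

theorem degree_legP (hab : a < b) (m : ℕ) : (legP a b m).degree = m := by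
  rw [degree_eq_natDegree (legP_ne_zero hab m), natDegree_legP hab]

theorem legP_mem (hab : a < b) {m n : ℕ} (hmn : m < n) : legP a b m ∈ degreeLT ℝ n := by
  rw [mem_degreeLT, degree_legP hab]
  exact_mod_cast hmn

/-- Orthogonality to lower degrees, transported from `(0, 1)` by the affine map. -/
theorem integral_legP_mul_eq_zero (hab : a < b) {m : ℕ} {w : ℝ[X]} (hw : w ∈ degreeLT ℝ m) :
    ∫ x in a..b, (legP a b m).eval x * w.eval x = 0 := by
  have hh : b - a ≠ 0 := by linarith
  set v : ℝ[X] := w.comp (C b - C (b - a) * X) with hv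
  have hvdeg : v ∈ degreeLT ℝ m := by
    rw [mem_degreeLT] at hw ⊢
    by_cases h0 : w = 0
    · simp [hv, h0]
    · have hl : (C b - C (b - a) * X : ℝ[X]).natDegree ≤ 1 := by
        compute_degree
      have h1 : v.natDegree ≤ w.natDegree := by
        rw [hv, natDegree_comp]
        exact (Nat.mul_le_mul_left _ hl).trans_eq (mul_one _)
      rw [degree_eq_natDegree h0] at hw
      exact degree_le_natDegree.trans_lt ((Nat.cast_le.2 h1).trans_lt hw)
  have h := integral_iterate_derivative_mul_eq_zero le_rfl hvdeg
  have hrod : (derivative^[m] ((X * (1 - X)) ^ m : ℝ[X])) =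
      (m.factorial : ℝ[X]) * (shiftedLegendre m).map (Int.castRingHom ℝ) := by
    have := congrArg (Polynomial.map (Int.castRingHom ℝ)) (factorial_mul_shiftedLegendre_eq m)
    rw [← iterate_derivative_map] at this
    simpa [mul_pow] using this.symm
  have h01 : ∫ y in (0 : ℝ)..1,
      ((shiftedLegendre m).map (Int.castRingHom ℝ)).eval y * v.eval y = 0 := by
    rw [hrod] at h
    simp only [eval_mul, eval_natCast, mul_assoc] at h
    rw [intervalIntegral.integral_const_mul] at h
    exact (mul_eq_zero.1 h).resolve_left (by exact_mod_cast m.factorial_ne_zero)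
  have hsub := intervalIntegral.inv_smul_integral_comp_sub_div (a := a) (b := b)
    (fun y => ((shiftedLegendre m).map (Int.castRingHom ℝ)).eval y * v.eval y) (b - a)
    (b / (b - a))
  have e1 : b / (b - a) - b / (b - a) = 0 := by ring
  have e2 : b / (b - a) - a / (b - a) = 1 := by field_simp
  rw [e1, e2, h01, smul_eq_mul, mul_eq_zero] at hsub
  have h3 := hsub.resolve_left (inv_ne_zero hh)
  rw [← h3]
  congr 1
  funext x
  congr 1
  · rw [legP, eval_comp]; simp; ring_nf
  · rw [hv, eval_comp]; simp; congr 1; field_simp; ring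

theorem legendre_right (a b : ℝ) (m : ℕ) : legendre a b m b = 1 := by
  rw [legendre, sub_self, zero_div, ← coeff_zero_eq_aeval_zero', coeff_shiftedLegendre]
  simp

theorem legendre_left (hab : a < b) (m : ℕ) : legendre a b m a = (-1) ^ m := by
  have : b - a ≠ 0 := by linarith
  rw [legendre, div_self this, shiftedLegendre_eval_symm, sub_self, ← coeff_zero_eq_aeval_zero',
    coeff_shiftedLegendre]
  simp

theorem integral_legP_sq (hab : a < b) (m : ℕ) :
    ∫ x in a..b, (legP a b m).eval x * (legP a b m).eval x = (b - a) / (2 * m + 1) := by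
  set L := legP a b m with hL
  set c := (a + b) / 2 with hc
  -- the Euler operator `(x - c) ∂ₓ` acts on `L` as `m` up to lower order terms
  have hlow : ((X - C c) * L.derivative - C (m : ℝ) * L) ∈ degreeLT ℝ m := by
    rw [mem_degreeLT, degree_lt_iff_coeff_zero]
    intro i hi
    rcases hi.eq_or_lt with rfl | hi
    · have h1 : (L.derivative).coeff m = 0 := by
        rw [coeff_derivative, coeff_eq_zero_of_natDegree_lt (by rw [hL, natDegree_legP hab]; omega)]
        simp
      cases m with
      | zero => rw [coeff_sub, mul_coeff_zero, h1, coeff_C_mul]; simp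
      | succ n =>
        rw [coeff_sub, sub_mul, coeff_sub, coeff_X_mul, coeff_C_mul, h1, coeff_C_mul,
          coeff_derivative]
        push_cast; ring
    · have h0 : L.coeff i = 0 :=
        coeff_eq_zero_of_natDegree_lt (by rw [hL, natDegree_legP hab]; omega)
      have h1 : (L.derivative).coeff i = 0 := by
        rw [coeff_derivative, coeff_eq_zero_of_natDegree_lt (by rw [hL, natDegree_legP hab]; omega)]
        simp
      obtain ⟨n, rfl⟩ : ∃ n, i = n + 1 := ⟨i - 1, by omega⟩
      rw [coeff_sub, sub_mul, coeff_sub, coeff_X_mul, coeff_C_mul, h1, coeff_C_mul, h0,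
          coeff_derivative, h0]
      simp
  have horth := integral_legP_mul_eq_zero hab hlow
  have hparts := integral_derivative_mul (X - C c) (L * L) a b
  have hLb : L.eval b = 1 := by rw [hL, eval_legP, legendre_right]
  have hLa : L.eval a * L.eval a = 1 := by
    rw [hL, eval_legP, legendre_left hab, ← pow_add, ← two_mul, pow_mul]; simp
  set I := ∫ x in a..b, L.eval x * L.eval x with hI
  set J := ∫ x in a..b, L.eval x * ((x - c) * L.derivative.eval x) with hJ
  have h1 : J = m * I := by
    have : (fun x => L.eval x * ((X - C c) * L.derivative - C (m : ℝ) * L).eval x) =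
        fun x => L.eval x * ((x - c) * L.derivative.eval x) - m * (L.eval x * L.eval x) := by
      funext x; simp; ring
    rw [← hL, this, intervalIntegral.integral_sub, intervalIntegral.integral_const_mul] at horth
    · linarith
    all_goals exact Continuous.intervalIntegrable (by fun_prop) _ _
  have h2 : I = (b - a) - 2 * J := by
    have e : (fun x => (X - C c).eval x * (L * L).derivative.eval x) =
        fun x => 2 * (L.eval x * ((x - c) * L.derivative.eval x)) := by
      funext x; simp [derivative_mul]; ring
    rw [e, intervalIntegral.integral_const_mul] at hparts
    simp only [derivative_sub, derivative_X, derivative_C, sub_zero, eval_one, one_mul, eval_mul,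
      eval_sub, eval_X, eval_C, hLb, hLa] at hparts
    rw [← hI, ← hJ] at hparts
    rw [hparts]; ring
  have h3 : (2 * m + 1 : ℝ) ≠ 0 := by positivity
  field_simp
  linear_combination h2 - 2 * h1

/-- The reproducing kernel, with one variable frozen at `x₀`, of the polynomials of degree at most
`k` on `(a, b)`. -/
noncomputable def kerP (a b : ℝ) (k : ℕ) (x₀ : ℝ) : ℝ[X] :=
  ∑ m ∈ Finset.range (k + 1), C ((2 * m + 1) / (b - a) * legendre a b m x₀) * legP a b m

theorem kerP_mem (hab : a < b) (k : ℕ) (x₀ : ℝ) : kerP a b k x₀ ∈ degreeLT ℝ (k + 1) := by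
  refine Submodule.sum_mem _ fun m hm => ?_
  rw [← smul_eq_C_mul]
  exact Submodule.smul_mem _ _ (legP_mem hab (Finset.mem_range.1 hm))

theorem integral_mul_kerP {v : ℝ → ℝ} (hv : IntervalIntegrable v volume a b) (k : ℕ) (x₀ : ℝ) :
    ∫ x in a..b, v x * (kerP a b k x₀).eval x = ∑ m ∈ Finset.range (k + 1),
      (2 * m + 1) / (b - a) * legendre a b m x₀ * ∫ x in a..b, v x * (legP a b m).eval x := by
  simp only [kerP, eval_finsetSum, Finset.mul_sum, eval_mul, eval_C]
  rw [intervalIntegral.integral_finsetSum]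
  · refine Finset.sum_congr rfl fun m _ => ?_
    rw [← intervalIntegral.integral_const_mul]
    congr 1; funext x; ring
  · intro m _
    exact hv.mul_continuousOn (by fun_prop)

/-- A polynomial of degree at most `k` is a multiple of the Legendre polynomial up to lower degree.
-/
theorem exists_eq_smul_legP_add (hab : a < b) {k : ℕ} {w : ℝ[X]} (hw : w ∈ degreeLT ℝ (k + 1)) :
    ∃ (s : ℝ) (r : ℝ[X]), r ∈ degreeLT ℝ k ∧ w = C s * legP a b k + r := by
  have hlead : (legP a b k).coeff k ≠ 0 := by
    have h := leadingCoeff_ne_zero.2 (legP_ne_zero hab k)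
    rwa [leadingCoeff, natDegree_legP hab] at h
  refine ⟨w.coeff k / (legP a b k).coeff k,
    w - C (w.coeff k / (legP a b k).coeff k) * legP a b k, ?_, by ring⟩
  rw [mem_degreeLT, degree_lt_iff_coeff_zero] at hw ⊢
  intro i hi
  rw [coeff_sub, coeff_C_mul]
  rcases hi.eq_or_lt with rfl | hi
  · field_simp; ring
  · rw [hw i (by omega), coeff_eq_zero_of_natDegree_lt (p := legP a b k) (n := i)
      (by rw [natDegree_legP hab]; omega)]
    simp

/-- The reproducing property. -/
theorem integral_mul_kerP_eval (hab : a < b) {k : ℕ} {p : ℝ[X]} (hp : p ∈ degreeLT ℝ (k + 1))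
    (x₀ : ℝ) : ∫ x in a..b, p.eval x * (kerP a b k x₀).eval x = p.eval x₀ := by
  have key : ∀ n (p : ℝ[X]), p ∈ degreeLT ℝ n → ∑ m ∈ Finset.range n,
      (2 * m + 1) / (b - a) * legendre a b m x₀ * ∫ x in a..b, p.eval x * (legP a b m).eval x
      = p.eval x₀ := by
    intro n
    induction n with
    | zero =>
      intro p hp
      have : p = 0 := by rw [mem_degreeLT] at hp; simpa using hp
      simp [this]
    | succ n ih =>
      intro p hp
      obtain ⟨s, r, hr, rfl⟩ := exists_eq_smul_legP_add hab hp
      have hint : ∀ m, ∫ x in a..b, (C s * legP a b n + r).eval x * (legP a b m).eval x =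
          s * (∫ x in a..b, (legP a b n).eval x * (legP a b m).eval x) +
            ∫ x in a..b, r.eval x * (legP a b m).eval x := by
        intro m
        rw [← intervalIntegral.integral_const_mul, ← intervalIntegral.integral_add]
        · congr 1; funext x; simp; ring
        all_goals exact Continuous.intervalIntegrable (by fun_prop) _ _
      rw [Finset.sum_range_succ]
      have h1 : ∑ m ∈ Finset.range n, (2 * m + 1) / (b - a) * legendre a b m x₀ *
          ∫ x in a..b, (C s * legP a b n + r).eval x * (legP a b m).eval x = r.eval x₀ := by
        rw [← ih r hr]
        refine Finset.sum_congr rfl fun m hm => ?_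
        rw [hint m, integral_legP_mul_eq_zero hab (legP_mem hab (Finset.mem_range.1 hm))]
        ring
      have h2 : ∫ x in a..b, r.eval x * (legP a b n).eval x = 0 := by
        rw [← integral_legP_mul_eq_zero hab hr]
        congr 1; funext x; ring
      rw [h1, hint n, h2, integral_legP_sq hab]
      have h3 : (2 * n + 1 : ℝ) ≠ 0 := by positivity
      have h4 : b - a ≠ 0 := by linarith
      simp only [eval_add, eval_mul, eval_C, eval_legP]
      field_simp
      ring
  rw [integral_mul_kerP (intervalIntegrable_eval _ _ _)]
  exact key _ _ hp

/-! ### Bounds for Legendre polynomials and inverse inequalities -/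

/-- `Λ` bounds the Legendre polynomials of degree at most `k` on every cell, and bounds their
derivatives up to the natural scaling. -/
def LegBound (k : ℕ) (Λ : ℝ) : Prop :=
  1 ≤ Λ ∧ ∀ a b : ℝ, a < b → ∀ m ≤ k, ∀ x ∈ Icc a b,
    |(legP a b m).eval x| ≤ Λ ∧ |(legP a b m).derivative.eval x| ≤ Λ / (b - a)

theorem abs_eval_le_sum_abs_coeff (p : ℝ[X]) {y : ℝ} (hy : y ∈ Icc (0 : ℝ) 1) :
    |p.eval y| ≤ ∑ i ∈ p.support, |p.coeff i| := by
  rw [eval_eq_sum, Polynomial.sum]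
  refine (Finset.abs_sum_le_sum_abs _ _).trans (Finset.sum_le_sum fun i _ => ?_)
  rw [abs_mul]
  refine mul_le_of_le_one_right (abs_nonneg _) ?_
  rw [abs_of_nonneg (pow_nonneg hy.1 _)]
  exact pow_le_one₀ hy.1 hy.2

/-- By the affine map to `[0, 1]`, where the sum of the absolute values of the coefficients is a
bound, the constant does not depend on the cell. -/
theorem exists_legBound (k : ℕ) : ∃ Λ, LegBound k Λ := by
  set P := fun m => (shiftedLegendre m).map (Int.castRingHom ℝ) with hP
  set S := fun p : ℝ[X] => ∑ i ∈ p.support, |p.coeff i| with hS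
  have hS0 : ∀ p, 0 ≤ S p := fun p => Finset.sum_nonneg fun i _ => abs_nonneg _
  refine ⟨1 + ∑ m ∈ Finset.range (k + 1), (S (P m) + S (P m).derivative), ?_, ?_⟩
  · have : 0 ≤ ∑ m ∈ Finset.range (k + 1), (S (P m) + S (P m).derivative) :=
      Finset.sum_nonneg fun m _ => add_nonneg (hS0 _) (hS0 _)
    linarith
  · intro a b hab m hm x hx
    have hh : 0 < b - a := by linarith
    have hle : S (P m) + S (P m).derivative ≤
        ∑ m ∈ Finset.range (k + 1), (S (P m) + S (P m).derivative) :=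
      Finset.single_le_sum (f := fun m => S (P m) + S (P m).derivative)
        (fun m _ => add_nonneg (hS0 _) (hS0 _)) (Finset.mem_range.2 (by omega))
    have hy : b / (b - a) - 1 / (b - a) * x ∈ Icc (0 : ℝ) 1 := by
      have : b / (b - a) - 1 / (b - a) * x = (b - x) / (b - a) := by ring
      rw [this]
      exact ⟨div_nonneg (by linarith [hx.2]) hh.le, (div_le_one hh).2 (by linarith [hx.1])⟩
    constructor
    · have e : (legP a b m).eval x = (P m).eval (b / (b - a) - 1 / (b - a) * x) := by
        rw [legP, eval_comp]; simp [hP]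
      rw [e]
      have := abs_eval_le_sum_abs_coeff (P m) hy
      linarith [hS0 (P m).derivative]
    · have e : (legP a b m).derivative.eval x =
          -(1 / (b - a)) * (P m).derivative.eval (b / (b - a) - 1 / (b - a) * x) := by
        rw [legP, derivative_comp, eval_mul, eval_comp]; simp [hP]
      rw [e, abs_mul, abs_neg, abs_of_pos (by positivity : 0 < 1 / (b - a)), mul_comm,
        ← div_eq_mul_one_div]
      have := abs_eval_le_sum_abs_coeff (P m).derivative hy
      refine div_le_div_of_nonneg_right ?_ hh.le
      linarith [hS0 (P m)]

/-- The constant in the bounds for the reproducing kernel. -/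
noncomputable def kerConst (k : ℕ) (Λ : ℝ) : ℝ := (k + 1) * (2 * k + 1) * Λ ^ 2

theorem one_le_kerConst {k : ℕ} {Λ : ℝ} (hΛ : LegBound k Λ) : 1 ≤ kerConst k Λ := by
  have h1 : 1 ≤ Λ ^ 2 := one_le_pow₀ hΛ.1
  have h2 : (1 : ℝ) ≤ (k + 1) * (2 * k + 1) := by
    have : (0 : ℝ) ≤ k := Nat.cast_nonneg k
    nlinarith
  exact one_le_mul_of_one_le_of_one_le h2 h1

theorem abs_sum_legP_le {k : ℕ} {Λ : ℝ} (hΛ : LegBound k Λ) (hab : a < b)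
    {f : ℕ → ℝ} {B : ℝ} (hB : 0 ≤ B) (hf : ∀ m ≤ k, |f m| ≤ B) {y : ℝ} (hy : y ∈ Icc a b) :
    |∑ m ∈ Finset.range (k + 1), (2 * m + 1) / (b - a) * f m * (legP a b m).eval y| ≤
      (k + 1) * (2 * k + 1) * Λ * B / (b - a) := by
  have hh : 0 < b - a := by linarith
  have h0 : 0 ≤ Λ := zero_le_one.trans hΛ.1
  refine (Finset.abs_sum_le_sum_abs _ _).trans ?_
  have : ∀ m ∈ Finset.range (k + 1),
      |(2 * m + 1) / (b - a) * f m * (legP a b m).eval y| ≤ (2 * k + 1) / (b - a) * B * Λ := by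
    intro m hm
    have hm' : m ≤ k := by simpa [Nat.lt_succ_iff] using hm
    rw [abs_mul, abs_mul, abs_of_nonneg (by positivity : 0 ≤ (2 * (m : ℝ) + 1) / (b - a))]
    gcongr
    · exact hf m hm'
    · exact (hΛ.2 a b hab m hm' y hy).1
  refine (Finset.sum_le_sum this).trans_eq ?_
  simp
  ring

theorem abs_kerP_le {k : ℕ} {Λ : ℝ} (hΛ : LegBound k Λ) (hab : a < b) {x y : ℝ}
    (hx : x ∈ Icc a b) (hy : y ∈ Icc a b) :
    |(kerP a b k x).eval y| ≤ kerConst k Λ / (b - a) := by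
  have h := abs_sum_legP_le hΛ hab (f := fun m => legendre a b m x) (zero_le_one.trans hΛ.1)
    (fun m hm => by rw [← eval_legP]; exact (hΛ.2 a b hab m hm x hx).1) hy
  have e : (kerP a b k x).eval y = ∑ m ∈ Finset.range (k + 1),
      (2 * m + 1) / (b - a) * legendre a b m x * (legP a b m).eval y := by
    simp [kerP, eval_finsetSum]
  rw [e]
  refine h.trans_eq ?_
  rw [kerConst]; ring

/-- Inverse inequality for point values. -/
theorem sq_eval_le {k : ℕ} {Λ : ℝ} (hΛ : LegBound k Λ) (hab : a < b) {p : ℝ[X]}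
    (hp : p ∈ degreeLT ℝ (k + 1)) {x : ℝ} (hx : x ∈ Icc a b) :
    (p.eval x) ^ 2 ≤ kerConst k Λ / (b - a) * ∫ y in a..b, p.eval y * p.eval y := by
  have h1 := sq_integral_eval_mul_le hab.le p (kerP a b k x)
  rw [integral_mul_kerP_eval hab hp, integral_mul_kerP_eval hab (kerP_mem hab k x)] at h1
  have h2 := (le_abs_self _).trans (abs_kerP_le hΛ hab hx hx)
  have h3 := integral_sq_eval_nonneg hab.le p
  rw [mul_comm (kerConst k Λ / (b - a))]
  exact h1.trans (mul_le_mul_of_nonneg_left h2 h3)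

/-- Inverse inequality for the derivative. -/
theorem integral_sq_derivative_le {k : ℕ} {Λ : ℝ} (hΛ : LegBound k Λ) (hab : a < b) {p : ℝ[X]}
    (hp : p ∈ degreeLT ℝ (k + 1)) :
    ∫ y in a..b, p.derivative.eval y * p.derivative.eval y ≤
      (kerConst k Λ / (b - a)) ^ 2 * ∫ y in a..b, p.eval y * p.eval y := by
  have hh : 0 < b - a := by linarith
  set I := ∫ y in a..b, p.eval y * p.eval y with hI
  have hI0 : 0 ≤ I := integral_sq_eval_nonneg hab.le p
  have hpt : ∀ x ∈ Icc a b, p.derivative.eval x * p.derivative.eval x ≤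
      (kerConst k Λ / (b - a)) ^ 2 * I / (b - a) := by
    intro x hx
    set K : ℝ[X] := ∑ m ∈ Finset.range (k + 1),
      C ((2 * m + 1) / (b - a) * (legP a b m).derivative.eval x) * legP a b m with hK
    have hev : ∀ y, K.eval y = ∑ m ∈ Finset.range (k + 1),
        (2 * m + 1) / (b - a) * (legP a b m).derivative.eval x * (legP a b m).eval y := by
      intro y; simp [hK, eval_finsetSum]
    have hrep : ∫ y in a..b, p.eval y * K.eval y = p.derivative.eval x := by
      have hpe : p = ∑ m ∈ Finset.range (k + 1), C ((2 * m + 1) / (b - a) *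
          ∫ y in a..b, p.eval y * (legP a b m).eval y) * legP a b m := by
        refine Polynomial.funext fun z => ?_
        rw [← integral_mul_kerP_eval hab hp z, integral_mul_kerP (intervalIntegrable_eval _ _ _),
          eval_finsetSum]
        refine Finset.sum_congr rfl fun m _ => ?_
        rw [eval_mul, eval_C, eval_legP]; ring
      have h1 : p.derivative.eval x = ∑ m ∈ Finset.range (k + 1), ((2 * m + 1) / (b - a) *
          ∫ y in a..b, p.eval y * (legP a b m).eval y) * (legP a b m).derivative.eval x := by
        conv_lhs => rw [hpe]
        simp [eval_finsetSum]
      rw [h1]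
      simp only [hev, Finset.mul_sum]
      rw [intervalIntegral.integral_finsetSum]
      · refine Finset.sum_congr rfl fun m _ => ?_
        rw [mul_right_comm, ← intervalIntegral.integral_const_mul]
        congr 1; funext y; ring
      · intro m _
        exact Continuous.intervalIntegrable (by fun_prop) _ _
    have hKb : ∀ y ∈ Icc a b, |K.eval y| ≤ kerConst k Λ / (b - a) / (b - a) := by
      intro y hy
      rw [hev]
      refine (abs_sum_legP_le hΛ hab (f := fun m => (legP a b m).derivative.eval x)
        (div_nonneg (zero_le_one.trans hΛ.1) hh.le)
        (fun m hm => (hΛ.2 a b hab m hm x hx).2) hy).trans_eq ?_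
      rw [kerConst]; ring
    have hKK : ∫ y in a..b, K.eval y * K.eval y ≤ (kerConst k Λ / (b - a)) ^ 2 / (b - a) := by
      calc _ ≤ ∫ y in a..b, (kerConst k Λ / (b - a) / (b - a)) ^ 2 := by
            refine intervalIntegral.integral_mono_on hab.le (intervalIntegrable_eval_mul _ _ _ _)
              (by simp) fun y hy => ?_
            rw [← pow_two, ← sq_abs]
            exact pow_le_pow_left₀ (abs_nonneg _) (hKb y hy) 2
        _ = _ := by simp; field_simp
    have := sq_integral_eval_mul_le hab.le p K
    rw [hrep] at this
    rw [← pow_two]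
    refine this.trans ((mul_le_mul_of_nonneg_left hKK hI0).trans_eq ?_)
    ring
  calc _ ≤ ∫ _ in a..b, (kerConst k Λ / (b - a)) ^ 2 * I / (b - a) :=
        intervalIntegral.integral_mono_on hab.le (intervalIntegrable_eval_mul _ _ _ _)
          (by simp) hpt
    _ = _ := by simp; field_simp

end

/-! ### Gauss-Radau projections on a cell -/

/-- The flux with the roles of `u` and `q` exchanged. It is also used to name the end of a cell:
the end that goes with a flux is the one where the trace of `u` is taken. -/
def Flux.swap : Flux → Flux
  | .minusPlus => .plusMinus
  | .plusMinus => .minusPlus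

/-- The end of the cell `(a, b)` at which the flux takes the trace of `u`. -/
def endpt (a b : ℝ) : Flux → ℝ
  | .minusPlus => b
  | .plusMinus => a

/-- The coefficient of the Legendre polynomial of degree `k` in `v - P v`, for the Gauss-Radau
projection `P` that goes with `u` for the given flux. -/
noncomputable def coefF (k : ℕ) (a b : ℝ) (v : ℝ → ℝ) : Flux → ℝ
  | .minusPlus => coefMinus k a b v
  | .plusMinus => coefPlus k a b v

/-- The value of the Legendre polynomial of degree `k` at `endpt`. -/
def endSign (k : ℕ) : Flux → ℝ
  | .minusPlus => 1
  | .plusMinus => (-1) ^ k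

section

variable {a b : ℝ}

theorem endpt_mem (hab : a < b) (F : Flux) : endpt a b F ∈ Icc a b := by
  cases F
  · exact right_mem_Icc.2 hab.le
  · exact left_mem_Icc.2 hab.le

theorem legendre_endpt (hab : a < b) (k : ℕ) (F : Flux) :
    legendre a b k (endpt a b F) = endSign k F := by
  cases F
  · exact legendre_right a b k
  · exact legendre_left hab k

theorem endSign_mul_self (k : ℕ) (F : Flux) : endSign k F * endSign k F = 1 := by
  cases F
  · simp [endSign]
  · simp [endSign, ← pow_add, ← two_mul]

theorem abs_endSign (k : ℕ) (F : Flux) : |endSign k F| = 1 := by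
  cases F <;> simp [endSign]

theorem isRadau_radauU (k : ℕ) (hab : a < b) {v : ℝ → ℝ} (hv : ContinuousOn v (Icc a b))
    (F : Flux) : IsRadau k a b (endpt a b F) v (radauU k a b v F) := by
  have hi : IntervalIntegrable v volume a b := hv.intervalIntegrable_of_Icc hab.le
  cases F
  · exact Classical.epsilon_spec (existsUnique_isRadau hab (Or.inr rfl) hi).exists
  · exact Classical.epsilon_spec (existsUnique_isRadau hab (Or.inl rfl) hi).exists

/-- The explicit Legendre coefficient compares the point value of `v` at the end with that of its
`L²` projection, since the sums in its definition are the reproducing kernel at that end. -/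
theorem coefF_eq (k : ℕ) (hab : a < b) (v : ℝ → ℝ) (F : Flux) :
    coefF k a b v F = endSign k F *
      (-v (endpt a b F) + ∫ x in a..b, v x * (kerP a b k (endpt a b F)).eval x) := by
  have hk : ∀ c x, (kerP a b k c).eval x = ∑ m ∈ Finset.range (k + 1),
      (2 * m + 1) / (b - a) * legendre a b m c * legendre a b m x := fun c x => by
    simp [kerP, eval_finsetSum, eval_legP]
  cases F
  · simp only [coefF, coefMinus, endSign, endpt, one_mul]
    rw [← intervalIntegral.integral_const_mul]
    congr 2
    funext x
    rw [hk, mul_left_comm, Finset.mul_sum]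
    congr 1
    refine Finset.sum_congr rfl fun m _ => ?_
    rw [legendre_right]; ring
  · simp only [coefF, coefPlus, endSign, endpt]
    rw [mul_add, ← intervalIntegral.integral_const_mul, ← intervalIntegral.integral_const_mul]
    congr 1
    · ring
    · congr 1
      funext x
      have hs : (-1) ^ k * (kerP a b k a).eval x = (b - a)⁻¹ * ∑ m ∈ Finset.range (k + 1),
          (-1) ^ (k + m) * (2 * m + 1 : ℝ) * legendre a b m x := by
        rw [hk, Finset.mul_sum, Finset.mul_sum]
        refine Finset.sum_congr rfl fun m _ => ?_
        rw [legendre_left hab]; ring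
      linear_combination (-v x) * hs

theorem integral_sub_eval_mul {v : ℝ → ℝ} (hab : a < b) (hv : ContinuousOn v (Icc a b))
    (p w : ℝ[X]) : ∫ x in a..b, (v x - p.eval x) * w.eval x =
      (∫ x in a..b, v x * w.eval x) - ∫ x in a..b, p.eval x * w.eval x := by
  rw [← intervalIntegral.integral_sub]
  · congr 1; funext x; ring
  · exact (hv.intervalIntegrable_of_Icc hab.le).mul_continuousOn (by fun_prop)
  · exact intervalIntegrable_eval_mul _ _ _ _

/-- On polynomials of degree at most `k`, the projection error acts as a multiple of the Legendre
polynomial of degree `k`. -/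
theorem integral_sub_radauU_mul (k : ℕ) (hab : a < b) {v : ℝ → ℝ} (hv : ContinuousOn v (Icc a b))
    (F : Flux) {w : ℝ[X]} (hw : w ∈ degreeLT ℝ (k + 1)) :
    ∫ x in a..b, (v x - (radauU k a b v F).eval x) * w.eval x =
      coefF k a b v F * ∫ x in a..b, (legP a b k).eval x * w.eval x := by
  obtain ⟨hp1, hp2, hp3⟩ := isRadau_radauU k hab hv F
  set p := radauU k a b v F
  have hlow : ∀ w ∈ degreeLT ℝ k, ∫ x in a..b, (v x - p.eval x) * w.eval x = 0 := by
    intro w hw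
    rw [integral_sub_eval_mul hab hv, hp2 w hw, sub_self]
  have hcont : IntervalIntegrable (fun x => v x - p.eval x) volume a b :=
    (hv.intervalIntegrable_of_Icc hab.le).sub (intervalIntegrable_eval _ _ _)
  -- the coefficient is the moment of the projection error against the reproducing kernel
  have hcoef : coefF k a b v F = (2 * k + 1) / (b - a) *
      ∫ x in a..b, (v x - p.eval x) * (legP a b k).eval x := by
    have h1 := integral_mul_kerP hcont k (endpt a b F)
    rw [Finset.sum_range_succ, Finset.sum_eq_zero, zero_add, legendre_endpt hab,
      integral_sub_eval_mul hab hv, integral_mul_kerP_eval hab hp1, hp3] at h1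
    · rw [coefF_eq k hab, neg_add_eq_sub, h1]
      linear_combination ((2 * k + 1) / (b - a) *
        ∫ x in a..b, (v x - p.eval x) * (legP a b k).eval x) * endSign_mul_self k F
    · intro m hm
      rw [hlow _ (legP_mem hab (Finset.mem_range.1 hm)), mul_zero]
  obtain ⟨s, r, hr, rfl⟩ := exists_eq_smul_legP_add hab hw
  have h1 : ∫ x in a..b, (v x - p.eval x) * (C s * legP a b k + r).eval x =
      s * ∫ x in a..b, (v x - p.eval x) * (legP a b k).eval x := by
    have e : (fun x => (v x - p.eval x) * (C s * legP a b k + r).eval x) = fun x =>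
        s * ((v x - p.eval x) * (legP a b k).eval x) + (v x - p.eval x) * r.eval x := by
      funext x; simp; ring
    rw [e, intervalIntegral.integral_add, hlow r hr, intervalIntegral.integral_const_mul, add_zero]
    · exact (hcont.mul_continuousOn (by fun_prop)).const_mul _
    · exact hcont.mul_continuousOn (by fun_prop)
  have h2 : ∫ x in a..b, (legP a b k).eval x * (C s * legP a b k + r).eval x =
      s * ((b - a) / (2 * k + 1)) := by
    have e : (fun x => (legP a b k).eval x * (C s * legP a b k + r).eval x) = fun x =>
        s * ((legP a b k).eval x * (legP a b k).eval x) + (legP a b k).eval x * r.eval x := by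
      funext x; simp; ring
    rw [e, intervalIntegral.integral_add, integral_legP_mul_eq_zero hab hr,
      intervalIntegral.integral_const_mul, integral_legP_sq hab, add_zero]
    all_goals exact Continuous.intervalIntegrable (by fun_prop) _ _
  rw [h1, h2, hcoef]
  have h3 : (2 * k + 1 : ℝ) ≠ 0 := by positivity
  have h4 : b - a ≠ 0 := by linarith
  field_simp

/-! ### Stability and approximation -/

theorem abs_integral_mul_kerP_le {k : ℕ} {Λ : ℝ} (hΛ : LegBound k Λ) (hab : a < b) {v : ℝ → ℝ}
    {S : ℝ} (hS : ∀ x ∈ Icc a b, |v x| ≤ S) {x : ℝ} (hx : x ∈ Icc a b) :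
    |∫ y in a..b, v y * (kerP a b k x).eval y| ≤ kerConst k Λ * S := by
  have hh : 0 < b - a := by linarith
  have hS0 : 0 ≤ S := (abs_nonneg _).trans (hS x hx)
  have := intervalIntegral.norm_integral_le_of_norm_le_const (a := a) (b := b)
    (f := fun y => v y * (kerP a b k x).eval y) (C := S * (kerConst k Λ / (b - a))) fun y hy => by
      rw [uIoc_of_le hab.le] at hy
      have hy' : y ∈ Icc a b := ⟨hy.1.le, hy.2⟩
      rw [Real.norm_eq_abs, abs_mul]
      exact mul_le_mul (hS y hy') (abs_kerP_le hΛ hab hx hy') (abs_nonneg _) hS0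
  rw [Real.norm_eq_abs, abs_of_pos hh] at this
  refine this.trans_eq ?_
  field_simp

theorem abs_coefF_le {k : ℕ} {Λ : ℝ} (hΛ : LegBound k Λ) (hab : a < b) {v : ℝ → ℝ}
    {S : ℝ} (hS : ∀ x ∈ Icc a b, |v x| ≤ S) (F : Flux) :
    |coefF k a b v F| ≤ (1 + kerConst k Λ) * S := by
  rw [coefF_eq k hab, abs_mul, abs_endSign, one_mul]
  have h1 := abs_integral_mul_kerP_le hΛ hab hS (endpt_mem hab F)
  have h2 := hS _ (endpt_mem hab F)
  calc _ ≤ |-v (endpt a b F)| + |∫ y in a..b, v y * (kerP a b k (endpt a b F)).eval y| :=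
        abs_add_le _ _
    _ ≤ _ := by rw [abs_neg]; linarith

/-- The coefficient vanishes on polynomials of degree at most `k`. -/
theorem coefF_sub_eval (k : ℕ) (hab : a < b) {v : ℝ → ℝ} (hv : ContinuousOn v (Icc a b))
    {p : ℝ[X]} (hp : p ∈ degreeLT ℝ (k + 1)) (F : Flux) :
    coefF k a b (fun x => v x - p.eval x) F = coefF k a b v F := by
  rw [coefF_eq k hab, coefF_eq k hab, integral_sub_eval_mul hab hv, integral_mul_kerP_eval hab hp]
  ring

/-- The stability constant of the Gauss-Radau projections in the maximum norm. -/
noncomputable def radConst (k : ℕ) (Λ : ℝ) : ℝ := kerConst k Λ + (1 + kerConst k Λ) * Λ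

theorem one_le_radConst {k : ℕ} {Λ : ℝ} (hΛ : LegBound k Λ) : 1 ≤ radConst k Λ := by
  have h1 := one_le_kerConst hΛ
  have h2 := hΛ.1
  unfold radConst
  nlinarith

/-- Stability in the maximum norm: the Gauss-Radau projection is the `L²` projection minus the
multiple `coefF` of the Legendre polynomial. -/
theorem abs_radauU_le {k : ℕ} {Λ : ℝ} (hΛ : LegBound k Λ) (hab : a < b) {v : ℝ → ℝ}
    (hv : ContinuousOn v (Icc a b)) {S : ℝ} (hS : ∀ x ∈ Icc a b, |v x| ≤ S) (F : Flux) {x : ℝ}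
    (hx : x ∈ Icc a b) : |(radauU k a b v F).eval x| ≤ radConst k Λ * S := by
  have hp := isRadau_radauU k hab hv F
  have h1 := integral_sub_radauU_mul k hab hv F (kerP_mem hab k x)
  rw [integral_sub_eval_mul hab hv, integral_mul_kerP_eval hab hp.1,
    integral_mul_kerP_eval hab (legP_mem hab (Nat.lt_succ_self k))] at h1
  have h2 : (radauU k a b v F).eval x = (∫ y in a..b, v y * (kerP a b k x).eval y)
      - coefF k a b v F * (legP a b k).eval x := by linarith
  rw [h2]
  have h3 := abs_integral_mul_kerP_le hΛ hab hS hx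
  have h4 := abs_coefF_le hΛ hab hS F
  have h5 := (hΛ.2 a b hab k le_rfl x hx).1
  calc _ ≤ _ := abs_sub _ _
    _ ≤ kerConst k Λ * S + (1 + kerConst k Λ) * S * Λ := by
      rw [abs_mul]
      exact add_le_add h3 (mul_le_mul h4 h5 (abs_nonneg _) ((abs_nonneg _).trans h4))
    _ = _ := by rw [radConst]; ring

theorem exists_antiderivative {n : ℕ} {p : ℝ[X]} (hp : p ∈ degreeLT ℝ n) :
    ∃ P ∈ degreeLT ℝ (n + 1), P.derivative = p := by
  refine ⟨∑ i ∈ Finset.range n, C (p.coeff i / (i + 1)) * X ^ (i + 1), ?_, ?_⟩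
  · refine Submodule.sum_mem _ fun i hi => ?_
    rw [mem_degreeLT]
    refine (degree_C_mul_X_pow_le _ _).trans_lt ?_
    exact_mod_cast Nat.succ_lt_succ (Finset.mem_range.1 hi)
  · ext i
    simp only [derivative_sum, derivative_C_mul_X_pow, finsetSum_coeff, coeff_C_mul_X_pow,
      add_tsub_cancel_right]
    rw [mem_degreeLT, degree_lt_iff_coeff_zero] at hp
    by_cases hi : i < n
    · rw [Finset.sum_eq_single i]
      · have : (i + 1 : ℝ) ≠ 0 := by positivity
        simp; field_simp
      · intro j _ hj; simp [hj.symm]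
      · intro h; exact absurd (Finset.mem_range.2 hi) h
    · rw [hp i (by omega)]
      refine Finset.sum_eq_zero fun j hj => ?_
      rw [if_neg]
      rintro rfl
      exact hi (Finset.mem_range.1 hj)

/-- Taylor approximation on a cell, obtained by integrating the approximation of the derivative. -/
theorem exists_polynomial_approx (hab : a < b) {n : ℕ} {M : ℝ} (d : ℕ → ℝ → ℝ)
    (hd : ∀ j < n, ∀ x ∈ Icc a b, HasDerivWithinAt (d j) (d (j + 1) x) (Icc a b) x)
    (hM : ∀ x ∈ Icc a b, ∀ y ∈ Icc a b, |d n x - d n y| ≤ M * |x - y|) :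
    ∃ p ∈ degreeLT ℝ (n + 1), ∀ x ∈ Icc a b, |d 0 x - p.eval x| ≤ M * (b - a) ^ (n + 1) := by
  have ha : a ∈ Icc a b := left_mem_Icc.2 hab.le
  have hb : b ∈ Icc a b := right_mem_Icc.2 hab.le
  have hM0 : 0 ≤ M := by
    have := (abs_nonneg _).trans (hM b hb a ha)
    rw [abs_of_pos (by linarith : 0 < b - a)] at this
    exact nonneg_of_mul_nonneg_left this (by linarith)
  induction n generalizing d with
  | zero =>
    refine ⟨C (d 0 a), ?_, fun x hx => ?_⟩
    · rw [mem_degreeLT]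
      exact degree_C_le.trans_lt (by norm_num)
    · rw [eval_C]
      refine (hM x hx a ha).trans ?_
      rw [zero_add, pow_one, abs_of_nonneg (by linarith [hx.1])]
      gcongr
      exact hx.2
  | succ n ih =>
    obtain ⟨p, hp, hpb⟩ := ih (fun j => d (j + 1)) (fun j hj => hd (j + 1) (by omega)) hM
    obtain ⟨P, hP, rfl⟩ := exists_antiderivative hp
    refine ⟨P + C (d 0 a - P.eval a), Submodule.add_mem _ hP ?_, fun x hx => ?_⟩
    · rw [mem_degreeLT]
      exact degree_C_le.trans_lt (by exact_mod_cast Nat.succ_pos _)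
    · have := (convex_Icc a b).norm_image_sub_le_of_norm_hasDerivWithin_le
        (f := fun x => d 0 x - P.eval x) (f' := fun x => d 1 x - P.derivative.eval x)
        (C := M * (b - a) ^ (n + 1))
        (fun y hy => (hd 0 (by omega) y hy).sub (P.hasDerivAt y).hasDerivWithinAt)
        (fun y hy => hpb y hy) ha hx
      simp only [Real.norm_eq_abs] at this
      have e : d 0 x - (P + C (d 0 a - P.eval a)).eval x =
          d 0 x - P.eval x - (d 0 a - P.eval a) := by simp; ring
      rw [e]
      refine this.trans ?_
      rw [pow_succ (b - a) (n + 1), ← mul_assoc, abs_of_nonneg (by linarith [hx.1] : 0 ≤ x - a)]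
      have h0 : 0 ≤ b - a := by linarith
      exact mul_le_mul_of_nonneg_left (by linarith [hx.2]) (by positivity)

/-- The Bramble-Hilbert argument: the coefficient is stable and annihilates the Taylor polynomial.
-/
theorem abs_coefF_le_of_deriv {k : ℕ} {Λ : ℝ} (hΛ : LegBound k Λ) (hab : a < b) {n : ℕ}
    (hn : n ≤ k) {M : ℝ} (d : ℕ → ℝ → ℝ)
    (hd : ∀ j < n, ∀ x ∈ Icc a b, HasDerivWithinAt (d j) (d (j + 1) x) (Icc a b) x)
    (hc : ContinuousOn (d 0) (Icc a b))
    (hM : ∀ x ∈ Icc a b, ∀ y ∈ Icc a b, |d n x - d n y| ≤ M * |x - y|) (F : Flux) :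
    |coefF k a b (d 0) F| ≤ (1 + kerConst k Λ) * (M * (b - a) ^ (n + 1)) := by
  obtain ⟨p, hp, hpb⟩ := exists_polynomial_approx hab d hd hM
  rw [← coefF_sub_eval k hab hc (degreeLT_mono (by omega) hp)]
  exact abs_coefF_le hΛ hab hpb F

/-! ### The iterated corrections -/

theorem hasDerivAt_Dinv {v : ℝ → ℝ} (hv : Continuous v) (a b x : ℝ) :
    HasDerivAt (Dinv a b v) (((b - a) / 2)⁻¹ * v x) x :=
  (intervalIntegral.integral_hasDerivAt_right (hv.intervalIntegrable _ _)
    (hv.stronglyMeasurableAtFilter _ _) hv.continuousAt).const_mul _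

theorem continuous_Dinv {v : ℝ → ℝ} (hv : Continuous v) (a b : ℝ) : Continuous (Dinv a b v) :=
  continuous_iff_continuousAt.2 fun x => (hasDerivAt_Dinv hv a b x).continuousAt

theorem abs_Dinv_le (hab : a < b) {v : ℝ → ℝ} {S : ℝ} (hS : ∀ x ∈ Icc a b, |v x| ≤ S) {x : ℝ}
    (hx : x ∈ Icc a b) : |Dinv a b v x| ≤ 2 * S := by
  have hh : 0 < b - a := by linarith
  have hS0 : 0 ≤ S := (abs_nonneg _).trans (hS x hx)
  have := intervalIntegral.norm_integral_le_of_norm_le_const (a := a) (b := x)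
    (f := v) (C := S) fun y hy => by
      rw [uIoc_of_le hx.1] at hy
      exact hS y ⟨hy.1.le, hy.2.trans hx.2⟩
  rw [Real.norm_eq_abs, abs_of_nonneg (by linarith [hx.1] : 0 ≤ x - a)] at this
  rw [Dinv, abs_mul, abs_of_pos (by positivity : 0 < ((b - a) / 2)⁻¹)]
  calc _ ≤ ((b - a) / 2)⁻¹ * (S * (b - a)) := by
        gcongr
        refine this.trans ?_
        gcongr
        exact hx.2
    _ = _ := by field_simp

/-- The alternating chain of corrections: the Legendre polynomial of degree `k`, and then in turn
`D_s⁻¹` and the two Gauss-Radau projections, such that the last projection is the one that goes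
with `u` for the given flux. -/
noncomputable def chain (k : ℕ) (a b : ℝ) : Flux → ℕ → ℝ[X]
  | _, 0 => legP a b k
  | F, n + 1 => radauU k a b (Dinv a b fun y => (chain k a b F.swap n).eval y) F

theorem swap_swap (F : Flux) : F.swap.swap = F := by cases F <;> rfl

theorem F2_eq_chain (k : ℕ) (a b : ℝ) (i : ℕ) :
    F2 k a b i = chain k a b .minusPlus (2 * i + 1) := by
  induction i with
  | zero => simp [F2, chain, radauU, eval_legP]
  | succ i ih =>
    rw [F2, ih, show 2 * (i + 1) + 1 = (2 * i + 1) + 1 + 1 by ring, chain, chain]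
    rfl

theorem F1_eq_chain (k : ℕ) (a b : ℝ) (i : ℕ) :
    F1 k a b i = chain k a b .plusMinus (2 * i + 1) := by
  induction i with
  | zero => simp [F1, chain, radauU, eval_legP]
  | succ i ih =>
    rw [F1, ih, show 2 * (i + 1) + 1 = (2 * i + 1) + 1 + 1 by ring, chain, chain]
    rfl

theorem F1bar_eq_chain (k : ℕ) (a b : ℝ) (i : ℕ) :
    F1bar k a b i = chain k a b .minusPlus (2 * i + 2) := by
  rw [F1bar, F1_eq_chain, chain]; rfl

theorem F2bar_eq_chain (k : ℕ) (a b : ℝ) (i : ℕ) :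
    F2bar k a b i = chain k a b .plusMinus (2 * i + 2) := by
  rw [F2bar, F2_eq_chain, chain]; rfl

theorem isRadau_chain (k : ℕ) (hab : a < b) (F : Flux) (n : ℕ) :
    IsRadau k a b (endpt a b F) (Dinv a b fun y => (chain k a b F.swap n).eval y)
      (chain k a b F (n + 1)) :=
  isRadau_radauU k hab (continuous_Dinv (by fun_prop) a b).continuousOn F

theorem chain_mem (k : ℕ) (hab : a < b) (F : Flux) (n : ℕ) :
    chain k a b F n ∈ degreeLT ℝ (k + 1) := by
  cases n with
  | zero => exact legP_mem hab (Nat.lt_succ_self k)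
  | succ n => exact (isRadau_chain k hab F n).1

theorem abs_chain_le {k : ℕ} {Λ : ℝ} (hΛ : LegBound k Λ) (hab : a < b) (F : Flux) (n : ℕ) {x : ℝ}
    (hx : x ∈ Icc a b) : |(chain k a b F n).eval x| ≤ (2 * radConst k Λ) ^ n * Λ := by
  induction n generalizing F x with
  | zero => simpa [chain] using (hΛ.2 a b hab k le_rfl x hx).1
  | succ n ih =>
    rw [chain]
    refine (abs_radauU_le hΛ hab (continuous_Dinv (by fun_prop) a b).continuousOn
      (fun y hy => abs_Dinv_le hab (fun z hz => ih F.swap hz) hy) F hx).trans_eq ?_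
    ring

/-- Integration by parts for the antiderivative `D_s⁻¹ p`. -/
theorem integral_Dinv_mul_derivative (hab : a < b) (p w : ℝ[X]) :
    (b - a) / 2 * ∫ x in a..b, Dinv a b (fun y => p.eval y) x * w.derivative.eval x =
      (∫ x in a..b, p.eval x) * w.eval b - ∫ x in a..b, p.eval x * w.eval x := by
  have hh : (b - a) / 2 ≠ 0 := by linarith
  have := intervalIntegral.integral_mul_deriv_eq_deriv_mul (a := a) (b := b)
    (u := Dinv a b fun y => p.eval y) (v := fun x => w.eval x)
    (fun x _ => hasDerivAt_Dinv (by fun_prop) a b x) (fun x _ => w.hasDerivAt x)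
    (Continuous.intervalIntegrable (by fun_prop) _ _) (intervalIntegrable_eval _ _ _)
  rw [this]
  have e : (fun x => ((b - a) / 2)⁻¹ * p.eval x * w.eval x) = fun x =>
      ((b - a) / 2)⁻¹ * (p.eval x * w.eval x) := by funext x; ring
  rw [e, intervalIntegral.integral_const_mul]
  simp only [Dinv, intervalIntegral.integral_same]
  have h1 := mul_inv_cancel₀ hh
  linear_combination ((∫ x in a..b, p.eval x) * w.eval b
    - ∫ x in a..b, p.eval x * w.eval x) * h1

/-- Testing an element of the chain with a derivative gives back its predecessor. -/
theorem integral_chain_succ_mul_derivative (k : ℕ) (hab : a < b) (F : Flux) (n : ℕ) {w : ℝ[X]}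
    (hw : w ∈ degreeLT ℝ (k + 1)) :
    (b - a) / 2 * ∫ x in a..b, (chain k a b F (n + 1)).eval x * w.derivative.eval x =
      (∫ x in a..b, (chain k a b F.swap n).eval x) * w.eval b -
        ∫ x in a..b, (chain k a b F.swap n).eval x * w.eval x := by
  rw [(isRadau_chain k hab F n).2.1 _ (derivative_mem_degreeLT hw),
    integral_Dinv_mul_derivative hab]

/-- Each step of the chain loses one degree of orthogonality. -/
theorem integral_chain_mul_eq_zero (k : ℕ) (hab : a < b) (F : Flux) (n : ℕ) {w : ℝ[X]}
    (hw : w ∈ degreeLT ℝ (k - n)) : ∫ x in a..b, (chain k a b F n).eval x * w.eval x = 0 := by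
  have hh : (b - a) / 2 ≠ 0 := by linarith
  induction n generalizing F w with
  | zero => exact integral_legP_mul_eq_zero hab hw
  | succ n ih =>
    rcases le_or_gt k n with hkn | hkn
    · have : w = 0 := by
        rw [mem_degreeLT, Nat.sub_eq_zero_of_le (by omega)] at hw
        simpa using hw
      simp [this]
    · obtain ⟨W, hW, rfl⟩ := exists_antiderivative hw
      rw [show k - (n + 1) + 1 = k - n by omega] at hW
      have h1 : ∫ x in a..b, (chain k a b F.swap n).eval x = 0 := by
        have := ih F.swap (w := 1) (by
          rw [mem_degreeLT, degree_one]; exact_mod_cast Nat.sub_pos_of_lt hkn)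
        simpa using this
      have h2 := integral_chain_succ_mul_derivative k hab F n
        (degreeLT_mono (show k - n ≤ k + 1 by omega) hW)
      rw [h1, ih F.swap hW, zero_mul, sub_zero] at h2
      exact (mul_eq_zero.1 h2).resolve_left hh

theorem integral_chain_eq_zero {k : ℕ} (hab : a < b) (F : Flux) {n : ℕ} (hn : n < k) :
    ∫ x in a..b, (chain k a b F n).eval x = 0 := by
  have := integral_chain_mul_eq_zero k hab F n (w := 1) (by
    rw [mem_degreeLT, degree_one]; exact_mod_cast Nat.sub_pos_of_lt hn)
  simpa using this

/-- The corrections do not change the trace that enters the flux. -/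
theorem chain_succ_eval_endpt {k : ℕ} (hab : a < b) (F : Flux) {n : ℕ} (hn : n < k) :
    (chain k a b F (n + 1)).eval (endpt a b F) = 0 := by
  rw [(isRadau_chain k hab F n).2.2, Dinv]
  cases F
  · simp [endpt, integral_chain_eq_zero hab _ hn]
  · simp [endpt]

end

/-! ### Weak derivatives in one variable -/

/-- The fundamental lemma of the calculus of variations. -/
theorem ae_eq_zero_of_forall_integral_mul_eq_zero {a b : ℝ} {f : ℝ → ℝ}
    (hf : LocallyIntegrableOn f (Ioo a b))
    (h : ∀ φ : ℝ → ℝ, ContDiff ℝ ∞ φ → HasCompactSupport φ → tsupport φ ⊆ Ioo a b →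
      ∫ x in Ioo a b, f x * φ x = 0) : ∀ᵐ x ∂volume.restrict (Ioo a b), f x = 0 := by
  rw [ae_restrict_iff' measurableSet_Ioo]
  refine isOpen_Ioo.ae_eq_zero_of_integral_contDiff_smul_eq_zero hf fun φ h1 h2 h3 => ?_
  rw [← h φ h1 h2 h3, ← integral_indicator measurableSet_Ioo]
  congr 1
  funext x
  by_cases hx : x ∈ Ioo a b
  · simp [hx, mul_comm]
  · have : φ x = 0 := image_eq_zero_of_notMem_tsupport fun h => hx (h3 h)
    simp [hx, this]

theorem integrableOn_mul_of_tsupport_subset {a b : ℝ} {f φ : ℝ → ℝ}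
    (hf : LocallyIntegrableOn f (Ioo a b)) (h1 : Continuous φ)
    (h2 : HasCompactSupport φ) (h3 : tsupport φ ⊆ Ioo a b) :
    IntegrableOn (fun x => f x * φ x) (Ioo a b) := by
  have hK : IntegrableOn f (tsupport φ) := hf.integrableOn_compact_subset h3 h2
  have h4 : IntegrableOn (fun x => f x * φ x) (tsupport φ) :=
    hK.mul_continuousOn h1.continuousOn h2
  refine h4.of_forall_sdiff_eq_zero measurableSet_Ioo fun x hx => ?_
  rw [image_eq_zero_of_notMem_tsupport hx.2, mul_zero]

theorem IsWeakDeriv.ae_eq {a b : ℝ} {j : ℕ} {f g g' : ℝ → ℝ} (h : IsWeakDeriv a b j f g)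
    (h' : IsWeakDeriv a b j f g') : g =ᵐ[volume.restrict (Ioo a b)] g' := by
  have := ae_eq_zero_of_forall_integral_mul_eq_zero (h.2.1.sub h'.2.1) fun φ h1 h2 h3 => by
    have e := (h.2.2 φ h1 h2 h3).symm.trans (h'.2.2 φ h1 h2 h3)
    have e2 := mul_left_cancel₀ (pow_ne_zero j (by norm_num : (-1 : ℝ) ≠ 0)) e
    simp only [Pi.sub_apply, sub_mul]
    rw [integral_sub (integrableOn_mul_of_tsupport_subset h.2.1 h1.continuous h2 h3)
      (integrableOn_mul_of_tsupport_subset h'.2.1 h1.continuous h2 h3), e2, sub_self]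
  filter_upwards [this] with x hx
  exact sub_eq_zero.1 hx

/-- The weak derivative of order `j + 1` is the weak derivative of the one of order `j`. -/
theorem IsWeakDeriv.integral_mul_deriv {a b : ℝ} {j : ℕ} {f g g' : ℝ → ℝ}
    (h : IsWeakDeriv a b j f g) (h' : IsWeakDeriv a b (j + 1) f g') {φ : ℝ → ℝ}
    (h1 : ContDiff ℝ ∞ φ) (h2 : HasCompactSupport φ) (h3 : tsupport φ ⊆ Ioo a b) :
    ∫ x in Ioo a b, g x * deriv φ x = -∫ x in Ioo a b, g' x * φ x := by
  have e1 := h.2.2 (deriv φ) (contDiff_infty_iff_deriv.1 h1).2 h2.deriv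
    (tsupport_deriv_subset.trans h3)
  have e2 := h'.2.2 φ h1 h2 h3
  rw [← iteratedDeriv_succ', e2, pow_succ, mul_assoc] at e1
  have := mul_left_cancel₀ (pow_ne_zero j (by norm_num : (-1 : ℝ) ≠ 0)) e1
  linarith

theorem intervalIntegral_eq_setIntegral_Ioo {a b : ℝ} (hab : a ≤ b) (f : ℝ → ℝ) :
    ∫ x in a..b, f x = ∫ x in Ioo a b, f x := by
  rw [intervalIntegral.integral_of_le hab, integral_Ioc_eq_integral_Ioo]

/-- The lemma of du Bois-Reymond. -/
theorem exists_ae_eq_const_of_integral_mul_deriv_eq_zero {a b : ℝ} (hab : a < b) {f : ℝ → ℝ}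
    (hf : LocallyIntegrableOn f (Ioo a b))
    (h : ∀ φ : ℝ → ℝ, ContDiff ℝ ∞ φ → HasCompactSupport φ → tsupport φ ⊆ Ioo a b →
      ∫ x in Ioo a b, f x * deriv φ x = 0) :
    ∃ c, ∀ᵐ x ∂volume.restrict (Ioo a b), f x = c := by
  obtain ⟨ψ, hψ1, hψ2, hψ3, hψ4⟩ : ∃ ψ : ℝ → ℝ, ContDiff ℝ ∞ ψ ∧ HasCompactSupport ψ ∧
      tsupport ψ ⊆ Ioo a b ∧ ∫ x in Ioo a b, ψ x = 1 := by
    let B : ContDiffBump ((a + b) / 2) := ⟨(b - a) / 8, (b - a) / 4, by linarith, by linarith⟩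
    have hsub : tsupport (B.normed volume) ⊆ Ioo a b := by
      rw [B.tsupport_normed_eq, Real.closedBall_eq_Icc]
      intro x hx
      have h1 : (a + b) / 2 - (b - a) / 4 ≤ x := hx.1
      have h2 : x ≤ (a + b) / 2 + (b - a) / 4 := hx.2
      constructor <;> linarith
    refine ⟨B.normed volume, B.contDiff_normed, B.hasCompactSupport_normed, hsub, ?_⟩
    rw [setIntegral_eq_integral_of_forall_compl_eq_zero, B.integral_normed]
    exact fun x hx => image_eq_zero_of_notMem_tsupport fun hx' => hx (hsub hx')
  refine ⟨∫ x in Ioo a b, f x * ψ x, ?_⟩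
  set c := ∫ x in Ioo a b, f x * ψ x with hc
  have hfc : LocallyIntegrableOn (fun x => f x - c) (Ioo a b) :=
    hf.sub (locallyIntegrableOn_const c)
  have := ae_eq_zero_of_forall_integral_mul_eq_zero hfc fun η h1 h2 h3 => by
    set s := ∫ x in Ioo a b, η x with hs
    have hηi : IntegrableOn η (Ioo a b) :=
      (h1.continuous.integrable_of_hasCompactSupport h2).integrableOn
    have hψi : IntegrableOn ψ (Ioo a b) :=
      (hψ1.continuous.integrable_of_hasCompactSupport hψ2).integrableOn
    set ζ : ℝ → ℝ := fun x => η x - s * ψ x with hζ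
    have hζc : ContDiff ℝ ∞ ζ := h1.sub (contDiff_const.mul hψ1)
    -- the primitive of `ζ` is a test function, since `ζ` has integral zero
    set φ : ℝ → ℝ := fun x => ∫ y in a..x, ζ y with hφ
    have hd : ∀ x, HasDerivAt φ (ζ x) x := fun x =>
      intervalIntegral.integral_hasDerivAt_right (hζc.continuous.intervalIntegrable _ _)
        (hζc.continuous.stronglyMeasurableAtFilter _ _) hζc.continuous.continuousAt
    have hdφ : deriv φ = ζ := funext fun x => (hd x).deriv
    have hφc : ContDiff ℝ ∞ φ :=
      contDiff_infty_iff_deriv.2 ⟨fun x => (hd x).differentiableAt, hdφ ▸ hζc⟩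
    have hζint : ∫ y in a..b, ζ y = 0 := by
      rw [intervalIntegral_eq_setIntegral_Ioo hab.le, hζ, integral_sub hηi (hψi.const_mul s),
        integral_const_mul, hψ4, ← hs]
      ring
    have hKc : IsCompact (tsupport η ∪ tsupport ψ) := IsCompact.union h2 hψ2
    obtain ⟨c', d', hc', hd', hcd⟩ : ∃ c' d', a < c' ∧ d' < b ∧
        tsupport η ∪ tsupport ψ ⊆ Icc c' d' := by
      rcases (tsupport η ∪ tsupport ψ).eq_empty_or_nonempty with he | hne
      · exact ⟨a + 1, b - 1, by linarith, by linarith, by simp [he]⟩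
      · exact ⟨_, _, (union_subset h3 hψ3 (hKc.sInf_mem hne)).1,
          (union_subset h3 hψ3 (hKc.sSup_mem hne)).2, hKc.isBounded.subset_Icc_sInf_sSup⟩
    have hζ0 : ∀ x, x ∉ Icc c' d' → ζ x = 0 := by
      intro x hx
      have k1 : η x = 0 := image_eq_zero_of_notMem_tsupport fun h => hx (hcd (Or.inl h))
      have k2 : ψ x = 0 := image_eq_zero_of_notMem_tsupport fun h => hx (hcd (Or.inr h))
      simp [hζ, k1, k2]
    have hφ0 : Function.support φ ⊆ Icc c' d' := by
      intro x hx
      by_contra hxc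
      apply hx
      rcases lt_or_ge x c' with hlt | hge
      · refine intervalIntegral.integral_zero_ae (Filter.Eventually.of_forall fun y hy => ?_)
        refine hζ0 y fun hy' => ?_
        have : y ≤ max a x := (uIoc_subset_uIcc hy).2
        exact absurd (hy'.1.trans this) (not_le.2 (max_lt hc' hlt))
      · have hdx : d' < x := lt_of_not_ge fun hle => hxc ⟨hge, hle⟩
        have k1 : ∫ y in b..x, ζ y = 0 := by
          refine intervalIntegral.integral_zero_ae (Filter.Eventually.of_forall fun y hy => ?_)
          refine hζ0 y fun hy' => ?_
          have : min b x ≤ y := (uIoc_subset_uIcc hy).1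
          exact absurd (this.trans hy'.2) (not_le.2 (lt_min hd' hdx))
        have k2 := intervalIntegral.integral_add_adjacent_intervals (μ := volume)
          (hζc.continuous.intervalIntegrable a b) (hζc.continuous.intervalIntegrable b x)
        rw [hζint, k1, add_zero] at k2
        exact k2.symm
    have hφs : tsupport φ ⊆ Icc c' d' := closure_minimal hφ0 isClosed_Icc
    have hcomp : HasCompactSupport φ :=
      HasCompactSupport.of_support_subset_isCompact isCompact_Icc hφ0
    have key := h φ hφc hcomp (hφs.trans fun x hx => ⟨hc'.trans_le hx.1, hx.2.trans_lt hd'⟩)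
    rw [hdφ] at key
    have i1 := integrableOn_mul_of_tsupport_subset hf h1.continuous h2 h3
    have i2 := integrableOn_mul_of_tsupport_subset hf hψ1.continuous hψ2 hψ3
    have e1 : ∫ x in Ioo a b, f x * ζ x = (∫ x in Ioo a b, f x * η x) - s * c := by
      have : (fun x => f x * ζ x) = fun x => f x * η x - s * (f x * ψ x) := by
        funext x; simp [hζ]; ring
      rw [this, integral_sub i1 (i2.const_mul s), integral_const_mul]
    have e2 : ∫ x in Ioo a b, (f x - c) * η x = (∫ x in Ioo a b, f x * η x) - c * s := by
      have : (fun x => (f x - c) * η x) = fun x => f x * η x - c * η x := by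
        funext x; ring
      rw [this, integral_sub i1 (hηi.const_mul c), integral_const_mul]
    rw [e2, mul_comm, ← e1, key]
  filter_upwards [this] with x hx
  exact sub_eq_zero.1 hx

/-- A function with a weak derivative is almost everywhere a primitive of it. -/
theorem exists_ae_eq_const_add_integral {a b : ℝ} (hab : a < b) {f g : ℝ → ℝ}
    (hf : LocallyIntegrableOn f (Ioo a b)) (hg : IntervalIntegrable g volume a b)
    (h : ∀ φ : ℝ → ℝ, ContDiff ℝ ∞ φ → HasCompactSupport φ → tsupport φ ⊆ Ioo a b →
      ∫ x in Ioo a b, f x * deriv φ x = -∫ x in Ioo a b, g x * φ x) :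
    ∃ c, ∀ᵐ x ∂volume.restrict (Ioo a b), f x = c + ∫ y in a..x, g y := by
  set G : ℝ → ℝ := fun x => ∫ y in a..x, g y with hG
  have hac : AbsolutelyContinuousOnInterval G a b :=
    hg.absolutelyContinuousOnInterval_intervalIntegral (by simp)
  have hGc : LocallyIntegrableOn G (Ioo a b) := by
    have := hac.continuousOn.mono (Ioo_subset_Icc_self.trans Icc_subset_uIcc)
    exact this.locallyIntegrableOn measurableSet_Ioo
  obtain ⟨c, hc⟩ := exists_ae_eq_const_of_integral_mul_deriv_eq_zero hab (hf.sub hGc)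
    fun φ h1 h2 h3 => by
      have h1' := (contDiff_infty_iff_deriv.1 h1).2
      have hz : ∀ x, x ∉ Ioo a b → φ x = 0 := fun x hx =>
        image_eq_zero_of_notMem_tsupport fun h => hx (h3 h)
      have hφ : AbsolutelyContinuousOnInterval φ a b := by
        obtain ⟨K, hK⟩ := h1.lipschitzWith_of_hasCompactSupport h2 (by simp)
        exact hK.lipschitzOnWith.absolutelyContinuousOnInterval
      have hparts := hac.integral_mul_deriv_eq_deriv_mul hφ
      rw [hz a (by simp), hz b (by simp), mul_zero, mul_zero, sub_zero, zero_sub] at hparts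
      have hd : ∫ x in a..b, deriv G x * φ x = ∫ x in a..b, g x * φ x := by
        apply intervalIntegral.integral_congr_ae
        filter_upwards [hg.ae_hasDerivAt_integral] with x hx hxm
        rw [(hx (uIoc_subset_uIcc hxm) a (by simp)).deriv]
      rw [hd, intervalIntegral_eq_setIntegral_Ioo hab.le,
        intervalIntegral_eq_setIntegral_Ioo hab.le] at hparts
      have s1 := h2.deriv
      have s2 := tsupport_deriv_subset.trans h3
      simp only [Pi.sub_apply, sub_mul]
      rw [integral_sub (integrableOn_mul_of_tsupport_subset hf h1'.continuous s1 s2)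
        (integrableOn_mul_of_tsupport_subset hGc h1'.continuous s1 s2), h φ h1 h2 h3, hparts,
        sub_self]
  refine ⟨c, ?_⟩
  filter_upwards [hc] with x hx
  have : f x - G x = c := hx
  linarith

/-- Bounded weak derivatives up to order `n + 1` of a continuous function give classical
derivatives up to order `n` on the closed interval, with the same bounds. -/
theorem exists_classical_derivs {a b : ℝ} (hab : a < b) {f : ℝ → ℝ}
    (hf : ContinuousOn f (Icc a b)) {n : ℕ} {S : ℝ}
    (hw : ∀ j ≤ n + 1, ∃ g, IsWeakDeriv a b j f g ∧
      ∀ᵐ x ∂volume.restrict (Ioo a b), |g x| ≤ S) :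
    ∃ d : ℕ → ℝ → ℝ, d 0 = f ∧
      (∀ j < n, ∀ x ∈ Icc a b, HasDerivWithinAt (d j) (d (j + 1) x) (Icc a b) x) ∧
      (∀ j ≤ n, ∀ x ∈ Icc a b, |d j x| ≤ S) ∧
      ∀ j ≤ n, ∀ x ∈ Icc a b, ∀ y ∈ Icc a b, |d j x - d j y| ≤ S * |x - y| := by
  choose! g₀ hg₀ hgS₀ using hw
  set g : ℕ → ℝ → ℝ := fun j => (Ioo a b).indicator (g₀ j) with hgdef
  have hgg : ∀ j, g j =ᵐ[volume.restrict (Ioo a b)] g₀ j := fun j =>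
    indicator_ae_eq_restrict measurableSet_Ioo
  have hS0 : 0 ≤ S := by
    have h1 := hgS₀ 0 (by omega)
    rw [ae_restrict_iff' measurableSet_Ioo] at h1
    by_contra hneg
    have : ∀ᵐ x ∂volume.restrict (Ioo a b), False := by
      filter_upwards [hgS₀ 0 (by omega)] with x hx
      exact hneg ((abs_nonneg _).trans hx)
    rw [Filter.eventually_false_iff_eq_bot, ae_eq_bot, Measure.restrict_eq_zero] at this
    simp at this
    linarith
  have hgS : ∀ j ≤ n + 1, ∀ᵐ x, |g j x| ≤ S := by
    intro j hj
    have := hgS₀ j hj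
    rw [ae_restrict_iff' measurableSet_Ioo] at this
    filter_upwards [this] with x hx
    by_cases hxm : x ∈ Ioo a b
    · simpa [hgdef, hxm] using hx hxm
    · simpa [hgdef, hxm] using hS0
  have hgm : ∀ j ≤ n + 1, AEStronglyMeasurable (g j) volume := by
    intro j hj
    have := (hg₀ j hj).2.1.aestronglyMeasurable
    exact (aestronglyMeasurable_indicator_iff measurableSet_Ioo).2 this
  have hgi : ∀ j ≤ n + 1, ∀ x y, IntervalIntegrable (g j) volume x y := by
    intro j hj x y
    rw [intervalIntegrable_iff]
    refine Measure.integrableOn_of_bounded (M := S) (by simp) (hgm j hj) ?_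
    exact ae_restrict_of_ae (hgS j hj)
  have hrep : ∀ j, j ≤ n → ∃ c, ∀ᵐ x ∂volume.restrict (Ioo a b),
      g₀ j x = c + ∫ y in a..x, g (j + 1) y := by
    intro j hj
    refine exists_ae_eq_const_add_integral hab (hg₀ j (by omega)).2.1
      (hgi (j + 1) (by omega) a b) fun φ h1 h2 h3 => ?_
    rw [(hg₀ j (by omega)).integral_mul_deriv (hg₀ (j + 1) (by omega)) h1 h2 h3]
    congr 1
    refine integral_congr_ae ?_
    filter_upwards [hgg (j + 1)] with x hx
    rw [hx]
  choose! c hc using hrep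
  set e : ℕ → ℝ → ℝ := fun j x => c j + ∫ y in a..x, g (j + 1) y with he
  have hlip : ∀ j ≤ n, ∀ x y, |e j x - e j y| ≤ S * |x - y| := by
    intro j hj x y
    have h1 : e j x - e j y = ∫ t in y..x, g (j + 1) t := by
      simp only [he]
      rw [add_sub_add_left_eq_sub, intervalIntegral.integral_interval_sub_left
        (hgi _ (by omega) _ _) (hgi _ (by omega) _ _)]
    rw [h1]
    have := intervalIntegral.norm_integral_le_of_norm_le_const_ae (a := y) (b := x)
      (f := g (j + 1)) (C := S) (by
        filter_upwards [hgS (j + 1) (by omega)] with t ht _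
        exact ht)
    exact this
  have hcont : ∀ j ≤ n, Continuous (e j) := by
    intro j hj
    refine (LipschitzWith.of_dist_le_mul (K := S.toNNReal) fun x y => ?_).continuous
    rw [Real.dist_eq, Real.dist_eq, Real.coe_toNNReal _ hS0]
    exact hlip j hj x y
  have hbd : ∀ j ≤ n, ∀ x ∈ Icc a b, |e j x| ≤ S := by
    intro j hj
    have hae : ∀ᵐ x ∂volume.restrict (Ioo a b), |e j x| ≤ S := by
      filter_upwards [hc j hj, hgS₀ j (by omega)] with x h1 h2
      rwa [h1] at h2
    have hmin : (fun x => min |e j x| S) =ᵐ[volume.restrict (Icc a b)] fun x => |e j x| := by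
      rw [← Measure.restrict_congr_set (Ioo_ae_eq_Icc (a := a) (b := b))]
      filter_upwards [hae] with x hx
      exact min_eq_left hx
    have hcj := hcont j hj
    have := Measure.eqOn_Icc_of_ae_eq volume hab.ne hmin (by fun_prop) (by fun_prop)
    intro x hx
    exact (this hx).symm.le.trans (min_le_right _ _)
  have hf0 : EqOn f (e 0) (Icc a b) := by
    have h00 : IsWeakDeriv a b 0 f f :=
      ⟨(hg₀ 0 (by omega)).1, (hg₀ 0 (by omega)).1, fun φ _ _ _ => by simp⟩
    refine Measure.eqOn_Icc_of_ae_eq volume hab.ne ?_ hf (hcont 0 (by omega)).continuousOn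
    rw [← Measure.restrict_congr_set (Ioo_ae_eq_Icc (a := a) (b := b))]
    filter_upwards [h00.ae_eq (hg₀ 0 (by omega)), hc 0 (by omega)] with x h1 h2
    rw [h1, h2]
  have hder : ∀ j < n, ∀ x ∈ Icc a b, HasDerivWithinAt (e j) (e (j + 1) x) (Icc a b) x := by
    intro j hj x hx
    have hce := hcont (j + 1) (by omega)
    have h1 : HasDerivAt (fun x => c j + ∫ y in a..x, e (j + 1) y) (e (j + 1) x) x :=
      (intervalIntegral.integral_hasDerivAt_right (hce.intervalIntegrable _ _)
        (hce.stronglyMeasurableAtFilter _ _) hce.continuousAt).const_add _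
    have h2 : ∀ x ∈ Icc a b, e j x = c j + ∫ y in a..x, e (j + 1) y := by
      intro x hx
      simp only [he]
      congr 1
      refine intervalIntegral.integral_congr_ae ?_
      have h3 := hgg (j + 1)
      have h4 := hc (j + 1) (by omega)
      rw [Filter.EventuallyEq, ae_restrict_iff' measurableSet_Ioo] at h3
      rw [ae_restrict_iff' measurableSet_Ioo] at h4
      have h5 : ∀ᵐ y : ℝ, y ≠ b := by simp [ae_iff, measure_singleton]
      filter_upwards [h3, h4, h5] with y k3 k4 k5 hy
      rw [uIoc_of_le hx.1] at hy
      have hyI : y ∈ Ioo a b := ⟨hy.1, lt_of_le_of_ne (hy.2.trans hx.2) k5⟩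
      rw [k3 hyI, k4 hyI]
    exact h1.hasDerivWithinAt.congr (fun y hy => h2 y hy) (h2 x hx)
  refine ⟨fun j => if j = 0 then f else e j, by simp, ?_, ?_, ?_⟩
  · intro j hj x hx
    rcases Nat.eq_zero_or_pos j with rfl | hj0
    · simpa using (hder 0 hj x hx).congr (fun y hy => hf0 hy) (hf0 hx)
    · simpa [hj0.ne'] using hder j hj x hx
  · intro j hj x hx
    rcases Nat.eq_zero_or_pos j with rfl | hj0
    · simpa [hf0 hx] using hbd 0 hj x hx
    · simpa [hj0.ne'] using hbd j hj x hx
  · intro j hj x hx y hy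
    rcases Nat.eq_zero_or_pos j with rfl | hj0
    · simpa [hf0 hx, hf0 hy] using hlip 0 hj x y
    · simpa [hj0.ne'] using hlip j hj x y

theorem exists_isWeakDeriv_of_sobolevNorm_lt_top {m : ℕ} {f : ℝ → ℝ} (h : sobolevNorm m f < ⊤)
    {j : ℕ} (hj : j ≤ m) : ∃ g, IsWeakDeriv 0 (2 * Real.pi) j f g ∧
      ∀ᵐ x ∂volume.restrict (Ioo 0 (2 * Real.pi)), |g x| ≤ (sobolevNorm m f).toReal := by
  have h1 : (⨅ (g : ℝ → ℝ) (_ : IsWeakDeriv 0 (2 * Real.pi) j f g),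
      eLpNorm g ∞ (volume.restrict (Ioo 0 (2 * Real.pi)))) ≤ sobolevNorm m f :=
    le_iSup₂_of_le (f := fun j (_ : j ∈ Finset.range (m + 1)) =>
      ⨅ (g : ℝ → ℝ) (_ : IsWeakDeriv 0 (2 * Real.pi) j f g),
      eLpNorm g ∞ (volume.restrict (Ioo 0 (2 * Real.pi)))) j
      (Finset.mem_range.2 (by omega)) le_rfl
  obtain ⟨g, hg⟩ := iInf_lt_iff.1 (h1.trans_lt h)
  obtain ⟨hgw, -⟩ := iInf_lt_iff.1 hg
  refine ⟨g, hgw, ?_⟩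
  have h2 : eLpNorm g ∞ (volume.restrict (Ioo 0 (2 * Real.pi))) ≤ sobolevNorm m f := by
    refine le_trans (le_iInf₂ fun g' hg' => ?_) h1
    exact (eLpNorm_congr_ae (hgw.ae_eq hg')).le
  rw [eLpNorm_exponent_top] at h2
  filter_upwards [ae_le_eLpNormEssSup (f := g)
    (μ := volume.restrict (Ioo 0 (2 * Real.pi)))] with x hx
  have h3 := ENNReal.toReal_mono h.ne (hx.trans h2)
  simpa using h3

/-! ### Regularity in time of solutions of the heat equation -/

/-- An interpolation inequality for the derivative in the maximum norm. -/
theorem abs_deriv_le_of_lipschitz {L : ℝ} {f f' : ℝ → ℝ} {η K r : ℝ} (hr : 0 < r)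
    (hrL : r ≤ L / 2) (hK : 0 ≤ K)
    (hf : ∀ x ∈ Icc 0 L, HasDerivWithinAt f (f' x) (Icc 0 L) x)
    (hlip : ∀ x ∈ Icc 0 L, ∀ y ∈ Icc 0 L, |f' x - f' y| ≤ K * |x - y|)
    (hη : ∀ x ∈ Icc 0 L, |f x| ≤ η) {x : ℝ} (hx : x ∈ Icc 0 L) :
    |f' x| ≤ 2 * η / r + K * r := by
  obtain ⟨y, hy, hxy⟩ : ∃ y ∈ Icc 0 L, |y - x| = r := by
    rcases le_total x (L / 2) with h | h
    · exact ⟨x + r, ⟨by linarith [hx.1], by linarith⟩, by rw [add_sub_cancel_left, abs_of_pos hr]⟩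
    · exact ⟨x - r, ⟨by linarith, by linarith [hx.2]⟩, by
        rw [sub_sub_cancel_left, abs_neg, abs_of_pos hr]⟩
  have hsub : uIcc x y ⊆ Icc 0 L := uIcc_subset_Icc hx hy
  have h1 := (convex_uIcc x y).norm_image_sub_le_of_norm_hasDerivWithin_le
    (f := fun z => f z - f' x * z) (f' := fun z => f' z - f' x) (C := K * r)
    (fun z hz => by
      refine (((hf z (hsub hz)).mono hsub).fun_sub
        (((hasDerivAt_id z).const_mul (f' x)).hasDerivWithinAt)).congr_deriv ?_
      rw [mul_one])
    (fun z hz => by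
      refine (hlip z (hsub hz) x hx).trans ?_
      gcongr
      rw [← hxy]
      exact abs_sub_left_of_mem_uIcc hz)
    left_mem_uIcc right_mem_uIcc
  simp only [Real.norm_eq_abs, hxy] at h1
  have e : f' x * (y - x) = (f y - f x) - (f y - f' x * y - (f x - f' x * x)) := by ring
  have h2 : |f' x| * r ≤ 2 * η + K * r * r := by
    rw [← hxy, ← abs_mul, hxy, e]
    refine (abs_sub _ _).trans (add_le_add ?_ h1)
    refine (abs_sub _ _).trans ?_
    linarith [hη x hx, hη y hy]
  rw [← sub_nonneg] at h2 ⊢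
  have : 2 * η / r + K * r - |f' x| = (2 * η + K * r * r - |f' x| * r) / r := by
    field_simp
  rw [this]
  exact div_nonneg h2 hr.le

/-- `U j` is the spatial derivative of order `j` of a function on `[0, L] × [0, T]`, for `j ≤ n`,
all of them are continuous, and the function solves the heat equation. -/
structure HeatJet (L T : ℝ) (n : ℕ) (U : ℕ → ℝ → ℝ → ℝ) : Prop where
  deriv_x : ∀ t ∈ Icc 0 T, ∀ j < n, ∀ x ∈ Icc 0 L,
    HasDerivWithinAt (fun y => U j y t) (U (j + 1) x t) (Icc 0 L) x
  cont : ∀ j ≤ n, ContinuousOn (fun z : ℝ × ℝ => U j z.1 z.2) (Icc 0 L ×ˢ Icc 0 T)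
  deriv_t : ∀ j, j + 2 ≤ n → ∀ x ∈ Icc 0 L, ∀ t ∈ Icc 0 T,
    HasDerivWithinAt (fun s => U j x s) (U (j + 2) x t) (Icc 0 T) t

section

variable {L T S : ℝ} {n : ℕ} {U : ℕ → ℝ → ℝ → ℝ}

/-- All spatial derivatives inherit continuity in time from the function, since they are uniformly
Lipschitz in space. -/
theorem forall_abs_sub_lt_of_lipschitz (hL : 0 < L) (hS : 0 ≤ S)
    (hx : ∀ t ∈ Icc 0 T, ∀ j < n, ∀ x ∈ Icc 0 L,
      HasDerivWithinAt (fun y => U j y t) (U (j + 1) x t) (Icc 0 L) x)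
    (hlip : ∀ t ∈ Icc 0 T, ∀ j ≤ n, ∀ x ∈ Icc 0 L, ∀ y ∈ Icc 0 L,
      |U j x t - U j y t| ≤ S * |x - y|)
    (hc : ContinuousOn (fun z : ℝ × ℝ => U 0 z.1 z.2) (Icc 0 L ×ˢ Icc 0 T)) :
    ∀ j ≤ n, ∀ ε > 0, ∃ δ > 0, ∀ s ∈ Icc 0 T, ∀ t ∈ Icc 0 T, |s - t| < δ → ∀ x ∈ Icc 0 L,
      |U j x s - U j x t| < ε := by
  intro j
  induction j with
  | zero =>
    intro _ ε hε
    have huc := (isCompact_Icc.prod isCompact_Icc).uniformContinuousOn_of_continuous hc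
    obtain ⟨δ, hδ, h⟩ := Metric.uniformContinuousOn_iff.1 huc ε hε
    refine ⟨δ, hδ, fun s hs t ht hst x hxm => ?_⟩
    have := h (x, s) ⟨hxm, hs⟩ (x, t) ⟨hxm, ht⟩ (by
      rw [Prod.dist_eq]; simpa [Real.dist_eq] using hst)
    simpa [Real.dist_eq] using this
  | succ j ih =>
    intro hj ε hε
    -- a step in space for which the interpolation inequality gives `ε / 4` twice
    set r := min (ε / (8 * S + 8)) (L / 2) with hr
    have hr0 : 0 < r := lt_min (by positivity) (by positivity)
    have hrS : 2 * S * r ≤ ε / 4 := by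
      have h1 : r ≤ ε / (8 * S + 8) := min_le_left _ _
      have h2 : r * (8 * S + 8) ≤ ε := by
        rwa [le_div_iff₀ (by positivity)] at h1
      nlinarith
    obtain ⟨δ, hδ, h⟩ := ih (by omega) (ε * r / 8) (by positivity)
    refine ⟨δ, hδ, fun s hs t ht hst x hxm => ?_⟩
    have := abs_deriv_le_of_lipschitz (f := fun y => U j y s - U j y t)
      (f' := fun y => U (j + 1) y s - U (j + 1) y t) (η := ε * r / 8) (K := 2 * S)
      hr0 (min_le_right _ _) (by positivity)
      (fun y hy => (hx s hs j (by omega) y hy).sub (hx t ht j (by omega) y hy))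
      (fun y hy z hz => by
        have e : U (j + 1) y s - U (j + 1) y t - (U (j + 1) z s - U (j + 1) z t) =
          (U (j + 1) y s - U (j + 1) z s) - (U (j + 1) y t - U (j + 1) z t) := by ring
        rw [e]
        refine (abs_sub _ _).trans ?_
        linarith [hlip s hs (j + 1) hj y hy z hz, hlip t ht (j + 1) hj y hy z hz])
      (fun y hy => (h s hs t ht hst y hy).le) hxm
    refine this.trans_lt ?_
    have e : 2 * (ε * r / 8) / r = ε / 4 := by field_simp; norm_num
    rw [e]
    linarith

/-- Joint continuity of all spatial derivatives. -/
theorem continuousOn_of_lipschitz (hL : 0 < L) (hS : 0 ≤ S)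
    (hx : ∀ t ∈ Icc 0 T, ∀ j < n, ∀ x ∈ Icc 0 L,
      HasDerivWithinAt (fun y => U j y t) (U (j + 1) x t) (Icc 0 L) x)
    (hlip : ∀ t ∈ Icc 0 T, ∀ j ≤ n, ∀ x ∈ Icc 0 L, ∀ y ∈ Icc 0 L,
      |U j x t - U j y t| ≤ S * |x - y|)
    (hc : ContinuousOn (fun z : ℝ × ℝ => U 0 z.1 z.2) (Icc 0 L ×ˢ Icc 0 T)) :
    ∀ j ≤ n, ContinuousOn (fun z : ℝ × ℝ => U j z.1 z.2) (Icc 0 L ×ˢ Icc 0 T) := by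
  intro j hj
  rw [Metric.continuousOn_iff]
  rintro ⟨x, t⟩ ⟨hxm, htm⟩ ε hε
  obtain ⟨δ, hδ, h⟩ := forall_abs_sub_lt_of_lipschitz hL hS hx hlip hc j hj (ε / 2) (by positivity)
  refine ⟨min δ (ε / (2 * (S + 1))), lt_min hδ (by positivity), ?_⟩
  rintro ⟨y, s⟩ ⟨hym, hsm⟩ hd
  rw [Prod.dist_eq, max_lt_iff, Real.dist_eq, Real.dist_eq] at hd
  simp only at hd hxm htm hym hsm
  have h1 := h s hsm t htm (hd.2.trans_le (min_le_left _ _)) y hym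
  have h2 := hlip t htm j hj y hym x hxm
  have h3 : |y - x| < ε / (2 * (S + 1)) := hd.1.trans_le (min_le_right _ _)
  have h4 : S * |y - x| ≤ ε / 2 := by
    rw [lt_div_iff₀ (by positivity)] at h3
    nlinarith [abs_nonneg (y - x)]
  rw [Real.dist_eq]
  have e : U j y s - U j x t = (U j y s - U j y t) + (U j y t - U j x t) := by ring
  simp only [e]
  refine (abs_add_le _ _).trans_lt ?_
  linarith

theorem eqOn_of_forall_integral_eq {L : ℝ} (hL : 0 < L) {f g : ℝ → ℝ} (hf : Continuous f)
    (hg : Continuous g) (h : ∀ x ∈ Icc 0 L, ∫ y in (0 : ℝ)..x, f y = ∫ y in (0 : ℝ)..x, g y) :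
    EqOn f g (Icc 0 L) := by
  intro x hx
  have h1 : ∀ f : ℝ → ℝ, Continuous f →
      HasDerivWithinAt (fun x => ∫ y in (0 : ℝ)..x, f y) (f x) (Icc 0 L) x := fun f hf =>
    (intervalIntegral.integral_hasDerivAt_right (hf.intervalIntegrable _ _)
      (hf.stronglyMeasurableAtFilter _ _) hf.continuousAt).hasDerivWithinAt
  exact (uniqueDiffOn_Icc hL x hx).eq_deriv _ ((h1 f hf).congr
    (fun y hy => (h y hy).symm) (h x hx).symm) (h1 g hg)

/-- The heat equation for the function carries over to its spatial derivatives, in the integrated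
form `U j x t - U j x 0 = ∫₀ᵗ U (j + 2) x τ dτ`: the relation for `j` is a primitive in `x` of the
one for `j + 1`, by exchanging the order of integration. -/
theorem heatJet_of_lipschitz (hL : 0 < L) (hT : 0 < T) (hS : 0 ≤ S)
    (hx : ∀ t ∈ Icc 0 T, ∀ j < n, ∀ x ∈ Icc 0 L,
      HasDerivWithinAt (fun y => U j y t) (U (j + 1) x t) (Icc 0 L) x)
    (hlip : ∀ t ∈ Icc 0 T, ∀ j ≤ n, ∀ x ∈ Icc 0 L, ∀ y ∈ Icc 0 L,
      |U j x t - U j y t| ≤ S * |x - y|)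
    (hc : ContinuousOn (fun z : ℝ × ℝ => U 0 z.1 z.2) (Icc 0 L ×ˢ Icc 0 T)) (hn : 2 ≤ n)
    (hheat : ∀ x ∈ Icc 0 L, ∀ t ∈ Ioc 0 T,
      HasDerivWithinAt (fun s => U 0 x s) (U 2 x t) (Icc 0 T) t) : HeatJet L T n U := by
  have hcont := continuousOn_of_lipschitz hL hS hx hlip hc
  -- extension of all functions to the plane, constant outside the rectangle
  set W : ℕ → ℝ → ℝ → ℝ := fun j x t => U j (max 0 (min x L)) (max 0 (min t T)) with hW
  have hcl : ∀ {R z : ℝ}, z ∈ Icc 0 R → max 0 (min z R) = z := fun hz => by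
    rw [min_eq_left hz.2, max_eq_right hz.1]
  have hWU : ∀ j, ∀ x ∈ Icc 0 L, ∀ t ∈ Icc 0 T, W j x t = U j x t := fun j x hx t ht => by
    simp only [hW, hcl hx, hcl ht]
  have hWc : ∀ j ≤ n, Continuous (Function.uncurry (W j)) := by
    intro j hj
    refine (hcont j hj).comp_continuous
      (f := fun z : ℝ × ℝ => (max 0 (min z.1 L), max 0 (min z.2 T))) (by fun_prop) fun z => ?_
    exact ⟨⟨le_max_left _ _, max_le hL.le (min_le_right _ _)⟩,
      ⟨le_max_left _ _, max_le hT.le (min_le_right _ _)⟩⟩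
  have hWx : ∀ j ≤ n, ∀ t, Continuous fun x => W j x t := fun j hj t =>
    (hWc j hj).comp (by fun_prop : Continuous fun x : ℝ => (x, t))
  have hWt : ∀ j ≤ n, ∀ x, Continuous fun t => W j x t := fun j hj x =>
    (hWc j hj).comp (by fun_prop : Continuous fun t : ℝ => (x, t))
  have h0T : (0 : ℝ) ∈ Icc 0 T := ⟨le_rfl, hT.le⟩
  have h0L : (0 : ℝ) ∈ Icc 0 L := ⟨le_rfl, hL.le⟩
  have hspace : ∀ j < n, ∀ t ∈ Icc 0 T, ∀ x ∈ Icc 0 L,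
      ∫ y in (0 : ℝ)..x, W (j + 1) y t = U j x t - U j 0 t := by
    intro j hj t ht x hxm
    refine intervalIntegral.integral_eq_sub_of_hasDerivAt_of_le (f := fun y => U j y t) hxm.1 ?_
      (fun y hy => ?_) ((hWx (j + 1) (by omega) t).intervalIntegrable _ _)
    · exact fun y hy => ((hx t ht j hj y ⟨hy.1, hy.2.trans hxm.2⟩).continuousWithinAt).mono
        (Icc_subset_Icc_right hxm.2)
    · have hyL : y ∈ Icc 0 L := ⟨hy.1.le, hy.2.le.trans hxm.2⟩
      rw [hWU _ y hyL t ht]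
      exact (hx t ht j hj y hyL).hasDerivAt (Icc_mem_nhds hy.1 (hy.2.trans_le hxm.2))
  have key : ∀ j, j + 2 ≤ n → ∀ x ∈ Icc 0 L, ∀ t ∈ Icc 0 T,
      U j x t - U j x 0 = ∫ τ in (0 : ℝ)..t, W (j + 2) x τ := by
    intro j
    induction j with
    | zero =>
      intro _ x hxm t ht
      symm
      refine intervalIntegral.integral_eq_sub_of_hasDerivAt_of_le (f := fun s => U 0 x s) ht.1 ?_
        (fun s hs => ?_) ((hWt 2 hn x).intervalIntegrable _ _)
      · refine (hWt 0 (by omega) x).continuousOn.congr fun s hs => ?_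
        exact (hWU 0 x hxm s ⟨hs.1, hs.2.trans ht.2⟩).symm
      · have hsT : s ∈ Ioc 0 T := ⟨hs.1, hs.2.le.trans ht.2⟩
        rw [hWU _ x hxm s ⟨hs.1.le, hsT.2⟩]
        exact (hheat x hxm s hsT).hasDerivAt (Icc_mem_nhds hs.1 (hs.2.trans_le ht.2))
    | succ j ih =>
      intro hj x hxm t ht
      have hA : Continuous fun y => W (j + 1) y t - W (j + 1) y 0 :=
        (hWx _ (by omega) t).sub (hWx _ (by omega) 0)
      have hB : Continuous fun y => ∫ τ in (0 : ℝ)..t, W (j + 3) y τ :=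
        intervalIntegral.continuous_parametric_intervalIntegral_of_continuous' (hWc _ hj) 0 t
      have hAB := eqOn_of_forall_integral_eq hL hA hB (fun z hz => by
        rw [intervalIntegral.integral_sub ((hWx _ (by omega) t).intervalIntegrable _ _)
          ((hWx _ (by omega) 0).intervalIntegrable _ _), hspace j (by omega) t ht z hz,
          hspace j (by omega) 0 h0T z hz]
        have hswap : ∫ y in (0 : ℝ)..z, ∫ τ in (0 : ℝ)..t, W (j + 3) y τ =
            ∫ τ in (0 : ℝ)..t, ∫ y in (0 : ℝ)..z, W (j + 3) y τ := by
          refine intervalIntegral_intervalIntegral_swap ?_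
          exact ((hWc _ hj).continuousOn.integrableOn_compact
            (isCompact_uIcc.prod isCompact_uIcc)).mono_set
              (prod_mono uIoc_subset_uIcc uIoc_subset_uIcc)
        have hin : ∫ τ in (0 : ℝ)..t, ∫ y in (0 : ℝ)..z, W (j + 3) y τ =
            ∫ τ in (0 : ℝ)..t, (W (j + 2) z τ - W (j + 2) 0 τ) := by
          refine intervalIntegral.integral_congr fun τ hτ => ?_
          rw [uIcc_of_le ht.1] at hτ
          have hτT : τ ∈ Icc 0 T := ⟨hτ.1, hτ.2.trans ht.2⟩
          rw [hspace (j + 2) (by omega) τ hτT z hz, hWU _ z hz τ hτT, hWU _ 0 h0L τ hτT]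
        rw [hswap, hin, intervalIntegral.integral_sub ((hWt _ (by omega) z).intervalIntegrable _ _)
          ((hWt _ (by omega) 0).intervalIntegrable _ _), ← ih (by omega) z hz t ht,
          ← ih (by omega) 0 h0L t ht]
        ring) hxm
      simp only at hAB
      rw [← hAB, hWU _ x hxm t ht, hWU _ x hxm 0 h0T]
  refine ⟨hx, hcont, fun j hj x hxm t ht => ?_⟩
  have h1 : HasDerivAt (fun s => U j x 0 + ∫ τ in (0 : ℝ)..s, W (j + 2) x τ) (W (j + 2) x t) t :=
    (intervalIntegral.integral_hasDerivAt_right ((hWt _ hj x).intervalIntegrable _ _)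
      ((hWt _ hj x).stronglyMeasurableAtFilter _ _) (hWt _ hj x).continuousAt).const_add _
  rw [hWU _ x hxm t ht] at h1
  have h2 : ∀ s ∈ Icc 0 T, U j x s = U j x 0 + ∫ τ in (0 : ℝ)..s, W (j + 2) x τ := by
    intro s hs
    rw [← key j hj x hxm s hs]; ring
  exact h1.hasDerivWithinAt.congr h2 (h2 t ht)

end

theorem sobolevNorm_le_supSobolevNorm {m : ℕ} {u : ℝ → ℝ → ℝ} {s t : ℝ} (hs : s ∈ Icc 0 t) :
    sobolevNorm m (fun x => u x s) ≤ supSobolevNorm m u t :=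
  le_iSup₂_of_le (f := fun s (_ : s ∈ Icc (0 : ℝ) t) => sobolevNorm m (fun x => u x s)) s hs le_rfl

theorem supSobolevNorm_mono {m : ℕ} {u : ℝ → ℝ → ℝ} {s t : ℝ} (hst : s ≤ t) :
    supSobolevNorm m u s ≤ supSobolevNorm m u t :=
  iSup₂_le fun _ hr => sobolevNorm_le_supSobolevNorm ⟨hr.1, hr.2.trans hst⟩

/-- The regularity of `u` that is used: all derivatives exist in the classical sense up to order
`n + 1`, and the last one is Lipschitz in space. -/
theorem IsHeatSolution.exists_heatJet {F : Flux} {bc : BC} {T : ℝ} {u₀ : ℝ → ℝ} {u : ℝ → ℝ → ℝ}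
    (hu : IsHeatSolution F bc T u₀ u) (hT : 0 < T) {n : ℕ} (hn : 2 ≤ n)
    (hfin : supSobolevNorm (n + 1) u T < ⊤) :
    ∃ U : ℕ → ℝ → ℝ → ℝ, (∀ x, ∀ t ∈ Icc 0 T, U 0 x t = u x t) ∧
      HeatJet (2 * Real.pi) T n U ∧
      ∀ t ∈ Icc 0 T, ∀ s ∈ Icc 0 t, ∀ j ≤ n, ∀ x ∈ Icc 0 (2 * Real.pi),
        ∀ y ∈ Icc 0 (2 * Real.pi),
          |U j x s - U j y s| ≤ (supSobolevNorm (n + 1) u t).toReal * |x - y| := by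
  have hL : (0 : ℝ) < 2 * Real.pi := by positivity
  have hex : ∀ s ∈ Icc 0 T, ∃ d : ℕ → ℝ → ℝ, d 0 = (fun x => u x s) ∧
      (∀ j < n, ∀ x ∈ Icc 0 (2 * Real.pi),
        HasDerivWithinAt (d j) (d (j + 1) x) (Icc 0 (2 * Real.pi)) x) ∧
      ∀ j ≤ n, ∀ x ∈ Icc 0 (2 * Real.pi), ∀ y ∈ Icc 0 (2 * Real.pi),
        |d j x - d j y| ≤ (sobolevNorm (n + 1) (fun x => u x s)).toReal * |x - y| := by
    intro s hs
    have hlt : sobolevNorm (n + 1) (fun x => u x s) < ⊤ :=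
      (sobolevNorm_le_supSobolevNorm hs).trans_lt hfin
    have hcs : ContinuousOn (fun x => u x s) (Icc 0 (2 * Real.pi)) :=
      hu.continuousOn.comp (f := fun x : ℝ => (x, s)) (by fun_prop) fun x hx => ⟨hx, hs⟩
    obtain ⟨d, h1, h2, -, h4⟩ := exists_classical_derivs hL hcs
      fun j hj => exists_isWeakDeriv_of_sobolevNorm_lt_top hlt hj
    exact ⟨d, h1, h2, h4⟩
  choose! d hd0 hdx hdlip using hex
  have hlipt : ∀ t ∈ Icc 0 T, ∀ s ∈ Icc 0 t, ∀ j ≤ n, ∀ x ∈ Icc 0 (2 * Real.pi),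
        ∀ y ∈ Icc 0 (2 * Real.pi),
          |d s j x - d s j y| ≤ (supSobolevNorm (n + 1) u t).toReal * |x - y| := by
    intro t ht s hs j hj x hx y hy
    refine (hdlip s ⟨hs.1, hs.2.trans ht.2⟩ j hj x hx y hy).trans ?_
    gcongr
    · exact ((supSobolevNorm_mono ht.2).trans_lt hfin).ne
    · exact sobolevNorm_le_supSobolevNorm hs
  have h0 : ∀ x, ∀ t ∈ Icc 0 T, d t 0 x = u x t := fun x t ht => by rw [hd0 t ht]
  refine ⟨fun j x t => d t j x, h0, ?_, hlipt⟩
  refine heatJet_of_lipschitz hL hT ENNReal.toReal_nonneg (fun t ht => hdx t ht)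
    (fun t ht => hlipt T ⟨hT.le, le_rfl⟩ t ht) ?_ hn ?_
  · exact hu.continuousOn.congr fun z hz => h0 z.1 z.2 hz.2
  · intro x hx t ht
    have ht' : t ∈ Icc 0 T := ⟨ht.1.le, ht.2⟩
    have hderiv : ∀ j < n, ∀ x ∈ Icc 0 (2 * Real.pi),
        derivWithin (d t j) (Icc 0 (2 * Real.pi)) x = d t (j + 1) x := fun j hj x hx =>
      (hdx t ht' j hj x hx).derivWithin (uniqueDiffOn_Icc hL x hx)
    have h2 : iteratedDerivWithin 2 (fun y => u y t) (Icc 0 (2 * Real.pi)) x = d t 2 x := by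
      rw [iteratedDerivWithin_succ, ← hd0 t ht']
      have : ∀ y ∈ Icc 0 (2 * Real.pi),
          iteratedDerivWithin 1 (d t 0) (Icc 0 (2 * Real.pi)) y = d t 1 y := fun y hy => by
        rw [iteratedDerivWithin_one, hderiv 0 (by omega) y hy]
      rw [derivWithin_congr this (this x hx), hderiv 1 (by omega) x hx]
    have h3 := hu.pde x hx t ht
    rw [h2] at h3
    exact h3.congr (fun s hs => h0 x s hs) (h0 x t ht')

/-! ### The heat semigroup of `D†D` on a Hilbert space -/

section Semigroup

/-- The norm by duality, where only one sign of the pairing is needed. -/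
theorem norm_le_of_forall_inner_le {V : Type*} [NormedAddCommGroup V] [InnerProductSpace ℝ V]
    {x : V} {K : ℝ} (hK : 0 ≤ K)
    (h : ∀ z, inner ℝ x z ≤ K * ‖z‖) : ‖x‖ ≤ K := by
  rcases (norm_nonneg x).eq_or_lt with h0 | h0
  · rwa [← h0]
  · have := h x
    rw [real_inner_self_eq_norm_sq, pow_two] at this
    exact le_of_mul_le_mul_right this h0

variable {V : Type*} [NormedAddCommGroup V] [InnerProductSpace ℝ V] [CompleteSpace V]

open ContinuousLinearMap in
/-- The nonnegative operator `D†D`, a discrete version of `-∂ₓₓ` if `D` is a discrete `∂ₓ`. -/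
noncomputable def lapl (D : V →L[ℝ] V) : V →L[ℝ] V := adjoint D ∘L D

/-- The semigroup `exp (-τ D†D)`. -/
noncomputable def heatSemigroup (D : V →L[ℝ] V) (τ : ℝ) : V →L[ℝ] V :=
  NormedSpace.exp (τ • -lapl D)

variable (D : V →L[ℝ] V)

theorem inner_lapl_left (x y : V) : inner ℝ (lapl D x) y = inner ℝ (D x) (D y) := by
  simp [lapl, ContinuousLinearMap.adjoint_inner_left]

theorem inner_lapl_right (x y : V) : inner ℝ x (lapl D y) = inner ℝ (D x) (D y) := by
  simp [lapl, ContinuousLinearMap.adjoint_inner_right]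

theorem heatSemigroup_zero (v : V) : heatSemigroup D 0 v = v := by
  simp [heatSemigroup]

theorem commute_heatSemigroup (τ : ℝ) : Commute (lapl D) (heatSemigroup D τ) := by
  apply Commute.exp_right
  exact ((Commute.refl (lapl D)).neg_right).smul_right τ

theorem lapl_heatSemigroup (τ : ℝ) (v : V) :
    lapl D (heatSemigroup D τ v) = heatSemigroup D τ (lapl D v) :=
  congrArg (fun T : V →L[ℝ] V => T v) (commute_heatSemigroup D τ).eq

theorem hasDerivAt_heatSemigroup (τ : ℝ) (v : V) :
    HasDerivAt (fun τ => heatSemigroup D τ v) (-lapl D (heatSemigroup D τ v)) τ := by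
  have h := hasDerivAt_exp_smul_const' (𝕂 := ℝ) (-lapl D) τ
  have h2 := h.clm_apply (hasDerivAt_const τ v)
  simpa [heatSemigroup] using h2

theorem inner_heatSemigroup_comm (τ : ℝ) (x y : V) :
    inner ℝ (heatSemigroup D τ x) y = inner ℝ x (heatSemigroup D τ y) := by
  have hA : IsSelfAdjoint (lapl D) := by
    rw [ContinuousLinearMap.isSelfAdjoint_iff_isSymmetric]
    intro x y
    simp [inner_lapl_left, inner_lapl_right]
  have hS : IsSelfAdjoint (heatSemigroup D τ) :=
    IsSelfAdjoint.exp (((IsSelfAdjoint.all τ).smul hA.neg))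
  exact (ContinuousLinearMap.isSelfAdjoint_iff_isSymmetric.1 hS) x y

theorem hasDerivAt_normSq_heatSemigroup (T : V →L[ℝ] V) (τ : ℝ) (v : V) :
    HasDerivAt (fun τ => ‖T (heatSemigroup D τ v)‖ ^ 2)
      (-2 * inner ℝ (T (heatSemigroup D τ v)) (T (lapl D (heatSemigroup D τ v)))) τ := by
  have h := ((T.hasFDerivAt (x := heatSemigroup D τ v)).comp_hasDerivAt τ
    (hasDerivAt_heatSemigroup D τ v)).norm_sq
  refine h.congr_deriv ?_
  simp

/-- The smoothing estimates for the semigroup. The four terms are chosen such that the derivative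
of the sum telescopes. -/
theorem heatSemigroup_smoothing {τ : ℝ} (hτ : 0 ≤ τ) (v : V) :
    ‖heatSemigroup D τ v‖ ^ 2 + 2 * τ * ‖D (heatSemigroup D τ v)‖ ^ 2
      + 2 * τ ^ 2 * ‖lapl D (heatSemigroup D τ v)‖ ^ 2
      + 4 / 3 * τ ^ 3 * ‖D (lapl D (heatSemigroup D τ v))‖ ^ 2 ≤ ‖v‖ ^ 2 := by
  set φ := fun τ => heatSemigroup D τ v with hφ
  have h0 : ∀ τ, HasDerivAt (fun τ => ‖φ τ‖ ^ 2) (-2 * ‖D (φ τ)‖ ^ 2) τ := by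
    intro τ
    have := hasDerivAt_normSq_heatSemigroup D (ContinuousLinearMap.id ℝ V) τ v
    simpa [inner_lapl_right, real_inner_self_eq_norm_sq] using this
  have h1 : ∀ τ, HasDerivAt (fun τ => ‖D (φ τ)‖ ^ 2) (-2 * ‖lapl D (φ τ)‖ ^ 2) τ := by
    intro τ
    have := hasDerivAt_normSq_heatSemigroup D D τ v
    rwa [← inner_lapl_left, real_inner_self_eq_norm_sq] at this
  have h2 : ∀ τ, HasDerivAt (fun τ => ‖lapl D (φ τ)‖ ^ 2) (-2 * ‖D (lapl D (φ τ))‖ ^ 2) τ := by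
    intro τ
    have := hasDerivAt_normSq_heatSemigroup D (lapl D) τ v
    rwa [inner_lapl_right, real_inner_self_eq_norm_sq] at this
  have h3 : ∀ τ, HasDerivAt (fun τ => ‖D (lapl D (φ τ))‖ ^ 2)
      (-2 * ‖lapl D (lapl D (φ τ))‖ ^ 2) τ := by
    intro τ
    have := hasDerivAt_normSq_heatSemigroup D (D ∘L lapl D) τ v
    simp only [ContinuousLinearMap.comp_apply] at this
    rwa [← inner_lapl_left, real_inner_self_eq_norm_sq] at this
  have hE : ∀ τ, HasDerivAt (fun τ => ‖φ τ‖ ^ 2 + 2 * τ * ‖D (φ τ)‖ ^ 2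
      + 2 * τ ^ 2 * ‖lapl D (φ τ)‖ ^ 2 + 4 / 3 * τ ^ 3 * ‖D (lapl D (φ τ))‖ ^ 2)
      (4 / 3 * τ ^ 3 * (-2 * ‖lapl D (lapl D (φ τ))‖ ^ 2)) τ := by
    intro τ
    have i1 := ((hasDerivAt_id τ).const_mul 2).mul (h1 τ)
    have i2 := (((hasDerivAt_id τ).pow 2).const_mul 2).mul (h2 τ)
    have i3 := (((hasDerivAt_id τ).pow 3).const_mul (4 / 3)).mul (h3 τ)
    have := (((h0 τ).add i1).add i2).add i3
    refine this.congr_deriv ?_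
    simp
    ring
  have hanti : AntitoneOn (fun τ => ‖φ τ‖ ^ 2 + 2 * τ * ‖D (φ τ)‖ ^ 2
      + 2 * τ ^ 2 * ‖lapl D (φ τ)‖ ^ 2 + 4 / 3 * τ ^ 3 * ‖D (lapl D (φ τ))‖ ^ 2) (Ici 0) := by
    apply antitoneOn_of_deriv_nonpos (convex_Ici 0)
    · exact fun τ _ => (hE τ).continuousAt.continuousWithinAt
    · exact fun τ _ => (hE τ).differentiableAt.differentiableWithinAt
    · intro τ hτ
      rw [interior_Ici] at hτ
      have : 0 < τ := hτ
      rw [(hE τ).deriv]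
      have : 0 ≤ 4 / 3 * τ ^ 3 * (2 * ‖lapl D (lapl D (φ τ))‖ ^ 2) := by positivity
      linarith
  have := hanti (mem_Ici.2 le_rfl) (mem_Ici.2 hτ) hτ
  simpa [hφ, heatSemigroup_zero] using this

theorem norm_heatSemigroup_le {τ : ℝ} (hτ : 0 ≤ τ) (v : V) : ‖heatSemigroup D τ v‖ ≤ ‖v‖ := by
  have h := heatSemigroup_smoothing D hτ v
  have : ‖heatSemigroup D τ v‖ ^ 2 ≤ ‖v‖ ^ 2 := by
    have : 0 ≤ 2 * τ * ‖D (heatSemigroup D τ v)‖ ^ 2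
      + 2 * τ ^ 2 * ‖lapl D (heatSemigroup D τ v)‖ ^ 2
      + 4 / 3 * τ ^ 3 * ‖D (lapl D (heatSemigroup D τ v))‖ ^ 2 := by positivity
    linarith
  exact (sq_le_sq₀ (norm_nonneg _) (norm_nonneg _)).1 this

theorem norm_D_heatSemigroup_le {τ : ℝ} (hτ : 0 < τ) (v : V) :
    ‖D (heatSemigroup D τ v)‖ ≤ ‖v‖ / √τ := by
  have h := heatSemigroup_smoothing D hτ.le v
  rw [le_div_iff₀ (Real.sqrt_pos.2 hτ), ← sq_le_sq₀ (by positivity) (norm_nonneg _), mul_pow,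
    Real.sq_sqrt hτ.le]
  have : 0 ≤ ‖heatSemigroup D τ v‖ ^ 2 + τ * ‖D (heatSemigroup D τ v)‖ ^ 2
      + 2 * τ ^ 2 * ‖lapl D (heatSemigroup D τ v)‖ ^ 2
      + 4 / 3 * τ ^ 3 * ‖D (lapl D (heatSemigroup D τ v))‖ ^ 2 := by positivity
  linarith

theorem norm_lapl_heatSemigroup_le {τ : ℝ} (hτ : 0 < τ) (v : V) :
    ‖lapl D (heatSemigroup D τ v)‖ ≤ ‖v‖ / τ := by
  have h := heatSemigroup_smoothing D hτ.le v
  rw [le_div_iff₀ hτ, ← sq_le_sq₀ (by positivity) (norm_nonneg _), mul_pow]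
  have : 0 ≤ ‖heatSemigroup D τ v‖ ^ 2 + 2 * τ * ‖D (heatSemigroup D τ v)‖ ^ 2
      + τ ^ 2 * ‖lapl D (heatSemigroup D τ v)‖ ^ 2
      + 4 / 3 * τ ^ 3 * ‖D (lapl D (heatSemigroup D τ v))‖ ^ 2 := by positivity
  linarith

theorem norm_D_lapl_heatSemigroup_le {τ : ℝ} (hτ : 0 < τ) (v : V) :
    ‖D (lapl D (heatSemigroup D τ v))‖ ≤ ‖v‖ / (τ * √τ) := by
  have h := heatSemigroup_smoothing D hτ.le v
  rw [le_div_iff₀ (by positivity), ← sq_le_sq₀ (by positivity) (norm_nonneg _), mul_pow, mul_pow,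
    Real.sq_sqrt hτ.le]
  have : 0 ≤ ‖heatSemigroup D τ v‖ ^ 2 + 2 * τ * ‖D (heatSemigroup D τ v)‖ ^ 2
      + 2 * τ ^ 2 * ‖lapl D (heatSemigroup D τ v)‖ ^ 2
      + 1 / 3 * τ ^ 3 * ‖D (lapl D (heatSemigroup D τ v))‖ ^ 2 := by positivity
  linarith

/-- The smoothing estimate that starts from `Dv` instead of `v` has a weaker singularity. -/
theorem norm_lapl_heatSemigroup_le_of_D {τ : ℝ} (hτ : 0 < τ) (v : V) :
    ‖lapl D (heatSemigroup D τ v)‖ ≤ ‖D v‖ / √τ := by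
  set φ := fun τ => heatSemigroup D τ v with hφ
  have h1 : ∀ τ, HasDerivAt (fun τ => ‖D (φ τ)‖ ^ 2) (-2 * ‖lapl D (φ τ)‖ ^ 2) τ := by
    intro τ
    have := hasDerivAt_normSq_heatSemigroup D D τ v
    rwa [← inner_lapl_left, real_inner_self_eq_norm_sq] at this
  have h2 : ∀ τ, HasDerivAt (fun τ => ‖lapl D (φ τ)‖ ^ 2) (-2 * ‖D (lapl D (φ τ))‖ ^ 2) τ := by
    intro τ
    have := hasDerivAt_normSq_heatSemigroup D (lapl D) τ v
    rwa [inner_lapl_right, real_inner_self_eq_norm_sq] at this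
  have hE : ∀ τ, HasDerivAt (fun τ => ‖D (φ τ)‖ ^ 2 + 2 * τ * ‖lapl D (φ τ)‖ ^ 2)
      (2 * τ * (-2 * ‖D (lapl D (φ τ))‖ ^ 2)) τ := by
    intro τ
    have := (h1 τ).add (((hasDerivAt_id τ).const_mul 2).mul (h2 τ))
    refine this.congr_deriv ?_
    simp
  have hanti : AntitoneOn (fun τ => ‖D (φ τ)‖ ^ 2 + 2 * τ * ‖lapl D (φ τ)‖ ^ 2) (Ici 0) := by
    apply antitoneOn_of_deriv_nonpos (convex_Ici 0)
    · exact fun τ _ => (hE τ).continuousAt.continuousWithinAt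
    · exact fun τ _ => (hE τ).differentiableAt.differentiableWithinAt
    · intro τ hτ
      rw [interior_Ici] at hτ
      have : 0 < τ := hτ
      rw [(hE τ).deriv]
      have : 0 ≤ 2 * τ * (2 * ‖D (lapl D (φ τ))‖ ^ 2) := by positivity
      linarith
  have h := hanti (mem_Ici.2 le_rfl) (mem_Ici.2 hτ.le) hτ.le
  simp only [hφ, heatSemigroup_zero, mul_zero, zero_mul, add_zero] at h
  rw [le_div_iff₀ (Real.sqrt_pos.2 hτ), ← sq_le_sq₀ (by positivity) (norm_nonneg _), mul_pow,
    Real.sq_sqrt hτ.le]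
  have : 0 ≤ ‖D (heatSemigroup D τ v)‖ ^ 2 + τ * ‖lapl D (heatSemigroup D τ v)‖ ^ 2 := by
    positivity
  linarith

open ContinuousLinearMap in
theorem norm_heatSemigroup_adjoint_le {τ : ℝ} (hτ : 0 < τ) (y : V) :
    ‖heatSemigroup D τ (adjoint D y)‖ ≤ ‖y‖ / √τ := by
  refine norm_le_of_forall_inner_le (by positivity) fun z => ?_
  rw [inner_heatSemigroup_comm, adjoint_inner_left]
  calc _ ≤ ‖y‖ * ‖D (heatSemigroup D τ z)‖ := real_inner_le_norm _ _
    _ ≤ ‖y‖ * (‖z‖ / √τ) := by gcongr; exact norm_D_heatSemigroup_le D hτ z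
    _ = _ := by ring

open ContinuousLinearMap in
theorem norm_lapl_heatSemigroup_adjoint_le {τ : ℝ} (hτ : 0 < τ) (y : V) :
    ‖lapl D (heatSemigroup D τ (adjoint D y))‖ ≤ ‖y‖ / (τ * √τ) := by
  refine norm_le_of_forall_inner_le (by positivity) fun z => ?_
  rw [inner_lapl_left, ← inner_lapl_right, inner_heatSemigroup_comm,
    adjoint_inner_left, ← lapl_heatSemigroup]
  calc _ ≤ ‖y‖ * ‖D (lapl D (heatSemigroup D τ z))‖ := real_inner_le_norm _ _
    _ ≤ ‖y‖ * (‖z‖ / (τ * √τ)) := by gcongr; exact norm_D_lapl_heatSemigroup_le D hτ z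
    _ = _ := by ring

end Semigroup

/-! ### Estimates for the perturbed discrete heat equation -/

section Perturbed

variable {V : Type*} [NormedAddCommGroup V] [InnerProductSpace ℝ V] [CompleteSpace V]

open ContinuousLinearMap in
/-- `ξ` solves `ξ' = -D†(Dξ + R₂) + R₁`, `ξ(0) = 0` on `[0, t]`, where `R₂` is of size `ρ` and `R₁`
is of the larger size `ρ / h` but has a primitive `B` of size `ρ`. -/
structure PerturbedHeat (D : V →L[ℝ] V) (ξ B R₁ R₂ : ℝ → V) (t h ρ : ℝ) : Prop where
  deriv : ∀ s ∈ Ico 0 t, HasDerivWithinAt ξ (-adjoint D (D (ξ s) + R₂ s) + R₁ s) (Ici s) s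
  cont : ContinuousOn ξ (Icc 0 t)
  init : ξ 0 = 0
  derivB : ∀ s ∈ Ico 0 t, HasDerivWithinAt B (R₁ s) (Ici s) s
  contB : ContinuousOn B (Icc 0 t)
  bound₁ : ∀ s ∈ Icc 0 t, ‖R₁ s‖ ≤ ρ / h
  bound₂ : ∀ s ∈ Icc 0 t, ‖R₂ s‖ ≤ ρ
  boundB : ∀ s ∈ Icc 0 t, ‖B s‖ ≤ ρ

variable {D : V →L[ℝ] V} {ξ B R₁ R₂ : ℝ → V} {t h ρ : ℝ}

theorem continuous_heatSemigroup_sub (D : V →L[ℝ] V) (t : ℝ) (v : V) :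
    Continuous fun s => heatSemigroup D (t - s) v := by
  have : Continuous fun τ => heatSemigroup D τ v :=
    continuous_iff_continuousAt.2 fun τ => (hasDerivAt_heatSemigroup D τ v).continuousAt
  exact this.comp (by fun_prop)

theorem hasDerivAt_heatSemigroup_sub (D : V →L[ℝ] V) (t s : ℝ) (v : V) :
    HasDerivAt (fun s => heatSemigroup D (t - s) v) (lapl D (heatSemigroup D (t - s) v)) s := by
  have h1 : HasDerivAt (fun s : ℝ => t - s) (-1) s := by
    simpa using (hasDerivAt_id s).const_sub t
  have := (hasDerivAt_heatSemigroup D (t - s) v).scomp s h1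
  simpa [Function.comp_def] using this

/-- Duhamel's formula: in the pairing with the backward evolution of `v` the terms with `D†D`
cancel. -/
theorem PerturbedHeat.hasDerivWithinAt_inner (H : PerturbedHeat D ξ B R₁ R₂ t h ρ) (v : V)
    {s : ℝ} (hs : s ∈ Ico 0 t) :
    HasDerivWithinAt (fun s => inner ℝ (ξ s) (heatSemigroup D (t - s) v))
      (inner ℝ (R₁ s) (heatSemigroup D (t - s) v)
        - inner ℝ (R₂ s) (D (heatSemigroup D (t - s) v))) (Ici s) s := by
  have := (H.deriv s hs).inner ℝ (hasDerivAt_heatSemigroup_sub D t s v).hasDerivWithinAt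
  refine this.congr_deriv ?_
  simp only [inner_add_left, inner_neg_left, ContinuousLinearMap.adjoint_inner_left,
    inner_lapl_right]
  ring

/-- The variant of `PerturbedHeat.hasDerivWithinAt_inner` in which the derivative of `B` is moved to
the backward evolution of `v`. -/
theorem PerturbedHeat.hasDerivWithinAt_inner_sub (H : PerturbedHeat D ξ B R₁ R₂ t h ρ) (v : V)
    {s : ℝ} (hs : s ∈ Ico 0 t) :
    HasDerivWithinAt (fun s => inner ℝ (ξ s - B s) (heatSemigroup D (t - s) v))
      (-inner ℝ (R₂ s) (D (heatSemigroup D (t - s) v))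
        - inner ℝ (B s) (lapl D (heatSemigroup D (t - s) v))) (Ici s) s := by
  have := ((H.deriv s hs).sub (H.derivB s hs)).inner ℝ
    (hasDerivAt_heatSemigroup_sub D t s v).hasDerivWithinAt
  refine this.congr_deriv ?_
  simp only [inner_add_left, inner_neg_left, inner_sub_left, inner_lapl_right, map_add,
    ContinuousLinearMap.adjoint_inner_left, Pi.sub_apply]
  ring

theorem hasDerivAt_neg_two_sqrt_sub {t s : ℝ} (hs : s < t) :
    HasDerivAt (fun s => -(2 * √(t - s))) (1 / √(t - s)) s := by
  have h1 : HasDerivAt (fun s : ℝ => t - s) (-1) s := by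
    simpa using (hasDerivAt_id s).const_sub t
  have := ((h1.sqrt (by linarith : t - s ≠ 0)).const_mul 2).neg
  refine this.congr_deriv ?_
  have : √(t - s) ≠ 0 := (Real.sqrt_pos.2 (by linarith)).ne'
  field_simp

/-- Growth of the duality pairing on an interval `[r, t]` ending at the final time, where only the
size of `R₁` is used. -/
theorem PerturbedHeat.abs_inner_le_add (H : PerturbedHeat D ξ B R₁ R₂ t h ρ) {v : V} {p q r : ℝ}
    (hr : 0 ≤ r) (hrt : r ≤ t) (hh : 0 < h) (hρ : 0 ≤ ρ)
    (hS : ∀ τ, 0 < τ → τ ≤ t → ‖heatSemigroup D τ v‖ ≤ p + q / √τ) :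
    |inner ℝ (ξ t) v| ≤ |inner ℝ (ξ r) (heatSemigroup D (t - r) v)|
      + ρ / h * (p * (t - r) + 2 * q * √(t - r)) + 2 * ρ * ‖v‖ * √(t - r) := by
  have key := image_norm_le_of_norm_deriv_right_le_deriv_boundary'
    (f := fun s => inner ℝ (ξ s) (heatSemigroup D (t - s) v)) (a := r) (b := t)
    (f' := fun s => (inner ℝ (R₁ s) (heatSemigroup D (t - s) v)
        - inner ℝ (R₂ s) (D (heatSemigroup D (t - s) v))))
    (B := fun s => |inner ℝ (ξ r) (heatSemigroup D (t - r) v)| + ρ / h * (p * (s - r)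
      + q * (2 * √(t - r) + -(2 * √(t - s))))
      + ρ * ‖v‖ * (2 * √(t - r) + -(2 * √(t - s))))
    (B' := fun s => ρ / h * (p + q * (1 / √(t - s))) + ρ * ‖v‖ * (1 / √(t - s)))
    ?_ ?_ ?_ ?_ ?_ ?_ (right_mem_Icc.2 hrt)
  · simp only [sub_self, heatSemigroup_zero, Real.sqrt_zero, mul_zero, neg_zero, add_zero] at key
    rw [Real.norm_eq_abs] at key
    linarith
  · refine ContinuousOn.inner ?_ (continuous_heatSemigroup_sub D t v).continuousOn
    exact H.cont.mono (Icc_subset_Icc_left hr)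
  · exact fun s hs => H.hasDerivWithinAt_inner v ⟨hr.trans hs.1, hs.2⟩
  · simp
  · exact Continuous.continuousOn (by fun_prop)
  · intro s hs
    have h2 := hasDerivAt_neg_two_sqrt_sub hs.2
    have h3 : HasDerivAt (fun s : ℝ => p * (s - r)) p s := by
      simpa using ((hasDerivAt_id s).sub_const r).const_mul p
    have := (((h3.add ((h2.const_add (2 * √(t - r))).const_mul q)).const_mul
      (ρ / h)).const_add (|inner ℝ (ξ r) (heatSemigroup D (t - r) v)|)).add
      ((h2.const_add (2 * √(t - r))).const_mul (ρ * ‖v‖))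
    exact this.hasDerivWithinAt
  · intro s hs
    have hs0 : s ∈ Icc 0 t := ⟨hr.trans hs.1, hs.2.le⟩
    have hτ : 0 < t - s := by linarith [hs.2]
    calc _ ≤ ‖inner ℝ (R₁ s) (heatSemigroup D (t - s) v)‖
          + ‖inner ℝ (R₂ s) (D (heatSemigroup D (t - s) v))‖ := norm_sub_le _ _
      _ ≤ ‖R₁ s‖ * ‖heatSemigroup D (t - s) v‖ + ‖R₂ s‖ * ‖D (heatSemigroup D (t - s) v)‖ :=
          add_le_add (norm_inner_le_norm _ _) (norm_inner_le_norm _ _)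
      _ ≤ ρ / h * (p + q / √(t - s)) + ρ * (‖v‖ / √(t - s)) := by
          gcongr
          · exact H.bound₁ s hs0
          · exact hS _ hτ (by linarith [hs0.1])
          · exact H.bound₂ s hs0
          · exact norm_D_heatSemigroup_le D hτ v
      _ = _ := by ring

/-- Growth of the duality pairing over the whole interval, where the singular part of `R₁ = B'` is
integrated by parts in time except on the last piece of length `h`. -/
theorem PerturbedHeat.abs_inner_le_of_le (H : PerturbedHeat D ξ B R₁ R₂ t h ρ) {v : V}
    {p q x y z : ℝ} (hh : 0 < h) (hht : h ≤ t) (hρ : 0 ≤ ρ) (hq : 0 ≤ q)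
    (hy : 0 ≤ y) (hz : 0 ≤ z)
    (hS : ∀ τ, 0 < τ → τ ≤ t → ‖heatSemigroup D τ v‖ ≤ p + q / √τ)
    (hA : ∀ τ, 0 < τ → τ ≤ t →
      ‖lapl D (heatSemigroup D τ v)‖ ≤ x * (1 / τ) + y * (1 / √τ) + z * (1 / (τ * √τ))) :
    |inner ℝ (ξ t) v| ≤ ρ * (3 * p + 4 * q / √h + 2 * ‖v‖ * √t + x * Real.log (t / h)
      + 2 * y * √t + 2 * z / √h) := by
  have ht : 0 < t := hh.trans_le hht
  have near := H.abs_inner_le_add (r := t - h) (by linarith) (by linarith) hh hρ hS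
  have hsub : t - (t - h) = h := by ring
  rw [hsub] at near
  have hlt : ∀ s ∈ Icc 0 (t - h), 0 < t - s := fun s hs => by linarith [hs.2]
  have far := image_norm_le_of_norm_deriv_right_le_deriv_boundary'
    (f := fun s => inner ℝ (ξ s - B s) (heatSemigroup D (t - s) v)) (a := 0) (b := t - h)
    (f' := fun s => -inner ℝ (R₂ s) (D (heatSemigroup D (t - s) v))
        - inner ℝ (B s) (lapl D (heatSemigroup D (t - s) v)))
    (B := fun s => |inner ℝ (B 0) (heatSemigroup D t v)|
      + ρ * (‖v‖ * (2 * √t + -(2 * √(t - s))))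
      + ρ * (x * (Real.log t - Real.log (t - s)) + y * (2 * √t + -(2 * √(t - s)))
        + z * (2 * (√(t - s))⁻¹ - 2 * (√t)⁻¹)))
    (B' := fun s => ρ * (‖v‖ * (1 / √(t - s)))
      + ρ * (x * (1 / (t - s)) + y * (1 / √(t - s)) + z * (1 / ((t - s) * √(t - s)))))
    ?_ ?_ ?_ ?_ ?_ ?_ (right_mem_Icc.2 (by linarith))
  · simp only [hsub, Real.norm_eq_abs] at far
    have hB1 : |inner ℝ (B (t - h)) (heatSemigroup D h v)| ≤ ρ * (p + q / √h) :=
      (abs_real_inner_le_norm _ _).trans (mul_le_mul (H.boundB _ ⟨by linarith, by linarith⟩)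
        (hS _ hh hht) (norm_nonneg _) hρ)
    have hB0 : |inner ℝ (B 0) (heatSemigroup D t v)| ≤ ρ * (p + q / √h) := by
      refine (abs_real_inner_le_norm _ _).trans (mul_le_mul (H.boundB _ ⟨le_rfl, ht.le⟩)
        ((hS _ ht le_rfl).trans ?_) (norm_nonneg _) hρ)
      gcongr
    have hsplit : |inner ℝ (ξ (t - h)) (heatSemigroup D h v)| ≤
        |inner ℝ (ξ (t - h) - B (t - h)) (heatSemigroup D h v)|
        + |inner ℝ (B (t - h)) (heatSemigroup D h v)| := by
      have : inner ℝ (ξ (t - h)) (heatSemigroup D h v) =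
        inner ℝ (ξ (t - h) - B (t - h)) (heatSemigroup D h v)
        + inner ℝ (B (t - h)) (heatSemigroup D h v) := by rw [inner_sub_left]; ring
      rw [this]; exact abs_add_le _ _
    have hsq : √h ≤ √t := Real.sqrt_le_sqrt hht
    have hsh : 0 < √h := Real.sqrt_pos.2 hh
    have e1 : ρ / h * (p * h + 2 * q * √h) = ρ * (p + 2 * q / √h) := by
      have : √h * √h = h := Real.mul_self_sqrt hh.le
      field_simp
      linear_combination (2 * q * ρ) * this
    rw [e1] at near
    rw [Real.log_div ht.ne' hh.ne']
    have t0 : 0 ≤ (√t)⁻¹ := by positivity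
    have e2 : z * (2 * (√h)⁻¹ - 2 * (√t)⁻¹) ≤ 2 * z / √h := by
      rw [div_eq_mul_inv]
      nlinarith [mul_nonneg hz t0]
    have e3 : y * (2 * √t + -(2 * √h)) ≤ 2 * y * √t := by nlinarith
    have e4 := mul_le_mul_of_nonneg_left e2 hρ
    have e5 := mul_le_mul_of_nonneg_left e3 hρ
    have e6 : q / √h = q * (√h)⁻¹ := div_eq_mul_inv _ _
    have e7 : 2 * q / √h = 2 * (q / √h) := by ring
    have e8 : 4 * q / √h = 4 * (q / √h) := by ring
    rw [e7] at near
    rw [e8]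
    linarith
  · refine ContinuousOn.inner ?_ (continuous_heatSemigroup_sub D t v).continuousOn
    exact (H.cont.sub H.contB).mono (Icc_subset_Icc_right (by linarith))
  · exact fun s hs => H.hasDerivWithinAt_inner_sub v ⟨hs.1, by linarith [hs.2]⟩
  · simp [H.init]
  · have c1 : ContinuousOn (fun s => Real.log (t - s)) (Icc 0 (t - h)) :=
      ContinuousOn.log (by fun_prop) fun s hs => (hlt s hs).ne'
    have c2 : ContinuousOn (fun s => (√(t - s))⁻¹) (Icc 0 (t - h)) :=
      ContinuousOn.inv₀ (by fun_prop) fun s hs => (Real.sqrt_pos.2 (hlt s hs)).ne'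
    fun_prop
  · intro s hs
    have hτ := hlt s ⟨hs.1, hs.2.le⟩
    have hd : HasDerivAt (fun s : ℝ => t - s) (-1) s := by
      simpa using (hasDerivAt_id s).const_sub t
    have h2 := hasDerivAt_neg_two_sqrt_sub (show s < t by linarith)
    have h3 := (hd.log hτ.ne').const_sub (Real.log t)
    have h4 := (((hd.sqrt hτ.ne').inv (Real.sqrt_pos.2 hτ).ne').const_mul 2).sub_const
      (2 * (√t)⁻¹)
    have := (((h2.const_add (2 * √t)).const_mul ‖v‖).const_mul ρ).const_add
      (|inner ℝ (B 0) (heatSemigroup D t v)|) |>.add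
      ((((h3.const_mul x).add ((h2.const_add (2 * √t)).const_mul y)).add
        (h4.const_mul z)).const_mul ρ)
    refine (this.congr_deriv ?_).hasDerivWithinAt
    have hs0 : √(t - s) ≠ 0 := (Real.sqrt_pos.2 hτ).ne'
    have hsq : √(t - s) ^ 2 = t - s := Real.sq_sqrt hτ.le
    rw [hsq]
    field_simp
  · intro s hs
    have hτ := hlt s ⟨hs.1, hs.2.le⟩
    have hs0 : s ∈ Icc 0 t := ⟨hs.1, by linarith [hs.2]⟩
    calc _ ≤ ‖-inner ℝ (R₂ s) (D (heatSemigroup D (t - s) v))‖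
          + ‖inner ℝ (B s) (lapl D (heatSemigroup D (t - s) v))‖ := norm_sub_le _ _
      _ ≤ ‖R₂ s‖ * ‖D (heatSemigroup D (t - s) v)‖
          + ‖B s‖ * ‖lapl D (heatSemigroup D (t - s) v)‖ := by
          rw [norm_neg]
          exact add_le_add (norm_inner_le_norm _ _) (norm_inner_le_norm _ _)
      _ ≤ ρ * (‖v‖ / √(t - s)) + ρ * (x * (1 / (t - s)) + y * (1 / √(t - s))
            + z * (1 / ((t - s) * √(t - s)))) := by
          gcongr
          · exact H.bound₂ s hs0
          · exact norm_D_heatSemigroup_le D hτ v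
          · exact H.boundB s hs0
          · exact hA _ hτ (by linarith [hs0.1])
      _ = _ := by ring

theorem PerturbedHeat.norm_le (H : PerturbedHeat D ξ B R₁ R₂ t h ρ) (ht : 0 ≤ t) (hh : 0 < h)
    (hρ : 0 ≤ ρ) : ‖ξ t‖ ≤ ρ * (t / h + 2 * √t) := by
  refine norm_le_of_forall_inner_le (by positivity) fun v => (le_abs_self _).trans ?_
  have := H.abs_inner_le_add (v := v) (p := ‖v‖) (q := 0) le_rfl ht hh hρ
    fun τ hτ _ => by simpa using norm_heatSemigroup_le D hτ.le v
  simp only [H.init, inner_zero_left, abs_zero, sub_zero] at this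
  refine this.trans_eq ?_
  ring

open ContinuousLinearMap in
/-- The test element is `D†` of the quantity that is bounded. -/
theorem PerturbedHeat.norm_D_le (H : PerturbedHeat D ξ B R₁ R₂ t h ρ) (ht : 0 ≤ t) (hh : 0 < h)
    (hρ : 0 ≤ ρ) {K : ℝ} (hD : ‖D‖ ≤ K / h) : ‖D (ξ t)‖ ≤ (2 + 2 * K) * √t * (ρ / h) := by
  set y := D (ξ t) with hy
  have hDy : ‖adjoint D y‖ ≤ K / h * ‖y‖ := by
    refine (le_opNorm _ _).trans ?_
    rw [LinearIsometryEquiv.norm_map]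
    gcongr
  have hK : 0 ≤ K / h := (norm_nonneg _).trans hD
  have h1 := H.abs_inner_le_add (v := adjoint D y) (p := 0) (q := ‖y‖) le_rfl ht hh hρ
    fun τ hτ _ => by simpa using norm_heatSemigroup_adjoint_le D hτ y
  simp only [H.init, inner_zero_left, abs_zero, sub_zero] at h1
  rw [adjoint_inner_right, ← hy, real_inner_self_eq_norm_sq, abs_of_nonneg (by positivity)] at h1
  have h2 : 2 * ρ * ‖adjoint D y‖ * √t ≤ 2 * ρ * (K / h * ‖y‖) * √t := by gcongr
  rcases (norm_nonneg y).eq_or_lt with h0 | h0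
  · rw [← h0]
    have : (2 + 2 * K) * √t * (ρ / h) = 2 * √t * (ρ / h) + 2 * √t * ρ * (K / h) := by ring
    rw [this]; positivity
  · have h3 : ‖y‖ * ‖y‖ ≤ ((2 + 2 * K) * √t * (ρ / h)) * ‖y‖ := by
      have : ((2 + 2 * K) * √t * (ρ / h)) * ‖y‖ =
        ρ / h * (0 * t + 2 * ‖y‖ * √t) + 2 * ρ * (K / h * ‖y‖) * √t := by ring
      rw [this, ← pow_two]
      linarith
    exact le_of_mul_le_mul_right h3 h0

open ContinuousLinearMap in
/-- The pairing of `Dξ` with a fixed element gains half a power of `h` over `‖R₁‖`. -/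
theorem PerturbedHeat.abs_inner_D_le (H : PerturbedHeat D ξ B R₁ R₂ t h ρ) (ht : 0 ≤ t)
    (hh : 0 < h) (hρ : 0 ≤ ρ) (y : V) :
    |inner ℝ (D (ξ t)) y| ≤ ρ * (6 * ‖y‖ / √h + 2 * ‖adjoint D y‖ * √t) := by
  rw [← adjoint_inner_right]
  have hS : ∀ τ, 0 < τ → τ ≤ t → ‖heatSemigroup D τ (adjoint D y)‖ ≤ 0 + ‖y‖ / √τ :=
    fun τ hτ _ => by simpa using norm_heatSemigroup_adjoint_le D hτ y
  rcases le_total h t with hht | hht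
  · have := H.abs_inner_le_of_le (v := adjoint D y) (p := 0) (q := ‖y‖) (x := 0) (y := 0)
      (z := ‖y‖) hh hht hρ (norm_nonneg _) le_rfl (norm_nonneg _) hS
      fun τ hτ _ => by
        simpa [div_eq_mul_inv] using norm_lapl_heatSemigroup_adjoint_le D hτ y
    refine this.trans_eq ?_
    ring
  · have := H.abs_inner_le_add (v := adjoint D y) (p := 0) (q := ‖y‖) le_rfl ht hh hρ hS
    simp only [H.init, inner_zero_left, abs_zero, sub_zero] at this
    refine this.trans ?_
    have hsh : 0 < √h := Real.sqrt_pos.2 hh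
    have h1 : √t / h ≤ 1 / √h := by
      rw [div_le_div_iff₀ hh hsh, one_mul]
      calc √t * √h ≤ √h * √h := by gcongr
        _ = h := Real.mul_self_sqrt hh.le
    have h2 : ρ / h * (0 * t + 2 * ‖y‖ * √t) = 2 * (ρ * ‖y‖) * (√t / h) := by ring
    have h3 : 6 * ‖y‖ / √h = 6 * ‖y‖ * (1 / √h) := by ring
    have h4 : 0 ≤ ρ * ‖y‖ * (1 / √h) := by positivity
    have h5 := mul_le_mul_of_nonneg_left h1 (show 0 ≤ 2 * (ρ * ‖y‖) by positivity)
    rw [zero_add, h2, h3]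
    linarith

/-- The pairing with an element `v` that is close to an element `v₂` on which `D` is small. -/
theorem PerturbedHeat.abs_inner_le_of_split (H : PerturbedHeat D ξ B R₁ R₂ t h ρ)
    (hh : 0 < h) (hht : h ≤ t) (hρ : 0 ≤ ρ) (v₁ v₂ : V) :
    |inner ℝ (ξ t) (v₁ + v₂)| ≤ ρ * (3 * ‖v₁ + v₂‖ + 2 * ‖v₁ + v₂‖ * √t
      + ‖v₁‖ * Real.log (t / h) + 2 * ‖D v₂‖ * √t) := by
  have := H.abs_inner_le_of_le (v := v₁ + v₂) (p := ‖v₁ + v₂‖) (q := 0) (x := ‖v₁‖)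
    (y := ‖D v₂‖) (z := 0) hh hht hρ le_rfl (norm_nonneg _) le_rfl
    (fun τ hτ _ => by rw [zero_div, add_zero]; exact norm_heatSemigroup_le D hτ.le _)
    fun τ hτ _ => by
      rw [map_add, map_add]
      refine (norm_add_le _ _).trans ?_
      have h1 := norm_lapl_heatSemigroup_le D hτ v₁
      have h2 := norm_lapl_heatSemigroup_le_of_D D hτ v₂
      rw [div_eq_mul_one_div] at h1 h2
      linarith
  refine this.trans_eq ?_
  ring

/-- A conserved quantity changes by `R₁ = B'` only. -/
theorem PerturbedHeat.abs_inner_le_of_D_eq_zero (H : PerturbedHeat D ξ B R₁ R₂ t h ρ)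
    (ht : 0 ≤ t) {v : V} (hv : D v = 0) : |inner ℝ (ξ t) v| ≤ 2 * ρ * ‖v‖ := by
  have hc := constant_of_has_deriv_right_zero (f := fun s => inner ℝ (ξ s - B s) v) (a := 0)
    (b := t) ((H.cont.sub H.contB).inner continuousOn_const) (fun s hs => by
      have := ((H.deriv s hs).sub (H.derivB s hs)).inner ℝ (hasDerivWithinAt_const s _ v)
      refine this.congr_deriv ?_
      simp [inner_add_left, ContinuousLinearMap.adjoint_inner_left, hv])
    t (right_mem_Icc.2 ht)
  simp only [H.init, inner_sub_left, inner_neg_left, zero_sub] at hc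
  have h1 : inner ℝ (ξ t) v = inner ℝ (B t) v - inner ℝ (B 0) v := by linarith
  rw [h1]
  have b0 := (abs_real_inner_le_norm (B 0) v).trans
    (mul_le_mul_of_nonneg_right (H.boundB 0 ⟨le_rfl, ht⟩) (norm_nonneg v))
  have b1 := (abs_real_inner_le_norm (B t) v).trans
    (mul_le_mul_of_nonneg_right (H.boundB t ⟨ht, le_rfl⟩) (norm_nonneg v))
  calc _ ≤ |inner ℝ (B t) v| + |inner ℝ (B 0) v| := abs_sub _ _
    _ ≤ _ := by linarith

end Perturbed

/-! ### Meshes -/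

section MeshFacts

variable {N : ℕ} (𝒯 : Mesh N)

theorem Mesh.left_lt_right (j : Fin N) : 𝒯.left j < 𝒯.right j :=
  𝒯.strictMono Fin.castSucc_lt_succ

theorem Mesh.len_pos (j : Fin N) : 0 < 𝒯.len j := sub_pos.2 (𝒯.left_lt_right j)

theorem Mesh.len_le_size (j : Fin N) : 𝒯.len j ≤ 𝒯.size :=
  le_ciSup (f := fun j => 𝒯.len j) (Set.finite_range _).bddAbove j

theorem Mesh.size_pos [NeZero N] : 0 < 𝒯.size := (𝒯.len_pos 0).trans_le (𝒯.len_le_size 0)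

theorem Mesh.node_mem (n : Fin (N + 1)) : 𝒯.node n ∈ Icc 0 (2 * Real.pi) := by
  rw [← 𝒯.first, ← 𝒯.last]
  exact ⟨𝒯.strictMono.monotone (Fin.zero_le _), 𝒯.strictMono.monotone (Fin.le_last _)⟩

theorem Mesh.cell_subset (j : Fin N) : Icc (𝒯.left j) (𝒯.right j) ⊆ Icc 0 (2 * Real.pi) :=
  Icc_subset_Icc (𝒯.node_mem _).1 (𝒯.node_mem _).2

theorem sum_succ_sub_castSucc {N : ℕ} (f : Fin (N + 1) → ℝ) :
    ∑ j : Fin N, (f j.succ - f j.castSucc) = f (Fin.last N) - f 0 := by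
  have h1 := Fin.sum_univ_succ f
  have h2 := Fin.sum_univ_castSucc f
  rw [Finset.sum_sub_distrib]
  linarith

theorem Mesh.sum_len : ∑ j, 𝒯.len j = 2 * Real.pi := by
  have := sum_succ_sub_castSucc 𝒯.node
  rwa [𝒯.first, 𝒯.last, sub_zero] at this

theorem Mesh.size_le [NeZero N] : 𝒯.size ≤ 2 * Real.pi := by
  refine ciSup_le fun j => ?_
  rw [← 𝒯.sum_len]
  exact Finset.single_le_sum (f := fun j => 𝒯.len j) (fun i _ => (𝒯.len_pos i).le)
    (Finset.mem_univ j)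

theorem Mesh.QuasiUniform.pos [NeZero N] {𝒯 : Mesh N} {c : ℝ} (h : 𝒯.QuasiUniform c) : 0 < c :=
  pos_of_mul_pos_left (𝒯.size_pos.trans_le (h 0)) (𝒯.len_pos 0).le

theorem Mesh.QuasiUniform.inv_len_le [NeZero N] {𝒯 : Mesh N} {c : ℝ} (h : 𝒯.QuasiUniform c)
    (j : Fin N) : (𝒯.len j)⁻¹ ≤ c / 𝒯.size := by
  rw [inv_eq_one_div, div_le_div_iff₀ (𝒯.len_pos j) 𝒯.size_pos, one_mul]
  exact h j

theorem Mesh.inv_card_le [NeZero N] :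
    (N : ℝ)⁻¹ ≤ 𝒯.size / (2 * Real.pi) := by
  have hN : (0 : ℝ) < N := Nat.cast_pos.2 (NeZero.pos N)
  rw [inv_eq_one_div, div_le_div_iff₀ hN (by positivity), one_mul, ← 𝒯.sum_len]
  refine (Finset.sum_le_sum fun j _ => 𝒯.len_le_size j).trans_eq ?_
  simp [mul_comm]

end MeshFacts

/-! ### Numerical fluxes -/

section Fluxes

variable {N : ℕ} (𝒯 : Mesh N)

theorem traceMinus_succ (β : ℝ) (v : Fin N → ℝ[X]) (j : Fin N) :
    traceMinus 𝒯 β v j.succ = (v j).eval (𝒯.right j) := rfl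

theorem traceMinus_zero (β : ℝ) (v : Fin N → ℝ[X]) : traceMinus 𝒯 β v 0 = β := rfl

theorem tracePlus_castSucc (β : ℝ) (v : Fin N → ℝ[X]) (j : Fin N) :
    tracePlus 𝒯 β v j.castSucc = (v j).eval (𝒯.left j) := by simp [tracePlus]

theorem tracePlus_last (β : ℝ) (v : Fin N → ℝ[X]) : tracePlus 𝒯 β v (Fin.last N) = β := by
  simp [tracePlus]

variable [NeZero N]

/-- The homogeneous boundary condition of the same type. -/
def BC.hom : BC → BC
  | .periodic => .periodic
  | .mixed _ _ => .mixed 0 0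

/-- The flux of `u` for homogeneous boundary conditions. -/
noncomputable def hatU (F : Flux) (bc : BC) (v : Fin N → ℝ[X]) : Fin (N + 1) → ℝ :=
  fluxU 𝒯 0 v F bc.hom

/-- `f` satisfies the part of the boundary condition that concerns the flux `û`. -/
def BC.Match (f : ℝ → ℝ) (t : ℝ) : Flux → BC → Prop
  | _, .periodic => f 0 = f (2 * Real.pi)
  | .minusPlus, .mixed g₀ _ => f 0 = g₀ t
  | .plusMinus, .mixed _ g₁ => f (2 * Real.pi) = g₁ t

theorem fluxQ_eq_fluxU_swap (t : ℝ) (v : Fin N → ℝ[X]) (F : Flux) (bc : BC) :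
    fluxQ 𝒯 t v F bc = fluxU 𝒯 t v F.swap bc := by
  cases F <;> cases bc <;> rfl

theorem rev_zero_succ : (Fin.rev (0 : Fin N)).succ = Fin.last N := by
  ext
  have := NeZero.pos N
  simp [Fin.val_rev]
  omega

theorem castSucc_zero_eq : (0 : Fin N).castSucc = 0 := rfl

theorem Mesh.right_rev_zero : 𝒯.right (Fin.rev 0) = 2 * Real.pi := by
  rw [Mesh.right, rev_zero_succ, 𝒯.last]

theorem Mesh.left_zero : 𝒯.left 0 = 0 := by
  rw [Mesh.left, castSucc_zero_eq, 𝒯.first]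

/-- The flux of a function that agrees with a given function `f` at the upwind ends of all cells,
up to a perturbation. -/
theorem fluxU_eq_add_hatU {F : Flux} {bc : BC} {t : ℝ} {f : ℝ → ℝ} (hf : bc.Match f t F)
    {p : Fin N → ℝ[X]} (hp : ∀ j, (p j).eval (endpt (𝒯.left j) (𝒯.right j) F) =
      f (endpt (𝒯.left j) (𝒯.right j) F)) (v : Fin N → ℝ[X]) (n : Fin (N + 1)) :
    fluxU 𝒯 t v F bc n = f (𝒯.node n) + hatU 𝒯 F bc (v - p) n := by
  cases F
  · have hs : ∀ j : Fin N, (p j).eval (𝒯.right j) = f (𝒯.node j.succ) := hp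
    have h0 := hs (Fin.rev 0)
    rw [𝒯.right_rev_zero, rev_zero_succ, 𝒯.last] at h0
    cases bc
    · have hf' : f 0 = f (2 * Real.pi) := hf
      induction n using Fin.cases with
      | zero =>
        simp only [hatU, BC.hom, fluxU, traceMinusPer, traceMinus_zero, 𝒯.first, hf', ← h0]
        simp
      | succ j => simp [hatU, BC.hom, fluxU, traceMinusPer, traceMinus_succ, ← hs]
    · have hf' : f 0 = _ := hf
      induction n using Fin.cases with
      | zero =>
        simp only [hatU, BC.hom, fluxU, traceMinus_zero, 𝒯.first, hf']
        simp
      | succ j => simp [hatU, BC.hom, fluxU, traceMinus_succ, ← hs]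
  · have hs : ∀ j : Fin N, (p j).eval (𝒯.left j) = f (𝒯.node j.castSucc) := hp
    have h0 := hs 0
    rw [𝒯.left_zero, castSucc_zero_eq, 𝒯.first] at h0
    cases bc
    · have hf' : f 0 = f (2 * Real.pi) := hf
      induction n using Fin.lastCases with
      | last =>
        simp only [hatU, BC.hom, fluxU, tracePlusPer, tracePlus_last, 𝒯.last, ← hf', ← h0]
        simp
      | cast j => simp [hatU, BC.hom, fluxU, tracePlusPer, tracePlus_castSucc, ← hs]
    · have hf' : f (2 * Real.pi) = _ := hf
      induction n using Fin.lastCases with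
      | last =>
        simp only [hatU, BC.hom, fluxU, tracePlus_last, 𝒯.last, hf']
        simp
      | cast j => simp [hatU, BC.hom, fluxU, tracePlus_castSucc, ← hs]

theorem hatU_add (F : Flux) (bc : BC) (v w : Fin N → ℝ[X]) (n : Fin (N + 1)) :
    hatU 𝒯 F bc (v + w) n = hatU 𝒯 F bc v n + hatU 𝒯 F bc w n := by
  cases F
  · induction n using Fin.cases <;> cases bc <;>
      simp [hatU, BC.hom, fluxU, traceMinusPer, traceMinus_zero, traceMinus_succ]
  · induction n using Fin.lastCases <;> cases bc <;>
      simp [hatU, BC.hom, fluxU, tracePlusPer, tracePlus_last, tracePlus_castSucc]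

theorem hatU_smul (F : Flux) (bc : BC) (s : ℝ) (v : Fin N → ℝ[X]) (n : Fin (N + 1)) :
    hatU 𝒯 F bc (s • v) n = s * hatU 𝒯 F bc v n := by
  cases F
  · induction n using Fin.cases <;> cases bc <;>
      simp [hatU, BC.hom, fluxU, traceMinusPer, traceMinus_zero, traceMinus_succ]
  · induction n using Fin.lastCases <;> cases bc <;>
      simp [hatU, BC.hom, fluxU, tracePlusPer, tracePlus_last, tracePlus_castSucc]

theorem hatU_minusPlus_succ (bc : BC) (v : Fin N → ℝ[X]) (j : Fin N) :
    hatU 𝒯 .minusPlus bc v j.succ = (v j).eval (𝒯.right j) := by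
  cases bc <;> simp [hatU, BC.hom, fluxU, traceMinusPer, traceMinus_succ]

theorem hatU_plusMinus_castSucc (bc : BC) (v : Fin N → ℝ[X]) (j : Fin N) :
    hatU 𝒯 .plusMinus bc v j.castSucc = (v j).eval (𝒯.left j) := by
  cases bc <;> simp [hatU, BC.hom, fluxU, tracePlusPer, tracePlus_castSucc]

theorem hatU_periodic (F : Flux) (v : Fin N → ℝ[X]) :
    hatU 𝒯 F .periodic v (Fin.last N) = hatU 𝒯 F .periodic v 0 := by
  cases F
  · rw [← rev_zero_succ, hatU_minusPlus_succ, 𝒯.right_rev_zero]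
    rfl
  · rw [← castSucc_zero_eq, hatU_plusMinus_castSucc, 𝒯.left_zero]
    simp [hatU, BC.hom, fluxU, tracePlusPer, tracePlus_last]

theorem hatU_minusPlus_mixed (g₀ g₁ : ℝ → ℝ) (v : Fin N → ℝ[X]) :
    hatU 𝒯 .minusPlus (.mixed g₀ g₁) v 0 = 0 := rfl

theorem hatU_plusMinus_mixed (g₀ g₁ : ℝ → ℝ) (v : Fin N → ℝ[X]) :
    hatU 𝒯 .plusMinus (.mixed g₀ g₁) v (Fin.last N) = 0 := by
  simp [hatU, BC.hom, fluxU, tracePlus_last]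

/-- The boundary terms in the duality of the two fluxes cancel: under mixed conditions, one factor
at each end is a homogeneous boundary value. -/
theorem hatU_mul_hatU_swap (F : Flux) (bc : BC) (v w : Fin N → ℝ[X]) :
    hatU 𝒯 F bc v (Fin.last N) * hatU 𝒯 F.swap bc w (Fin.last N) =
      hatU 𝒯 F bc v 0 * hatU 𝒯 F.swap bc w 0 := by
  cases bc with
  | periodic => rw [hatU_periodic, hatU_periodic]
  | mixed g₀ g₁ =>
    cases F
    · simp [Flux.swap, hatU_minusPlus_mixed, hatU_plusMinus_mixed]
    · simp [Flux.swap, hatU_minusPlus_mixed, hatU_plusMinus_mixed]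

/-- Each node takes its flux from one cell, and the flux from outside is zero or periodic. -/
theorem sum_sq_hatU_le (F : Flux) (bc : BC) (v : Fin N → ℝ[X]) :
    ∑ j : Fin N, hatU 𝒯 F bc v j.succ ^ 2 ≤
        ∑ j, (v j).eval (endpt (𝒯.left j) (𝒯.right j) F) ^ 2 ∧
      ∑ j : Fin N, hatU 𝒯 F bc v j.castSucc ^ 2 ≤
        ∑ j, (v j).eval (endpt (𝒯.left j) (𝒯.right j) F) ^ 2 := by
  have h := sum_succ_sub_castSucc fun n => hatU 𝒯 F bc v n ^ 2
  rw [Finset.sum_sub_distrib] at h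
  cases F
  · have e : ∑ j, (v j).eval (endpt (𝒯.left j) (𝒯.right j) .minusPlus) ^ 2 =
        ∑ j : Fin N, hatU 𝒯 .minusPlus bc v j.succ ^ 2 :=
      Finset.sum_congr rfl fun j _ => by rw [hatU_minusPlus_succ]; rfl
    refine ⟨e.ge, ?_⟩
    rw [e]
    have : hatU 𝒯 .minusPlus bc v 0 ^ 2 ≤ hatU 𝒯 .minusPlus bc v (Fin.last N) ^ 2 := by
      cases bc with
      | periodic => rw [hatU_periodic]
      | mixed g₀ g₁ => rw [hatU_minusPlus_mixed, zero_pow two_ne_zero]; exact sq_nonneg _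
    linarith
  · have e : ∑ j, (v j).eval (endpt (𝒯.left j) (𝒯.right j) .plusMinus) ^ 2 =
        ∑ j : Fin N, hatU 𝒯 .plusMinus bc v j.castSucc ^ 2 :=
      Finset.sum_congr rfl fun j _ => by rw [hatU_plusMinus_castSucc]; rfl
    refine ⟨?_, e.ge⟩
    rw [e]
    have : hatU 𝒯 .plusMinus bc v (Fin.last N) ^ 2 ≤ hatU 𝒯 .plusMinus bc v 0 ^ 2 := by
      cases bc with
      | periodic => rw [hatU_periodic]
      | mixed g₀ g₁ => rw [hatU_plusMinus_mixed, zero_pow two_ne_zero]; exact sq_nonneg _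
    linarith

/-- The contribution of a cell to the discrete first derivative of `v`, tested with `w`. -/
noncomputable def cellForm (F : Flux) (bc : BC) (v : Fin N → ℝ[X]) (j : Fin N) (w : ℝ[X]) : ℝ :=
  -(∫ x in 𝒯.left j..𝒯.right j, (v j).eval x * w.derivative.eval x)
    + hatU 𝒯 F bc v j.succ * w.eval (𝒯.right j)
    - hatU 𝒯 F bc v j.castSucc * w.eval (𝒯.left j)

/-- The discrete first derivative for a flux is minus the adjoint of the one for the opposite
flux. -/
theorem sum_cellForm_swap (F : Flux) (bc : BC) (v w : Fin N → ℝ[X]) :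
    ∑ j, cellForm 𝒯 F bc v j (w j) = -∑ j, cellForm 𝒯 F.swap bc w j (v j) := by
  have key : ∀ j, cellForm 𝒯 F bc v j (w j) + cellForm 𝒯 F.swap bc w j (v j) =
      hatU 𝒯 F bc v j.succ * hatU 𝒯 F.swap bc w j.succ -
        hatU 𝒯 F bc v j.castSucc * hatU 𝒯 F.swap bc w j.castSucc := by
    intro j
    have hp := integral_derivative_mul (v j) (w j) (𝒯.left j) (𝒯.right j)
    have hc : ∫ x in 𝒯.left j..𝒯.right j, (w j).eval x * (v j).derivative.eval x =
        ∫ x in 𝒯.left j..𝒯.right j, (v j).derivative.eval x * (w j).eval x := by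
      congr 1; funext x; ring
    cases F
    · simp only [cellForm, Flux.swap, hatU_minusPlus_succ, hatU_plusMinus_castSucc]
      rw [hc, hp]; ring
    · simp only [cellForm, Flux.swap, hatU_minusPlus_succ, hatU_plusMinus_castSucc]
      rw [hc, hp]; ring
  have h1 := Finset.sum_congr rfl fun j (_ : j ∈ Finset.univ) => key j
  rw [Finset.sum_add_distrib, sum_succ_sub_castSucc
    (fun n => hatU 𝒯 F bc v n * hatU 𝒯 F.swap bc w n), hatU_mul_hatU_swap, sub_self] at h1
  linarith

end Fluxes

/-! ### The finite element space as a Hilbert space -/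

/-- The finite element space `V_h`, with the inner product of `L²(0, 2π)`. -/
def DGSpace {N : ℕ} (_ : Mesh N) (k : ℕ) : Type := Fin N → degreeLT ℝ (k + 1)

namespace DGSpace

variable {N : ℕ} {𝒯 : Mesh N} {k : ℕ}

noncomputable instance : AddCommGroup (DGSpace 𝒯 k) :=
  inferInstanceAs (AddCommGroup (Fin N → degreeLT ℝ (k + 1)))

noncomputable instance : Module ℝ (DGSpace 𝒯 k) :=
  inferInstanceAs (Module ℝ (Fin N → degreeLT ℝ (k + 1)))

/-- The polynomial on each cell. -/
def poly (v : DGSpace 𝒯 k) : Fin N → ℝ[X] := fun j => (v j : ℝ[X])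

theorem poly_mem (v : DGSpace 𝒯 k) (j : Fin N) : v.poly j ∈ degreeLT ℝ (k + 1) := (v j).2

theorem poly_add (v w : DGSpace 𝒯 k) : (v + w).poly = v.poly + w.poly := rfl

theorem poly_smul (s : ℝ) (v : DGSpace 𝒯 k) : (s • v).poly = s • v.poly := rfl

theorem poly_zero : (0 : DGSpace 𝒯 k).poly = 0 := rfl

theorem ext_poly {v w : DGSpace 𝒯 k} (h : v.poly = w.poly) : v = w :=
  funext fun j => Subtype.ext (congrFun h j)

/-- The element of `V_h` with given polynomials. -/
def mk (p : Fin N → ℝ[X]) (hp : ∀ j, p j ∈ degreeLT ℝ (k + 1)) : DGSpace 𝒯 k :=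
  fun j => ⟨p j, hp j⟩

theorem poly_mk (p : Fin N → ℝ[X]) (hp : ∀ j, p j ∈ degreeLT ℝ (k + 1)) :
    (mk p hp : DGSpace 𝒯 k).poly = p := rfl

theorem eq_zero_of_integral_sq_eq_zero {a b : ℝ} (hab : a < b) {p : ℝ[X]}
    (h : ∫ x in a..b, p.eval x * p.eval x = 0) : p = 0 := by
  obtain ⟨Λ, hΛ⟩ := exists_legBound p.natDegree
  have hp : p ∈ degreeLT ℝ (p.natDegree + 1) := by
    rw [mem_degreeLT]
    exact degree_le_natDegree.trans_lt (by exact_mod_cast Nat.lt_succ_self _)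
  refine p.eq_zero_of_infinite_isRoot ((Icc_infinite hab).mono fun x hx => ?_)
  have := sq_eval_le hΛ hab hp hx
  rw [h, mul_zero] at this
  exact pow_eq_zero_iff (two_ne_zero) |>.1 (le_antisymm this (sq_nonneg _))

/-- The `L²` inner product. -/
@[reducible]
noncomputable def core : InnerProductSpace.Core ℝ (DGSpace 𝒯 k) where
  inner v w := ∑ j, ∫ x in 𝒯.left j..𝒯.right j, (v.poly j).eval x * (w.poly j).eval x
  conj_inner_symm v w := by
    simp only [conj_trivial]
    refine Finset.sum_congr rfl fun j _ => ?_
    congr 1; funext x; ring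
  re_inner_nonneg v := by
    rw [RCLike.re_to_real]
    exact Finset.sum_nonneg fun j _ => integral_sq_eval_nonneg (𝒯.left_lt_right j).le _
  add_left v w z := by
    rw [← Finset.sum_add_distrib]
    refine Finset.sum_congr rfl fun j _ => ?_
    rw [← intervalIntegral.integral_add (intervalIntegrable_eval_mul _ _ _ _)
      (intervalIntegrable_eval_mul _ _ _ _), poly_add]
    congr 1; funext x; simp [add_mul]
  smul_left v w s := by
    simp only [conj_trivial, Finset.mul_sum]
    refine Finset.sum_congr rfl fun j _ => ?_
    rw [← intervalIntegral.integral_const_mul, poly_smul]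
    congr 1; funext x; simp [mul_assoc]
  definite v h := by
    refine ext_poly (funext fun j => ?_)
    have := (Finset.sum_eq_zero_iff_of_nonneg fun j _ =>
      integral_sq_eval_nonneg (𝒯.left_lt_right j).le (v.poly j)).1 h j (Finset.mem_univ j)
    exact eq_zero_of_integral_sq_eq_zero (𝒯.left_lt_right j) this

noncomputable instance : NormedAddCommGroup (DGSpace 𝒯 k) :=
  @InnerProductSpace.Core.toNormedAddCommGroup ℝ _ _ _ _ core

noncomputable instance : InnerProductSpace ℝ (DGSpace 𝒯 k) :=
  InnerProductSpace.ofCore core.toCore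

instance : FiniteDimensional ℝ (DGSpace 𝒯 k) := by
  have : FiniteDimensional ℝ (degreeLT ℝ (k + 1)) :=
    Module.Finite.equiv (degreeLTEquiv ℝ (k + 1)).symm
  exact inferInstanceAs (FiniteDimensional ℝ (Fin N → degreeLT ℝ (k + 1)))

instance : CompleteSpace (DGSpace 𝒯 k) := FiniteDimensional.complete ℝ _

theorem inner_def (v w : DGSpace 𝒯 k) : inner ℝ v w =
    ∑ j, ∫ x in 𝒯.left j..𝒯.right j, (v.poly j).eval x * (w.poly j).eval x := rfl

theorem norm_sq (v : DGSpace 𝒯 k) : ‖v‖ ^ 2 =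
    ∑ j, ∫ x in 𝒯.left j..𝒯.right j, (v.poly j).eval x * (v.poly j).eval x := by
  rw [← real_inner_self_eq_norm_sq, inner_def]

theorem norm_sq_le_of_abs_le {v : DGSpace 𝒯 k} {B : ℝ}
    (hB : ∀ j, ∀ x ∈ Icc (𝒯.left j) (𝒯.right j), |(v.poly j).eval x| ≤ B) :
    ‖v‖ ^ 2 ≤ 2 * Real.pi * B ^ 2 := by
  rw [norm_sq, ← 𝒯.sum_len, Finset.sum_mul]
  refine Finset.sum_le_sum fun j _ => ?_
  calc _ ≤ ∫ _ in 𝒯.left j..𝒯.right j, B ^ 2 := by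
        refine intervalIntegral.integral_mono_on (𝒯.left_lt_right j).le
          (intervalIntegrable_eval_mul _ _ _ _) (by simp) fun x hx => ?_
        rw [← pow_two, ← sq_abs]
        exact pow_le_pow_left₀ (abs_nonneg _) (hB j x hx) 2
    _ = _ := by simp [Mesh.len]

variable [NeZero N]

/-- The form `(v, w) ↦ (D v, w)`, where `D` is the discrete first derivative. -/
noncomputable def formD (F : Flux) (bc : BC) : DGSpace 𝒯 k →ₗ[ℝ] DGSpace 𝒯 k →ₗ[ℝ] ℝ :=
  LinearMap.mk₂ ℝ (fun v w => ∑ j, cellForm 𝒯 F bc v.poly j (w.poly j))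
    (fun v v' w => by
      rw [← Finset.sum_add_distrib]
      refine Finset.sum_congr rfl fun j _ => ?_
      have : ∫ x in 𝒯.left j..𝒯.right j, ((v + v').poly j).eval x * (w.poly j).derivative.eval x =
          (∫ x in 𝒯.left j..𝒯.right j, (v.poly j).eval x * (w.poly j).derivative.eval x) +
          ∫ x in 𝒯.left j..𝒯.right j, (v'.poly j).eval x * (w.poly j).derivative.eval x := by
        rw [← intervalIntegral.integral_add (intervalIntegrable_eval_mul _ _ _ _)
          (intervalIntegrable_eval_mul _ _ _ _), poly_add]
        congr 1; funext x; simp [add_mul]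
      simp only [cellForm]
      rw [this, poly_add, hatU_add, hatU_add]; ring)
    (fun s v w => by
      rw [smul_eq_mul, Finset.mul_sum]
      refine Finset.sum_congr rfl fun j _ => ?_
      have : ∫ x in 𝒯.left j..𝒯.right j, ((s • v).poly j).eval x * (w.poly j).derivative.eval x =
          s * (∫ x in 𝒯.left j..𝒯.right j, (v.poly j).eval x * (w.poly j).derivative.eval x) := by
        rw [← intervalIntegral.integral_const_mul, poly_smul]
        congr 1; funext x; simp [mul_assoc]
      simp only [cellForm]
      rw [this, poly_smul, hatU_smul, hatU_smul]; ring)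
    (fun v w w' => by
      rw [← Finset.sum_add_distrib]
      refine Finset.sum_congr rfl fun j _ => ?_
      have : ∫ x in 𝒯.left j..𝒯.right j, (v.poly j).eval x * ((w + w').poly j).derivative.eval x =
          (∫ x in 𝒯.left j..𝒯.right j, (v.poly j).eval x * (w.poly j).derivative.eval x) +
          ∫ x in 𝒯.left j..𝒯.right j, (v.poly j).eval x * (w'.poly j).derivative.eval x := by
        rw [← intervalIntegral.integral_add (intervalIntegrable_eval_mul _ _ _ _)
          (intervalIntegrable_eval_mul _ _ _ _), poly_add]
        congr 1; funext x; simp [mul_add]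
      simp only [cellForm]
      rw [this, poly_add]
      simp only [Pi.add_apply, eval_add]; ring)
    (fun s v w => by
      rw [smul_eq_mul, Finset.mul_sum]
      refine Finset.sum_congr rfl fun j _ => ?_
      have : ∫ x in 𝒯.left j..𝒯.right j, (v.poly j).eval x * ((s • w).poly j).derivative.eval x =
          s * (∫ x in 𝒯.left j..𝒯.right j, (v.poly j).eval x * (w.poly j).derivative.eval x) := by
        rw [← intervalIntegral.integral_const_mul, poly_smul]
        congr 1; funext x; simp; ring
      simp only [cellForm]
      rw [this, poly_smul]
      simp only [Pi.smul_apply, eval_smul, smul_eq_mul]; ring)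

theorem formD_apply (F : Flux) (bc : BC) (v w : DGSpace 𝒯 k) :
    formD F bc v w = ∑ j, cellForm 𝒯 F bc v.poly j (w.poly j) := rfl

/-- The discrete first derivative on `V_h` with the trace of the given flux. -/
noncomputable def opD (𝒯 : Mesh N) (k : ℕ) (F : Flux) (bc : BC) :
    DGSpace 𝒯 k →L[ℝ] DGSpace 𝒯 k :=
  LinearMap.toContinuousLinearMap
    ((InnerProductSpace.toDual ℝ (DGSpace 𝒯 k)).symm.toLinearEquiv.toLinearMap ∘ₗ
      (LinearMap.toContinuousLinearMap (𝕜 := ℝ) (E := DGSpace 𝒯 k) (F' := ℝ)).toLinearMap ∘ₗ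
        formD F bc)

theorem inner_opD (F : Flux) (bc : BC) (v w : DGSpace 𝒯 k) :
    inner ℝ (opD 𝒯 k F bc v) w = ∑ j, cellForm 𝒯 F bc v.poly j (w.poly j) := by
  rw [← formD_apply]
  exact InnerProductSpace.toDual_symm_apply

theorem inner_adjoint_opD (F : Flux) (bc : BC) (v w : DGSpace 𝒯 k) :
    inner ℝ (ContinuousLinearMap.adjoint (opD 𝒯 k F bc) v) w =
      -∑ j, cellForm 𝒯 F.swap bc v.poly j (w.poly j) := by
  rw [ContinuousLinearMap.adjoint_inner_left, real_inner_comm, inner_opD, sum_cellForm_swap]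

end DGSpace

/-! ### The discrete derivative -/

theorem abs_sum_mul_le_of_sum_sq_le {ι : Type*} {s : Finset ι} {x y : ι → ℝ} {X Y : ℝ}
    (hX : 0 ≤ X) (hY : 0 ≤ Y) (hx : ∑ i ∈ s, x i ^ 2 ≤ X ^ 2) (hy : ∑ i ∈ s, y i ^ 2 ≤ Y ^ 2) :
    |∑ i ∈ s, x i * y i| ≤ X * Y := by
  refine abs_le_of_sq_le_sq ?_ (by positivity)
  calc _ ≤ (∑ i ∈ s, x i ^ 2) * ∑ i ∈ s, y i ^ 2 := Finset.sum_mul_sq_le_sq_mul_sq _ _ _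
    _ ≤ X ^ 2 * Y ^ 2 := by
      have := Finset.sum_nonneg fun i (_ : i ∈ s) => sq_nonneg (y i)
      gcongr
    _ = _ := by ring

namespace DGSpace

section

variable {N : ℕ} {𝒯 : Mesh N} {k : ℕ} {Λ K : ℝ}

theorem sum_sq_eval_le (hΛ : LegBound k Λ) (hK : ∀ j, kerConst k Λ / 𝒯.len j ≤ K)
    (v : DGSpace 𝒯 k) {x : Fin N → ℝ} (hx : ∀ j, x j ∈ Icc (𝒯.left j) (𝒯.right j)) :
    ∑ j, (v.poly j).eval (x j) ^ 2 ≤ K * ‖v‖ ^ 2 := by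
  rw [norm_sq, Finset.mul_sum]
  refine Finset.sum_le_sum fun j _ =>
    (sq_eval_le hΛ (𝒯.left_lt_right j) (v.poly_mem j) (hx j)).trans ?_
  exact mul_le_mul_of_nonneg_right (hK j) (integral_sq_eval_nonneg (𝒯.left_lt_right j).le _)

/-- The mean square of the cell averages is bounded by the `L²` norm. -/
theorem sum_mean_sq_le {c : ℝ} [NeZero N] (hc : 𝒯.QuasiUniform c) (z : DGSpace 𝒯 k) :
    (N : ℝ)⁻¹ * ∑ j, ((𝒯.len j)⁻¹ * ∫ x in 𝒯.left j..𝒯.right j, (z.poly j).eval x) ^ 2 ≤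
      c * ‖z‖ ^ 2 := by
  have hs := 𝒯.size_pos
  have hc0 := hc.pos
  have h1 : ∑ j, ((𝒯.len j)⁻¹ * ∫ x in 𝒯.left j..𝒯.right j, (z.poly j).eval x) ^ 2 ≤
      c / 𝒯.size * ‖z‖ ^ 2 := by
    rw [norm_sq, Finset.mul_sum]
    refine Finset.sum_le_sum fun j _ => ?_
    have hl := 𝒯.len_pos j
    have hcs := sq_integral_eval_mul_le (𝒯.left_lt_right j).le (z.poly j) 1
    simp only [eval_one, mul_one, intervalIntegral.integral_const, smul_eq_mul] at hcs
    calc _ ≤ ((𝒯.len j)⁻¹) ^ 2 * ((∫ x in 𝒯.left j..𝒯.right j,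
            (z.poly j).eval x * (z.poly j).eval x) * 𝒯.len j) := by
          rw [mul_pow]; exact mul_le_mul_of_nonneg_left hcs (by positivity)
      _ = (𝒯.len j)⁻¹ * ∫ x in 𝒯.left j..𝒯.right j,
            (z.poly j).eval x * (z.poly j).eval x := by field_simp
      _ ≤ _ := mul_le_mul_of_nonneg_right (hc.inv_len_le j)
          (integral_sq_eval_nonneg (𝒯.left_lt_right j).le _)
  calc _ ≤ 𝒯.size / (2 * Real.pi) * (c / 𝒯.size * ‖z‖ ^ 2) :=
        mul_le_mul 𝒯.inv_card_le h1 (Finset.sum_nonneg fun j _ => sq_nonneg _) (by positivity)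
    _ = (2 * Real.pi)⁻¹ * (c * ‖z‖ ^ 2) := by field_simp
    _ ≤ c * ‖z‖ ^ 2 := by
      refine mul_le_of_le_one_left (by positivity) (inv_le_one_of_one_le₀ ?_)
      linarith [Real.pi_gt_three]

theorem inner_mk_single (z : DGSpace 𝒯 k) (j : Fin N) {w : ℝ[X]}
    (hs : ∀ i, (Pi.single j w : Fin N → ℝ[X]) i ∈ degreeLT ℝ (k + 1)) :
    inner ℝ z (mk (Pi.single j w) hs) =
      ∫ x in 𝒯.left j..𝒯.right j, (z.poly j).eval x * w.eval x := by
  rw [inner_def, Finset.sum_eq_single j]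
  · simp [poly_mk]
  · intro i _ hij
    simp [poly_mk, hij]
  · simp

theorem single_mem (j : Fin N) {w : ℝ[X]} (hw : w ∈ degreeLT ℝ (k + 1)) (i : Fin N) :
    (Pi.single j w : Fin N → ℝ[X]) i ∈ degreeLT ℝ (k + 1) := by
  by_cases h : i = j
  · subst h; simpa using hw
  · simp [h]

theorem ext_of_integral_mul_eq {z z' : DGSpace 𝒯 k} (h : ∀ j, ∀ w ∈ degreeLT ℝ (k + 1),
    ∫ x in 𝒯.left j..𝒯.right j, (z.poly j).eval x * w.eval x =
      ∫ x in 𝒯.left j..𝒯.right j, (z'.poly j).eval x * w.eval x) : z = z' := by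
  refine ext_inner_right ℝ fun w => ?_
  rw [inner_def, inner_def]
  exact Finset.sum_congr rfl fun j _ => h j _ (w.poly_mem j)

theorem one_mem (k : ℕ) : (1 : ℝ[X]) ∈ degreeLT ℝ (k + 1) := by
  rw [mem_degreeLT, degree_one]
  exact_mod_cast k.succ_pos

variable (𝒯 k) in
/-- The constant function `1` in `V_h`. -/
noncomputable def one : DGSpace 𝒯 k := mk (fun _ => 1) fun _ => one_mem k

theorem inner_one (v : DGSpace 𝒯 k) :
    inner ℝ v (one 𝒯 k) = ∑ j, ∫ x in 𝒯.left j..𝒯.right j, (v.poly j).eval x := by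
  simp [inner_def, one, poly_mk]

theorem norm_sq_one : ‖one 𝒯 k‖ ^ 2 = 2 * Real.pi := by
  rw [norm_sq, ← 𝒯.sum_len]
  simp [one, poly_mk, Mesh.len]

end

section

variable {N : ℕ} [NeZero N] {𝒯 : Mesh N} {k : ℕ} {Λ K : ℝ}

theorem integral_opD_mul (F : Flux) (bc : BC) (v : DGSpace 𝒯 k) (j : Fin N) {w : ℝ[X]}
    (hw : w ∈ degreeLT ℝ (k + 1)) :
    ∫ x in 𝒯.left j..𝒯.right j, ((opD 𝒯 k F bc v).poly j).eval x * w.eval x =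
      cellForm 𝒯 F bc v.poly j w := by
  rw [← inner_mk_single _ j (single_mem j hw), inner_opD, Finset.sum_eq_single j]
  · simp [poly_mk]
  · intro i _ hij
    simp [poly_mk, hij, cellForm]
  · simp

theorem cellForm_one (F : Flux) (bc : BC) (v : Fin N → ℝ[X]) (j : Fin N) :
    cellForm 𝒯 F bc v j 1 = hatU 𝒯 F bc v j.succ - hatU 𝒯 F bc v j.castSucc := by
  simp [cellForm]

/-- The cell integral of the discrete derivative is the difference of the fluxes. -/
theorem integral_opD (F : Flux) (bc : BC) (v : DGSpace 𝒯 k) (j : Fin N) :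
    ∫ x in 𝒯.left j..𝒯.right j, ((opD 𝒯 k F bc v).poly j).eval x =
      hatU 𝒯 F bc v.poly j.succ - hatU 𝒯 F bc v.poly j.castSucc := by
  rw [← cellForm_one, ← integral_opD_mul F bc v j (one_mem k)]
  simp

theorem inner_opD_one (F : Flux) (bc : BC) (v : DGSpace 𝒯 k) :
    inner ℝ (opD 𝒯 k F bc v) (one 𝒯 k) =
      hatU 𝒯 F bc v.poly (Fin.last N) - hatU 𝒯 F bc v.poly 0 := by
  rw [inner_one, Finset.sum_congr rfl fun j _ => integral_opD F bc v j,
    sum_succ_sub_castSucc (fun n => hatU 𝒯 F bc v.poly n)]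

/-- The conservation property of the periodic scheme. -/
theorem opD_one_periodic (F : Flux) : opD 𝒯 k F .periodic (one 𝒯 k) = 0 := by
  refine ext_inner_right ℝ fun w => ?_
  rw [inner_opD, sum_cellForm_swap, inner_zero_left, neg_eq_zero]
  simp only [one, poly_mk, cellForm_one]
  rw [sum_succ_sub_castSucc (fun n => hatU 𝒯 F.swap .periodic w.poly n), hatU_periodic, sub_self]

theorem sum_sq_hatU_le_norm (hΛ : LegBound k Λ) (hK : ∀ j, kerConst k Λ / 𝒯.len j ≤ K)
    (F : Flux) (bc : BC) (v : DGSpace 𝒯 k) :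
    ∑ j : Fin N, hatU 𝒯 F bc v.poly j.succ ^ 2 ≤ K * ‖v‖ ^ 2 ∧
      ∑ j : Fin N, hatU 𝒯 F bc v.poly j.castSucc ^ 2 ≤ K * ‖v‖ ^ 2 := by
  have h := sum_sq_hatU_le 𝒯 F bc v.poly
  have h2 := sum_sq_eval_le hΛ hK v fun j => endpt_mem (𝒯.left_lt_right j) F
  exact ⟨h.1.trans h2, h.2.trans h2⟩

theorem nonneg_of_le (hΛ : LegBound k Λ) (hK : ∀ j, kerConst k Λ / 𝒯.len j ≤ K) : 0 ≤ K :=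
  (div_nonneg (zero_le_one.trans (one_le_kerConst hΛ)) (𝒯.len_pos 0).le).trans (hK 0)

/-- The inverse inequality for the discrete derivative. -/
theorem norm_opD_le (hΛ : LegBound k Λ) (hK : ∀ j, kerConst k Λ / 𝒯.len j ≤ K) (F : Flux)
    (bc : BC) : ‖opD 𝒯 k F bc‖ ≤ 3 * K := by
  have hK0 := nonneg_of_le hΛ hK
  have hkc := one_le_kerConst hΛ
  refine ContinuousLinearMap.opNorm_le_bound _ (by positivity) fun v => ?_
  refine norm_le_of_forall_inner_le (by positivity) fun w => ?_
  have hl := fun j => (𝒯.left_lt_right j).le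
  have hsq : Real.sqrt K ^ 2 = K := Real.sq_sqrt hK0
  have hw1 : ∑ j, (w.poly j).eval (𝒯.right j) ^ 2 ≤ (Real.sqrt K * ‖w‖) ^ 2 := by
    rw [mul_pow, hsq]; exact sum_sq_eval_le hΛ hK w fun j => right_mem_Icc.2 (hl j)
  have hw2 : ∑ j, (w.poly j).eval (𝒯.left j) ^ 2 ≤ (Real.sqrt K * ‖w‖) ^ 2 := by
    rw [mul_pow, hsq]; exact sum_sq_eval_le hΛ hK w fun j => left_mem_Icc.2 (hl j)
  have hv := sum_sq_hatU_le_norm hΛ hK F bc v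
  rw [← hsq, ← mul_pow] at hv
  have t1 := abs_sum_mul_le_of_sum_sq_le (by positivity) (by positivity) hv.1 hw1
  have t2 := abs_sum_mul_le_of_sum_sq_le (by positivity) (by positivity) hv.2 hw2
  have t0 : |∑ j, ∫ x in 𝒯.left j..𝒯.right j, (v.poly j).eval x * (w.poly j).derivative.eval x| ≤
      ‖v‖ * (K * ‖w‖) := by
    refine (Finset.abs_sum_le_sum_abs _ _).trans ?_
    have hI := fun (z : DGSpace 𝒯 k) j => integral_sq_eval_nonneg (hl j) (z.poly j)
    have := abs_sum_mul_le_of_sum_sq_le (s := Finset.univ)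
      (x := fun j => Real.sqrt (∫ x in 𝒯.left j..𝒯.right j, (v.poly j).eval x * (v.poly j).eval x))
      (y := fun j => K *
        Real.sqrt (∫ x in 𝒯.left j..𝒯.right j, (w.poly j).eval x * (w.poly j).eval x))
      (X := ‖v‖) (Y := K * ‖w‖) (by positivity) (by positivity)
      (by rw [norm_sq]; exact Finset.sum_le_sum fun j _ => (Real.sq_sqrt (hI v j)).le)
      (by
        rw [mul_pow, norm_sq, Finset.mul_sum]
        exact Finset.sum_le_sum fun j _ => by rw [mul_pow, Real.sq_sqrt (hI w j)])
    refine le_trans ?_ ((le_abs_self _).trans this)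
    refine Finset.sum_le_sum fun j _ => ?_
    refine abs_le_of_sq_le_sq ?_ (by positivity)
    rw [mul_pow, mul_pow, Real.sq_sqrt (hI v j), Real.sq_sqrt (hI w j)]
    refine (sq_integral_eval_mul_le (hl j) _ _).trans ?_
    refine mul_le_mul_of_nonneg_left ?_ (hI v j)
    refine (integral_sq_derivative_le hΛ (𝒯.left_lt_right j) (w.poly_mem j)).trans ?_
    refine mul_le_mul_of_nonneg_right ?_ (hI w j)
    have := (𝒯.len_pos j).le
    exact pow_le_pow_left₀ (by change 0 ≤ _ / 𝒯.len j; positivity) (hK j) 2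
  rw [inner_opD]
  simp only [cellForm]
  rw [Finset.sum_sub_distrib, Finset.sum_add_distrib, Finset.sum_neg_distrib]
  have e : Real.sqrt K * ‖v‖ * (Real.sqrt K * ‖w‖) = K * ‖v‖ * ‖w‖ := by
    rw [← hsq]; simp only [Real.sqrt_sq (Real.sqrt_nonneg K)]; ring
  rw [e] at t1 t2
  have := abs_le.1 t0
  have := abs_le.1 t1
  have := abs_le.1 t2
  nlinarith

theorem abs_hatU_ends_le (hΛ : LegBound k Λ) (hK : ∀ j, kerConst k Λ / 𝒯.len j ≤ K)
    (F : Flux) (bc : BC) (v : DGSpace 𝒯 k) :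
    |hatU 𝒯 F bc v.poly (Fin.last N)| ≤ Real.sqrt K * ‖v‖ ∧
      |hatU 𝒯 F bc v.poly 0| ≤ Real.sqrt K * ‖v‖ := by
  have hK0 := nonneg_of_le hΛ hK
  have hv := sum_sq_hatU_le_norm hΛ hK F bc v
  rw [← Real.sq_sqrt hK0, ← mul_pow] at hv
  constructor
  · refine abs_le_of_sq_le_sq (le_trans ?_ hv.1) (by positivity)
    rw [← rev_zero_succ]
    exact Finset.single_le_sum (f := fun j : Fin N => hatU 𝒯 F bc v.poly j.succ ^ 2)
      (fun i _ => sq_nonneg _) (Finset.mem_univ _)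
  · refine abs_le_of_sq_le_sq (le_trans ?_ hv.2) (by positivity)
    rw [← castSucc_zero_eq]
    exact Finset.single_le_sum (f := fun j : Fin N => hatU 𝒯 F bc v.poly j.castSucc ^ 2)
      (fun i _ => sq_nonneg _) (Finset.mem_univ _)

/-- Testing with `1` leaves only the fluxes at the two ends, which the inverse inequality for point
values bounds by `h^(-1/2)`. -/
theorem norm_adjoint_opD_one_le (hΛ : LegBound k Λ) (hK : ∀ j, kerConst k Λ / 𝒯.len j ≤ K)
    (F : Flux) (bc : BC) :
    ‖ContinuousLinearMap.adjoint (opD 𝒯 k F bc) (one 𝒯 k)‖ ≤ 2 * Real.sqrt K := by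
  refine norm_le_of_forall_inner_le (by positivity) fun w => ?_
  rw [ContinuousLinearMap.adjoint_inner_left, real_inner_comm, inner_opD_one]
  have h := abs_hatU_ends_le hΛ hK F bc w
  have h1 := abs_le.1 h.1
  have h2 := abs_le.1 h.2
  linarith

/-- On continuous piecewise polynomials with homogeneous boundary values the discrete derivative
is the derivative. -/
theorem opD_eq_derivative {F : Flux} {bc : BC} {f : ℝ → ℝ} (hf : bc.hom.Match f 0 F)
    {v w : DGSpace 𝒯 k} (ha : ∀ j, (v.poly j).eval (𝒯.left j) = f (𝒯.left j))
    (hb : ∀ j, (v.poly j).eval (𝒯.right j) = f (𝒯.right j))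
    (hw : ∀ j, w.poly j = (v.poly j).derivative) : opD 𝒯 k F bc v = w := by
  have hn : ∀ n, hatU 𝒯 F bc v.poly n = f (𝒯.node n) := fun n => by
    have := fluxU_eq_add_hatU 𝒯 hf (p := v.poly)
      (by intro j; cases F; exacts [hb j, ha j]) v.poly n
    rw [sub_self, ← zero_smul ℝ v.poly, hatU_smul, zero_mul, add_zero] at this
    exact this
  refine ext_of_integral_mul_eq fun j z hz => ?_
  rw [integral_opD_mul F bc v j hz, cellForm, hn, hn, hw, integral_derivative_mul, hb, ha]
  simp only [Mesh.left, Mesh.right]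
  ring

end

end DGSpace

/-! ### Cut-off functions -/

/-- A node lies at distance between `y` and `y + h` from the left end. -/
theorem Mesh.exists_node_between {N : ℕ} (𝒯 : Mesh N) {y : ℝ} (hy : 0 < y)
    (hy2 : y ≤ 2 * Real.pi) : ∃ m : Fin (N + 1), y ≤ 𝒯.node m ∧ 𝒯.node m ≤ y + 𝒯.size := by
  classical
  let S := Finset.univ.filter fun m => y ≤ 𝒯.node m
  have hS : S.Nonempty := ⟨Fin.last N, by simp [S, 𝒯.last, hy2]⟩
  have hm : y ≤ 𝒯.node (S.min' hS) := (Finset.mem_filter.1 (S.min'_mem hS)).2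
  refine ⟨S.min' hS, hm, ?_⟩
  generalize hmm : S.min' hS = m at hm ⊢
  induction m using Fin.cases with
  | zero => rw [𝒯.first] at hm; linarith
  | succ j =>
    have h1 : 𝒯.node j.castSucc < y := by
      by_contra! h
      have := S.min'_le j.castSucc (by simp [S, h])
      rw [hmm] at this
      exact absurd this (not_le.2 Fin.castSucc_lt_succ)
    have h2 := 𝒯.len_le_size j
    simp only [Mesh.len, Mesh.left, Mesh.right] at h2
    linarith

/-- A node lies at distance between `y` and `y + h` from the right end. -/
theorem Mesh.exists_node_between_rev {N : ℕ} (𝒯 : Mesh N) {y : ℝ} (hy : 0 < y)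
    (hy2 : y ≤ 2 * Real.pi) :
    ∃ m : Fin (N + 1), y ≤ 2 * Real.pi - 𝒯.node m ∧ 2 * Real.pi - 𝒯.node m ≤ y + 𝒯.size := by
  classical
  let S := Finset.univ.filter fun m => y ≤ 2 * Real.pi - 𝒯.node m
  have hS : S.Nonempty := ⟨0, by simp [S, 𝒯.first, hy2]⟩
  have hm : y ≤ 2 * Real.pi - 𝒯.node (S.max' hS) := (Finset.mem_filter.1 (S.max'_mem hS)).2
  refine ⟨S.max' hS, hm, ?_⟩
  generalize hmm : S.max' hS = m at hm ⊢
  induction m using Fin.lastCases with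
  | last => rw [𝒯.last] at hm; linarith
  | cast j =>
    have h1 : 2 * Real.pi - 𝒯.node j.succ < y := by
      by_contra! h
      have := S.le_max' j.succ (by simp [S, h])
      rw [hmm] at this
      exact absurd this (not_le.2 Fin.castSucc_lt_succ)
    have h2 := 𝒯.len_le_size j
    simp only [Mesh.len, Mesh.left, Mesh.right] at h2
    linarith

namespace DGSpace

/-- The distance of `x` from the end of `[0, 2π]` at which the mixed condition is a Dirichlet
condition. -/
noncomputable def dirichletDist : Flux → ℝ → ℝ
  | .minusPlus, x => x
  | .plusMinus, x => 2 * Real.pi - x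

/-- `dirichletDist` as a polynomial. -/
noncomputable def dirichletDistPoly : Flux → ℝ[X]
  | .minusPlus => X
  | .plusMinus => C (2 * Real.pi) - X

theorem eval_dirichletDistPoly (F : Flux) (x : ℝ) :
    (dirichletDistPoly F).eval x = dirichletDist F x := by
  cases F <;> simp [dirichletDistPoly, dirichletDist]

/-- The distance is an affine function of slope `1` or `-1`. -/
theorem exists_slope_dirichletDist (F : Flux) :
    ∃ σ : ℝ, |σ| = 1 ∧ (dirichletDistPoly F).derivative = C σ ∧
      ∀ x y, dirichletDist F x - dirichletDist F y = σ * (x - y) := by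
  cases F
  · exact ⟨1, by simp, by simp [dirichletDistPoly], fun x y => by simp [dirichletDist]⟩
  · exact ⟨-1, by simp, by simp [dirichletDistPoly], fun x y => by simp [dirichletDist]⟩

theorem dirichletDistPoly_mem {k : ℕ} (hk : 1 ≤ k) (F : Flux) :
    dirichletDistPoly F ∈ degreeLT ℝ (k + 1) := by
  have hX : (X : ℝ[X]) ∈ degreeLT ℝ (k + 1) := by
    rw [mem_degreeLT, degree_X]; exact_mod_cast Nat.lt_succ_of_le hk
  have hC : C (2 * Real.pi) ∈ degreeLT ℝ (k + 1) := by
    rw [mem_degreeLT]; exact degree_C_le.trans_lt (by exact_mod_cast k.succ_pos)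
  cases F
  exacts [hX, sub_mem hC hX]

/-- Some length `ℓ`, at least `y` and at most the mesh size longer, is the distance of a node, that
is, it separates the cells. -/
theorem exists_dirichletDist_between {N : ℕ} (𝒯 : Mesh N) (F : Flux) {y : ℝ} (hy : 0 < y)
    (hy2 : y ≤ 2 * Real.pi) : ∃ ℓ, y ≤ ℓ ∧ ℓ ≤ y + 𝒯.size ∧
      ∀ j, (dirichletDist F (𝒯.left j) ≤ ℓ ∧ dirichletDist F (𝒯.right j) ≤ ℓ) ∨
        (ℓ ≤ dirichletDist F (𝒯.left j) ∧ ℓ ≤ dirichletDist F (𝒯.right j)) := by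
  cases F
  · obtain ⟨m, h1, h2⟩ := 𝒯.exists_node_between hy hy2
    refine ⟨_, h1, h2, fun j => ?_⟩
    rcases le_or_gt m j.castSucc with h | h
    · exact Or.inr ⟨𝒯.strictMono.monotone h,
        𝒯.strictMono.monotone (h.trans Fin.castSucc_lt_succ.le)⟩
    · exact Or.inl ⟨𝒯.strictMono.monotone h.le,
        𝒯.strictMono.monotone (Fin.castSucc_lt_iff_succ_le.1 h)⟩
  · obtain ⟨m, h1, h2⟩ := 𝒯.exists_node_between_rev hy hy2
    refine ⟨_, h1, h2, fun j => ?_⟩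
    rcases le_or_gt m j.castSucc with h | h
    · exact Or.inl ⟨sub_le_sub_left (𝒯.strictMono.monotone h) _, sub_le_sub_left
        (𝒯.strictMono.monotone (h.trans Fin.castSucc_lt_succ.le)) _⟩
    · exact Or.inr ⟨sub_le_sub_left (𝒯.strictMono.monotone h.le) _, sub_le_sub_left
        (𝒯.strictMono.monotone (Fin.castSucc_lt_iff_succ_le.1 h)) _⟩

/-- The function `1` is split into a part concentrated near the Dirichlet end and a part in the
domain of the operator, `min (dist / ℓ) 1`, where `ℓ` is the distance of a node. -/
theorem exists_cutoff {N : ℕ} [NeZero N] (𝒯 : Mesh N) {k : ℕ} (hk : 1 ≤ k) (F : Flux)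
    (g₀ g₁ : ℝ → ℝ) {y : ℝ} (hy : 0 < y) (hy2 : y ≤ 2 * Real.pi) :
    ∃ (ℓ : ℝ) (v₁ v₂ : DGSpace 𝒯 k), y ≤ ℓ ∧ ℓ ≤ y + 𝒯.size ∧ v₁ + v₂ = one 𝒯 k ∧
      ‖v₁‖ ^ 2 ≤ ℓ ∧ ‖opD 𝒯 k F (.mixed g₀ g₁) v₂‖ ^ 2 ≤ ℓ⁻¹ := by
  classical
  obtain ⟨ℓ, h1, h2, hcell⟩ := exists_dirichletDist_between 𝒯 F hy hy2
  obtain ⟨σ, hσ, hder, hdiff⟩ := exists_slope_dirichletDist F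
  have hσ2 : σ * σ = 1 := by rw [← abs_mul_abs_self, hσ, one_mul]
  have hℓ : 0 < ℓ := hy.trans_le h1
  let inside : Fin N → Prop := fun j =>
    dirichletDist F (𝒯.left j) ≤ ℓ ∧ dirichletDist F (𝒯.right j) ≤ ℓ
  let p : Fin N → ℝ[X] := fun j => if inside j then C ℓ⁻¹ * dirichletDistPoly F else 1
  let φ : ℝ → ℝ := fun x => min (dirichletDist F x / ℓ) 1
  have hp : ∀ j, p j ∈ degreeLT ℝ (k + 1) := fun j => by
    by_cases h : inside j
    · simp only [p, h, if_true, ← smul_eq_C_mul]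
      exact Submodule.smul_mem _ _ (dirichletDistPoly_mem hk F)
    · simp only [p, h, if_false]; exact one_mem k
  have hpd : ∀ j, (p j).derivative ∈ degreeLT ℝ (k + 1) := fun j =>
    degreeLT_mono k.le_succ (derivative_mem_degreeLT (hp j))
  let v₂ : DGSpace 𝒯 k := mk p hp
  have hin : ∀ {x}, dirichletDist F x ≤ ℓ → φ x = dirichletDist F x / ℓ := fun h =>
    min_eq_left ((div_le_one hℓ).2 h)
  have hout : ∀ {x}, ℓ ≤ dirichletDist F x → φ x = 1 := fun h =>
    min_eq_right ((one_le_div hℓ).2 h)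
  have hD : opD 𝒯 k F (.mixed g₀ g₁) v₂ = mk _ hpd := by
    refine opD_eq_derivative (f := φ) ?_ (fun j => ?_) (fun j => ?_) fun j => rfl
    · cases F <;> simp [BC.hom, BC.Match, φ, dirichletDist]
    · simp only [v₂, poly_mk, p]
      by_cases h : inside j
      · simp only [h, if_true, eval_mul, eval_C, eval_dirichletDistPoly, hin h.1]; ring
      · simp only [h, if_false, eval_one, hout ((hcell j).resolve_left h).1]
    · simp only [v₂, poly_mk, p]
      by_cases h : inside j
      · simp only [h, if_true, eval_mul, eval_C, eval_dirichletDistPoly, hin h.2]; ring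
      · simp only [h, if_false, eval_one, hout ((hcell j).resolve_left h).2]
  -- The cells inside the cut-off region have total length `ℓ`.
  have hsum : ∑ j, (if inside j then 𝒯.len j else 0) ≤ ℓ := by
    have e : ∀ j, (if inside j then 𝒯.len j else 0) =
        ℓ * σ * φ (𝒯.node j.succ) - ℓ * σ * φ (𝒯.node j.castSucc) := fun j => by
      change _ = ℓ * σ * φ (𝒯.right j) - ℓ * σ * φ (𝒯.left j)
      by_cases h : inside j
      · have := hdiff (𝒯.right j) (𝒯.left j)
        rw [if_pos h, hin h.1, hin h.2, Mesh.len]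
        field_simp
        linear_combination (-(𝒯.right j) + 𝒯.left j) * hσ2 - σ * this
      · have h' := (hcell j).resolve_left h
        rw [if_neg h, hout h'.1, hout h'.2]; ring
    rw [Finset.sum_congr rfl fun j _ => e j,
      sum_succ_sub_castSucc (fun n => ℓ * σ * φ (𝒯.node n)), 𝒯.first, 𝒯.last, ← mul_sub, mul_assoc]
    refine mul_le_of_le_one_right hℓ.le ?_
    have hd := hdiff (2 * Real.pi) 0
    have hpi := Real.pi_pos
    cases F
    · have h0 : σ = 1 := by simp only [dirichletDist] at hd; nlinarith
      have ha : φ 0 = 0 := by simp [φ, dirichletDist]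
      rw [h0, ha]; linarith [show φ (2 * Real.pi) ≤ 1 from min_le_right _ _]
    · have h0 : σ = -1 := by simp only [dirichletDist] at hd; nlinarith
      have ha : φ (2 * Real.pi) = 0 := by simp [φ, dirichletDist]
      rw [h0, ha]; linarith [show φ 0 ≤ 1 from min_le_right _ _]
  refine ⟨ℓ, one 𝒯 k - v₂, v₂, h1, h2, sub_add_cancel _ _, ?_, ?_⟩
  · refine le_trans ?_ hsum
    rw [norm_sq]
    refine Finset.sum_le_sum fun j _ => ?_
    have e : (one 𝒯 k - v₂).poly j = 1 - p j := rfl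
    rw [e]
    by_cases h : inside j
    · rw [if_pos h]
      have hle : ∀ x ∈ Icc (𝒯.left j) (𝒯.right j),
          (1 - p j).eval x * (1 - p j).eval x ≤ 1 := fun x hx => by
        have hxm := 𝒯.cell_subset j hx
        have h0 : 0 ≤ dirichletDist F x := by
          cases F <;> simp only [dirichletDist] <;> linarith [hxm.1, hxm.2]
        have h3 : dirichletDist F x ≤ ℓ := by
          have ha := h.1
          have hb := h.2
          cases F <;> simp only [dirichletDist] at ha hb ⊢ <;> linarith [hx.1, hx.2]
        simp only [p, h, if_true, eval_sub, eval_one, eval_mul, eval_C, eval_dirichletDistPoly]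
        have h4 : 0 ≤ ℓ⁻¹ * dirichletDist F x := by positivity
        have h5 : ℓ⁻¹ * dirichletDist F x ≤ 1 := by
          rw [inv_mul_le_iff₀ hℓ]; linarith
        nlinarith
      calc _ ≤ ∫ _ in 𝒯.left j..𝒯.right j, (1 : ℝ) :=
            intervalIntegral.integral_mono_on (𝒯.left_lt_right j).le
              (intervalIntegrable_eval_mul _ _ _ _) (by simp) hle
        _ = 𝒯.len j := by simp [Mesh.len]
    · rw [if_neg h]
      simp [p, h]
  · rw [hD, norm_sq]
    have : ∀ j, ∫ x in 𝒯.left j..𝒯.right j,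
        ((mk _ hpd : DGSpace 𝒯 k).poly j).eval x * ((mk _ hpd : DGSpace 𝒯 k).poly j).eval x =
          (ℓ⁻¹) ^ 2 * (if inside j then 𝒯.len j else 0) := fun j => by
      simp only [poly_mk, p]
      by_cases h : inside j
      · simp only [h, if_true, derivative_C_mul, hder, eval_mul, eval_C]
        rw [intervalIntegral.integral_const, smul_eq_mul, Mesh.len]
        linear_combination (𝒯.right j - 𝒯.left j) * ℓ⁻¹ ^ 2 * hσ2
      · simp [h]
    rw [Finset.sum_congr rfl fun j _ => this j, ← Finset.mul_sum]
    calc _ ≤ (ℓ⁻¹) ^ 2 * ℓ := mul_le_mul_of_nonneg_left hsum (by positivity)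
      _ = ℓ⁻¹ := by field_simp

end DGSpace

/-! ### The interpolation function of a jet -/

/-- `F` for even `n` and the opposite flux for odd `n`. -/
def Flux.alt : Flux → ℕ → Flux
  | F, 0 => F
  | F, n + 1 => F.swap.alt n

theorem Flux.alt_add_two (F : Flux) (n : ℕ) : F.alt (n + 2) = F.alt n := by
  change F.swap.swap.alt n = F.alt n
  rw [swap_swap]

theorem Flux.alt_two_mul (F : Flux) (i : ℕ) : F.alt (2 * i) = F := by
  induction i with
  | zero => rfl
  | succ i ih => rw [mul_add, mul_one, Flux.alt_add_two, ih]

section Jet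

variable {k : ℕ} {a b : ℝ}

/-- The top Legendre coefficient of the projection error of the `n`-th entry of the jet `d`. -/
noncomputable def jetCoef (k : ℕ) (a b : ℝ) (d : ℕ → ℝ → ℝ) (F : Flux) (n : ℕ) : ℝ :=
  coefF k a b (d n) (F.alt n)

/-- The interpolation function of `d 0`, where the jet `d` lists `d 0` and its derivatives: the
time derivatives in the corrections are replaced by spatial derivatives by the heat equation. -/
noncomputable def jetInterp (k : ℕ) (a b : ℝ) (d : ℕ → ℝ → ℝ) (F : Flux) : ℝ[X] :=
  radauU k a b (d 0) F - ∑ n ∈ Finset.range k,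
    C (((b - a) / 2) ^ (n + 1) * jetCoef k a b d F (n + 1)) * chain k a b F (n + 1)

theorem jetCoef_shift (k : ℕ) (a b : ℝ) (d : ℕ → ℝ → ℝ) (F : Flux) (n : ℕ) :
    jetCoef k a b (fun n => d (n + 1)) F.swap n = jetCoef k a b d F (n + 1) := rfl

theorem C_mul_mem_degreeLT {n : ℕ} {p : ℝ[X]} (hp : p ∈ degreeLT ℝ n) (s : ℝ) :
    C s * p ∈ degreeLT ℝ n := by
  rw [← smul_eq_C_mul]; exact Submodule.smul_mem _ _ hp

theorem jetInterp_mem (hab : a < b) {d : ℕ → ℝ → ℝ} (hd : ContinuousOn (d 0) (Icc a b))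
    (F : Flux) : jetInterp k a b d F ∈ degreeLT ℝ (k + 1) :=
  sub_mem (isRadau_radauU k hab hd F).1
    (sum_mem fun n _ => C_mul_mem_degreeLT (chain_mem k hab F (n + 1)) _)

theorem jetInterp_eval_endpt (hab : a < b) {d : ℕ → ℝ → ℝ} (hd : ContinuousOn (d 0) (Icc a b))
    (F : Flux) : (jetInterp k a b d F).eval (endpt a b F) = d 0 (endpt a b F) := by
  rw [jetInterp, eval_sub, (isRadau_radauU k hab hd F).2.2, eval_finsetSum,
    Finset.sum_eq_zero, sub_zero]
  intro n hn
  rw [eval_mul, chain_succ_eval_endpt hab F (Finset.mem_range.1 hn), mul_zero]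

theorem integral_sum_mul {ι : Type*} (s : Finset ι) (f : ι → ℝ) (p : ι → ℝ[X]) (w : ℝ[X]) :
    ∫ x in a..b, (∑ i ∈ s, C (f i) * p i).eval x * w.eval x =
      ∑ i ∈ s, f i * ∫ x in a..b, (p i).eval x * w.eval x := by
  simp_rw [← intervalIntegral.integral_const_mul]
  rw [← intervalIntegral.integral_finsetSum fun i _ =>
    (intervalIntegrable_eval_mul (p i) w a b).const_mul _]
  congr 1; funext x
  rw [eval_finsetSum, Finset.sum_mul]
  refine Finset.sum_congr rfl fun i _ => ?_
  simp [mul_assoc]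

/-- The interpolation error, tested with polynomials of degree at most `k`, is a combination of the
functions of the chain; the term `n = 0` is the projection error. -/
theorem integral_sub_jetInterp_mul (hab : a < b) {d : ℕ → ℝ → ℝ}
    (hd : ContinuousOn (d 0) (Icc a b)) (F : Flux) {w : ℝ[X]} (hw : w ∈ degreeLT ℝ (k + 1)) :
    ∫ x in a..b, (d 0 x - (jetInterp k a b d F).eval x) * w.eval x =
      ∑ n ∈ Finset.range (k + 1), ((b - a) / 2) ^ n * jetCoef k a b d F n *
        ∫ x in a..b, (chain k a b F n).eval x * w.eval x := by
  have h1 := integral_sub_radauU_mul k hab hd F hw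
  rw [integral_sub_eval_mul hab hd] at h1 ⊢
  have h2 := integral_sum_mul (a := a) (b := b) (Finset.range k)
    (fun n => ((b - a) / 2) ^ (n + 1) * jetCoef k a b d F (n + 1))
    (fun n => chain k a b F (n + 1)) w
  have h3 : ∫ x in a..b, (jetInterp k a b d F).eval x * w.eval x =
      (∫ x in a..b, (radauU k a b (d 0) F).eval x * w.eval x) -
        ∫ x in a..b, (∑ n ∈ Finset.range k, C (((b - a) / 2) ^ (n + 1) *
          jetCoef k a b d F (n + 1)) * chain k a b F (n + 1)).eval x * w.eval x := by
    rw [← intervalIntegral.integral_sub (intervalIntegrable_eval_mul _ _ _ _)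
      (intervalIntegrable_eval_mul _ _ _ _)]
    congr 1; funext x
    rw [jetInterp, eval_sub, sub_mul]
  rw [Finset.sum_range_succ', h3, h2, ← sub_add, h1, add_comm]
  simp [jetCoef, Flux.alt, chain]

/-- The mean of the interpolation error: only the last correction contributes. -/
theorem integral_sub_jetInterp (hab : a < b) {d : ℕ → ℝ → ℝ}
    (hd : ContinuousOn (d 0) (Icc a b)) (F : Flux) :
    ∫ x in a..b, (d 0 x - (jetInterp k a b d F).eval x) =
      ((b - a) / 2) ^ k * jetCoef k a b d F k * ∫ x in a..b, (chain k a b F k).eval x := by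
  have h := integral_sub_jetInterp_mul hab hd F (DGSpace.one_mem k)
  simp only [eval_one, mul_one] at h
  rw [h, Finset.sum_range_succ, Finset.sum_eq_zero, zero_add]
  intro n hn
  rw [integral_chain_eq_zero hab F (Finset.mem_range.1 hn), mul_zero]

/-- The interpolation functions of `d 0` and of its derivative satisfy the scheme on a cell, with
exact fluxes, up to a residual of high order. -/
theorem integral_jetInterp_shift_mul (hab : a < b) {d : ℕ → ℝ → ℝ}
    (hd : ∀ x ∈ Icc a b, HasDerivWithinAt (d 0) (d 1 x) (Icc a b) x)
    (hd1 : ContinuousOn (d 1) (Icc a b)) (F : Flux) {w : ℝ[X]} (hw : w ∈ degreeLT ℝ (k + 1)) :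
    ∫ x in a..b, (jetInterp k a b (fun n => d (n + 1)) F.swap).eval x * w.eval x =
      -(∫ x in a..b, (jetInterp k a b d F).eval x * w.derivative.eval x)
        + d 0 b * w.eval b - d 0 a * w.eval a
        - ((b - a) / 2) ^ k * jetCoef k a b d F (k + 1) *
          ∫ x in a..b, (chain k a b F.swap k).eval x * w.eval x := by
  have hd0 : ContinuousOn (d 0) (Icc a b) := fun x hx => (hd x hx).continuousWithinAt
  have hw' : w.derivative ∈ degreeLT ℝ (k + 1) :=
    degreeLT_mono k.le_succ (derivative_mem_degreeLT hw)
  have h1 := integral_sub_jetInterp_mul (k := k) hab (d := fun n => d (n + 1)) hd1 F.swap hw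
  have h0 := integral_sub_jetInterp_mul (k := k) hab hd0 F hw'
  rw [integral_sub_eval_mul hab (by exact hd1)] at h1
  rw [integral_sub_eval_mul hab hd0] at h0
  have hI : ∫ x in a..b, d 1 x * w.eval x =
      d 0 b * w.eval b - d 0 a * w.eval a - ∫ x in a..b, d 0 x * w.derivative.eval x := by
    have hu := uIcc_of_le hab.le
    have := intervalIntegral.integral_mul_deriv_eq_deriv_mul_of_hasDerivWithinAt
      (u := d 0) (u' := d 1) (v := fun x => w.eval x) (v' := fun x => w.derivative.eval x)
      (by rw [hu]; exact hd) (fun x _ => (w.hasDerivAt x).hasDerivWithinAt)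
      (hd1.intervalIntegrable_of_Icc hab.le) (intervalIntegrable_eval _ _ _)
    linarith
  have hS : ∑ n ∈ Finset.range (k + 1), ((b - a) / 2) ^ n * jetCoef k a b d F n *
        ∫ x in a..b, (chain k a b F n).eval x * w.derivative.eval x =
      -∑ n ∈ Finset.range k, ((b - a) / 2) ^ n * jetCoef k a b d F (n + 1) *
        ∫ x in a..b, (chain k a b F.swap n).eval x * w.eval x := by
    rw [Finset.sum_range_succ', ← Finset.sum_neg_distrib]
    have hz : ∫ x in a..b, (chain k a b F 0).eval x * w.derivative.eval x = 0 :=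
      integral_legP_mul_eq_zero hab (derivative_mem_degreeLT hw)
    rw [hz, mul_zero, add_zero]
    refine Finset.sum_congr rfl fun n hn => ?_
    have hc := integral_chain_succ_mul_derivative k hab F n hw
    rw [integral_chain_eq_zero hab F.swap (Finset.mem_range.1 hn), zero_mul, zero_sub] at hc
    linear_combination ((b - a) / 2) ^ n * jetCoef k a b d F (n + 1) * hc
  rw [hS] at h0
  simp only [jetCoef_shift] at h1
  rw [Finset.sum_range_succ, zero_add, hI] at h1
  linear_combination -h0 - h1

/-- The corrections with even index come from `u`, those with odd index from `q`. -/
theorem sum_range_eq_sum_even_add_sum_odd {A : Type*} [AddCommMonoid A] (f : ℕ → A) (k : ℕ) :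
    ∑ n ∈ Finset.range k, f (n + 1) = ∑ i ∈ Finset.range (k / 2), f (2 * i + 2) +
      ∑ i ∈ Finset.range ((k + 1) / 2), f (2 * i + 1) := by
  induction k with
  | zero => simp
  | succ k ih =>
    rw [Finset.sum_range_succ, ih]
    rcases Nat.even_or_odd' k with ⟨m, rfl | rfl⟩
    · rw [show (2 * m + 1 + 1) / 2 = m + 1 by omega, show (2 * m + 1) / 2 = m by omega,
        show 2 * m / 2 = m by omega, Finset.sum_range_succ (fun i => f (2 * i + 1)), add_assoc]
    · rw [show (2 * m + 1 + 1 + 1) / 2 = m + 1 by omega, show (2 * m + 1 + 1) / 2 = m + 1 by omega,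
        show (2 * m + 1) / 2 = m by omega, Finset.sum_range_succ (fun i => f (2 * i + 2)) m,
        add_right_comm]

/-- The size of the residuals: the top coefficient for the `n`-th derivative gains a power of the
length for each of the `m` further derivatives, and one from the Lipschitz bound. -/
theorem abs_residual_le {Λ : ℝ} (hΛ : LegBound k Λ) (hab : a < b) {M : ℝ} (hM0 : 0 ≤ M)
    {n m : ℕ} (hm : m ≤ k) {d : ℕ → ℝ → ℝ}
    (hd : ∀ j < n + m, ∀ x ∈ Icc a b, HasDerivWithinAt (d j) (d (j + 1) x) (Icc a b) x)
    (hc : ContinuousOn (d n) (Icc a b))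
    (hM : ∀ x ∈ Icc a b, ∀ y ∈ Icc a b, |d (n + m) x - d (n + m) y| ≤ M * |x - y|)
    (F G : Flux) {x : ℝ} (hx : x ∈ Icc a b) :
    |((b - a) / 2) ^ k * jetCoef k a b d F n * (chain k a b G k).eval x| ≤
      (1 + kerConst k Λ) * ((2 * radConst k Λ) ^ k * Λ) * M * (b - a) ^ (k + m + 1) := by
  have h1 : |jetCoef k a b d F n| ≤ (1 + kerConst k Λ) * (M * (b - a) ^ (m + 1)) :=
    abs_coefF_le_of_deriv hΛ hab hm (fun j => d (n + j))
      (fun j hj => hd (n + j) (by omega)) hc hM _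
  have h2 := abs_chain_le hΛ hab G k hx
  have hl : 0 ≤ b - a := (sub_pos.2 hab).le
  have h3 : ((b - a) / 2) ^ k ≤ (b - a) ^ k := pow_le_pow_left₀ (by linarith) (by linarith) k
  have hk := one_le_kerConst hΛ
  rw [abs_mul, abs_mul, abs_of_nonneg (by positivity : 0 ≤ ((b - a) / 2) ^ k)]
  calc _ ≤ (b - a) ^ k * ((1 + kerConst k Λ) * (M * (b - a) ^ (m + 1))) *
        ((2 * radConst k Λ) ^ k * Λ) := by gcongr
    _ = _ := by ring

end Jet

/-! ### Time derivatives -/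

/-- Differentiation under the integral sign on a compact interval of time, with one-sided
derivatives at its ends. -/
theorem hasDerivWithinAt_integral_of_continuousOn {a b T : ℝ} (hab : a ≤ b) {f f' : ℝ → ℝ → ℝ}
    (hd : ∀ x ∈ Icc a b, ∀ t ∈ Icc 0 T, HasDerivWithinAt (f x) (f' x t) (Icc 0 T) t)
    (hf : ∀ t ∈ Icc 0 T, ContinuousOn (fun x => f x t) (Icc a b))
    (hf' : ContinuousOn (fun z : ℝ × ℝ => f' z.1 z.2) (Icc a b ×ˢ Icc 0 T)) {t : ℝ}
    (ht : t ∈ Icc 0 T) :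
    HasDerivWithinAt (fun s => ∫ x in a..b, f x s) (∫ x in a..b, f' x t) (Icc 0 T) t := by
  have hf't : ContinuousOn (fun x => f' x t) (Icc a b) :=
    hf'.comp (by fun_prop : ContinuousOn (fun x : ℝ => (x, t)) (Icc a b)) fun x hx => ⟨hx, ht⟩
  have huc := (isCompact_Icc.prod isCompact_Icc).uniformContinuousOn_of_continuous hf'
  rw [Metric.uniformContinuousOn_iff] at huc
  rw [hasDerivWithinAt_iff_isLittleO, Asymptotics.isLittleO_iff]
  intro c hc
  have hL : 0 < b - a + 1 := by linarith
  obtain ⟨δ, hδ, hδ'⟩ := huc (c / (b - a + 1)) (by positivity)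
  filter_upwards [self_mem_nhdsWithin, mem_nhdsWithin_of_mem_nhds (Metric.ball_mem_nhds t hδ)]
    with s hs hst
  have hu := uIcc_of_le hab
  have i1 : ∀ r ∈ Icc 0 T, IntervalIntegrable (fun x => f x r) volume a b := fun r hr =>
    (hf r hr).intervalIntegrable_of_Icc hab
  have i2 := hf't.intervalIntegrable_of_Icc (μ := volume) hab
  rw [smul_eq_mul, ← intervalIntegral.integral_const_mul,
    ← intervalIntegral.integral_sub (i1 s hs) (i1 t ht),
    ← intervalIntegral.integral_sub ((i1 s hs).sub (i1 t ht)) (i2.const_mul _)]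
  have hb : ∀ x ∈ uIoc a b, ‖f x s - f x t - (s - t) * f' x t‖ ≤ c / (b - a + 1) * ‖s - t‖ := by
    intro x hx
    have hx : x ∈ Icc a b := by rw [uIoc_of_le hab] at hx; exact ⟨hx.1.le, hx.2⟩
    have := Convex.norm_image_sub_le_of_norm_hasDerivWithin_le
      (f := fun r => f x r - r * f' x t) (f' := fun r => f' x r - f' x t)
      (s := Icc 0 T ∩ Metric.ball t δ) (C := c / (b - a + 1))
      (fun r hr => by
        have h1 := (hd x hx r hr.1).mono (inter_subset_left (t := Metric.ball t δ))
        have h2 : HasDerivWithinAt (fun r : ℝ => r * f' x t) (f' x t)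
            (Icc 0 T ∩ Metric.ball t δ) r := by
          simpa using (hasDerivWithinAt_id r _).mul_const (f' x t)
        exact h1.sub h2)
      (fun r hr => by
        have := hδ' (x, r) ⟨hx, hr.1⟩ (x, t) ⟨hx, ht⟩
          (by rw [Prod.dist_eq, dist_self, max_eq_right dist_nonneg]; exact hr.2)
        rw [Real.dist_eq] at this
        exact this.le)
      ((convex_Icc 0 T).inter (convex_ball t δ)) ⟨ht, Metric.mem_ball_self hδ⟩ ⟨hs, hst⟩
    rwa [show f x s - f x t - (s - t) * f' x t =
      f x s - s * f' x t - (f x t - t * f' x t) by ring]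
  refine (intervalIntegral.norm_integral_le_of_norm_le_const hb).trans ?_
  rw [abs_of_nonneg (sub_nonneg.2 hab)]
  have : c / (b - a + 1) * (b - a) ≤ c := by
    rw [div_mul_eq_mul_div, div_le_iff₀ hL]; nlinarith
  calc _ = c / (b - a + 1) * (b - a) * ‖s - t‖ := by ring
    _ ≤ _ := by gcongr

theorem HeatJet.mono {L T : ℝ} {n m : ℕ} {U : ℕ → ℝ → ℝ → ℝ} (H : HeatJet L T n U) (h : m ≤ n) :
    HeatJet L T m U where
  deriv_x t ht j hj := H.deriv_x t ht j (hj.trans_le h)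
  cont j hj := H.cont j (hj.trans h)
  deriv_t j hj := H.deriv_t j (hj.trans h)

theorem HeatJet.shift {L T : ℝ} {n : ℕ} {U : ℕ → ℝ → ℝ → ℝ} (H : HeatJet L T (n + 1) U) :
    HeatJet L T n fun j => U (j + 1) where
  deriv_x t ht j hj := H.deriv_x t ht (j + 1) (by omega)
  cont j hj := H.cont (j + 1) (by omega)
  deriv_t j hj x hx t ht := by
    have := H.deriv_t (j + 1) (by omega) x hx t ht
    rwa [add_right_comm] at this

section

variable {L T a b : ℝ} {n : ℕ} {U : ℕ → ℝ → ℝ → ℝ}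

theorem HeatJet.cont_x (H : HeatJet L T n U) (hI : Icc a b ⊆ Icc 0 L) {j : ℕ} (hj : j ≤ n) {t : ℝ}
    (ht : t ∈ Icc 0 T) : ContinuousOn (fun x => U j x t) (Icc a b) :=
  (H.cont j hj).comp (by fun_prop : ContinuousOn (fun x : ℝ => (x, t)) (Icc a b))
    fun x hx => ⟨hI hx, ht⟩

theorem HeatJet.hasDerivWithinAt_integral (H : HeatJet L T n U) (hab : a ≤ b)
    (hI : Icc a b ⊆ Icc 0 L) {j : ℕ} (hj : j + 2 ≤ n) (w : ℝ[X]) {t : ℝ} (ht : t ∈ Icc 0 T) :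
    HasDerivWithinAt (fun s => ∫ x in a..b, U j x s * w.eval x)
      (∫ x in a..b, U (j + 2) x t * w.eval x) (Icc 0 T) t := by
  refine hasDerivWithinAt_integral_of_continuousOn (f := fun x s => U j x s * w.eval x)
    (f' := fun x s => U (j + 2) x s * w.eval x) hab ?_ ?_ ?_ ht
  · exact fun x hx s hs => (H.deriv_t j hj x (hI hx) s hs).mul_const _
  · exact fun s hs => (H.cont_x hI (by omega) hs).mul w.continuousOn
  · refine ((H.cont (j + 2) hj).mono (prod_mono hI subset_rfl)).mul ?_
    exact (w.continuous.comp continuous_fst).continuousOn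

theorem HeatJet.hasDerivWithinAt_coefF (H : HeatJet L T n U) (k : ℕ) (hab : a < b)
    (hI : Icc a b ⊆ Icc 0 L) {j : ℕ} (hj : j + 2 ≤ n) (F : Flux) {t : ℝ} (ht : t ∈ Icc 0 T) :
    HasDerivWithinAt (fun s => coefF k a b (fun x => U j x s) F)
      (coefF k a b (fun x => U (j + 2) x t) F) (Icc 0 T) t := by
  simp only [coefF_eq k hab]
  exact (((H.deriv_t j hj _ (hI (endpt_mem hab F)) t ht).neg).add
    (H.hasDerivWithinAt_integral hab.le hI hj _ ht)).const_mul _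

/-- A derivative in time is two derivatives in space. -/
theorem HeatJet.iteratedDerivWithin_coefF (H : HeatJet L T n U) (hT : 0 < T) (k : ℕ) (hab : a < b)
    (hI : Icc a b ⊆ Icc 0 L) {j : ℕ} (F : Flux) (i : ℕ) (hj : j + 2 * i ≤ n) :
    ∀ t ∈ Icc 0 T, iteratedDerivWithin i (fun s => coefF k a b (fun x => U j x s) F) (Icc 0 T) t =
      coefF k a b (fun x => U (j + 2 * i) x t) F := by
  induction i with
  | zero => intro t _; simp
  | succ i ih =>
    intro t ht
    rw [iteratedDerivWithin_succ, derivWithin_congr (ih (by omega)) (ih (by omega) t ht)]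
    exact (H.hasDerivWithinAt_coefF k hab hI (by omega) F ht).derivWithin
      (uniqueDiffOn_Icc hT t ht)

theorem coefF_congr (k : ℕ) (hab : a < b) {v w : ℝ → ℝ} (h : EqOn v w (Icc a b)) (F : Flux) :
    coefF k a b v F = coefF k a b w F := by
  rw [coefF_eq k hab, coefF_eq k hab, h (endpt_mem hab F)]
  congr 2
  refine intervalIntegral.integral_congr fun x hx => ?_
  rw [uIcc_of_le hab.le] at hx
  simp only [h hx]

/-- The correction functions in terms of spatial derivatives. -/
theorem HeatJet.correction_eq (H : HeatJet (2 * Real.pi) T n U) (hT : 0 < T) {u : ℝ → ℝ → ℝ}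
    (hu : ∀ x, ∀ t ∈ Icc 0 T, U 0 x t = u x t)
    (hq : ∀ x ∈ Icc 0 (2 * Real.pi), ∀ t ∈ Icc 0 T, U 1 x t = auxQ u x t) {k l : ℕ} (hl : l ≤ n)
    (hab : a < b) (hI : Icc a b ⊆ Icc 0 (2 * Real.pi)) (F : Flux) {t : ℝ} (ht : t ∈ Icc 0 T) :
    correction k l T u t a b F = ∑ m ∈ Finset.range l, C (((b - a) / 2) ^ (m + 1) *
      jetCoef k a b (fun n x => U n x t) F (m + 1)) * chain k a b F (m + 1) := by
  rw [sum_range_eq_sum_even_add_sum_odd (fun m => C (((b - a) / 2) ^ m *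
      jetCoef k a b (fun n x => U n x t) F m) * chain k a b F m)]
  have hU : ∀ G : Flux, ∀ i < l / 2,
      iteratedDerivWithin (i + 1) (fun s => coefF k a b (fun x => u x s) G) (Icc 0 T) t =
        coefF k a b (fun x => U (2 * i + 2) x t) G := fun G i hi => by
    have h1 := H.iteratedDerivWithin_coefF hT k hab hI (j := 0) G (i + 1) (by omega) t ht
    rw [zero_add, mul_add, mul_one] at h1
    rw [← h1]
    refine iteratedDerivWithin_congr (fun s hs => ?_) ht
    exact coefF_congr k hab (fun x _ => (hu x s hs).symm) G
  have hQ : ∀ G : Flux, ∀ i < (l + 1) / 2,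
      iteratedDerivWithin i (fun s => coefF k a b (fun x => auxQ u x s) G) (Icc 0 T) t =
        coefF k a b (fun x => U (2 * i + 1) x t) G := fun G i hi => by
    have h1 := H.iteratedDerivWithin_coefF hT k hab hI (j := 1) G i (by omega) t ht
    rw [add_comm 1] at h1
    rw [← h1]
    refine iteratedDerivWithin_congr (fun s hs => ?_) ht
    exact coefF_congr k hab (fun x hx => (hq x (hI hx) s hs).symm) G
  have he : ∀ i, F.alt (2 * i + 2) = F := fun i => by rw [Flux.alt_add_two, Flux.alt_two_mul]
  have ho : ∀ i, F.alt (2 * i + 1) = F.swap := fun i => F.swap.alt_two_mul i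
  simp only [jetCoef, he, ho]
  cases F
  · refine congrArg₂ (· + ·) (Finset.sum_congr rfl fun i hi => ?_)
      (Finset.sum_congr rfl fun i hi => ?_)
    · rw [← hU _ i (Finset.mem_range.1 hi), F1bar_eq_chain]; rfl
    · rw [← hQ _ i (Finset.mem_range.1 hi), F2_eq_chain]; rfl
  · refine congrArg₂ (· + ·) (Finset.sum_congr rfl fun i hi => ?_)
      (Finset.sum_congr rfl fun i hi => ?_)
    · rw [← hU _ i (Finset.mem_range.1 hi), F2bar_eq_chain]; rfl
    · rw [← hQ _ i (Finset.mem_range.1 hi), F1_eq_chain]; rfl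

theorem HeatJet.eq_auxQ (H : HeatJet (2 * Real.pi) T n U) {u : ℝ → ℝ → ℝ}
    (hu : ∀ x, ∀ t ∈ Icc 0 T, U 0 x t = u x t) (hn : 1 ≤ n) {x : ℝ}
    (hx : x ∈ Icc 0 (2 * Real.pi)) {t : ℝ} (ht : t ∈ Icc 0 T) : U 1 x t = auxQ u x t := by
  have h := H.deriv_x t ht 0 hn x hx
  rw [funext fun y => hu y t ht] at h
  exact (h.derivWithin (uniqueDiffOn_Icc (by positivity) x hx)).symm

/-- The pairings of the interpolation function are differentiated by shifting the jet. -/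
theorem HeatJet.hasDerivWithinAt_integral_jetInterp (H : HeatJet L T n U) {k : ℕ}
    (hn : k + 2 ≤ n) (hab : a < b) (hI : Icc a b ⊆ Icc 0 L) (F : Flux) {w : ℝ[X]}
    (hw : w ∈ degreeLT ℝ (k + 1)) {t : ℝ} (ht : t ∈ Icc 0 T) :
    HasDerivWithinAt
      (fun s => ∫ x in a..b, (jetInterp k a b (fun n x => U n x s) F).eval x * w.eval x)
      (∫ x in a..b, (jetInterp k a b (fun n x => U (n + 2) x t) F).eval x * w.eval x)
      (Icc 0 T) t := by
  have key : ∀ m ≤ 2, ∀ s ∈ Icc 0 T,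
      ∫ x in a..b, (jetInterp k a b (fun n x => U (n + m) x s) F).eval x * w.eval x =
        (∫ x in a..b, U m x s * w.eval x) - ∑ n ∈ Finset.range (k + 1),
          ((b - a) / 2) ^ n * jetCoef k a b (fun n x => U (n + m) x s) F n *
            ∫ x in a..b, (chain k a b F n).eval x * w.eval x := fun m hm s hs => by
    have hc : ContinuousOn (fun x => U (0 + m) x s) (Icc a b) :=
      H.cont_x hI (by omega) hs
    rw [← integral_sub_jetInterp_mul hab hc F hw, integral_sub_eval_mul hab hc, zero_add]
    ring
  have h2 := key 2 le_rfl t ht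
  have h0 := key 0 (by omega)
  simp only [add_zero] at h0
  refine HasDerivWithinAt.congr (f := fun s => (∫ x in a..b, U 0 x s * w.eval x) -
    ∑ n ∈ Finset.range (k + 1), ((b - a) / 2) ^ n * jetCoef k a b (fun n x => U n x s) F n *
            ∫ x in a..b, (chain k a b F n).eval x * w.eval x) ?_ h0 (h0 t ht)
  rw [h2]
  refine (H.hasDerivWithinAt_integral hab.le hI (by omega) w ht).sub ?_
  refine HasDerivWithinAt.fun_sum fun m hm => ?_
  have hm := Finset.mem_range.1 hm
  exact ((H.hasDerivWithinAt_coefF k hab hI (by omega) _ ht).const_mul _).mul_const _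

end

/-! ### The error equations -/

/-- In finite dimensions a weak derivative is a derivative. -/
theorem hasDerivWithinAt_of_inner {V : Type*} [NormedAddCommGroup V] [InnerProductSpace ℝ V]
    [FiniteDimensional ℝ V] {ξ : ℝ → V} {z : V} {S : Set ℝ} {t : ℝ}
    (h : ∀ w, HasDerivWithinAt (fun s => (inner ℝ (ξ s) w : ℝ)) (inner ℝ z w) S t) :
    HasDerivWithinAt ξ z S t := by
  let b := stdOrthonormalBasis ℝ V
  have e : ∀ v : V, v = ∑ i, (inner ℝ v (b i) : ℝ) • b i := fun v => by
    conv_lhs => rw [← b.sum_repr' v]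
    exact Finset.sum_congr rfl fun i _ => by rw [real_inner_comm]
  rw [e z, funext fun s => e (ξ s)]
  exact HasDerivWithinAt.fun_sum fun i _ => (h (b i)).smul_const (b i)

theorem eq_sum_C_coeff_mul {n : ℕ} {p : ℝ[X]} (hp : p ∈ degreeLT ℝ n) :
    p = ∑ i ∈ Finset.range n, C (p.coeff i) * X ^ i := by
  by_cases h0 : p = 0
  · subst h0; simp
  · refine p.as_sum_range_C_mul_X_pow' ?_
    rw [mem_degreeLT, degree_eq_natDegree h0] at hp
    exact_mod_cast hp

/-- The pairings of `u_h` are differentiated in time under the integral sign. -/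
theorem hasDerivWithinAt_integral_eval_mul {n : ℕ} {T a b : ℝ} (hT : 0 < T) {p : ℝ → ℝ[X]}
    (hp : ∀ t ∈ Icc 0 T, p t ∈ degreeLT ℝ n)
    (hd : ∀ i, DifferentiableOn ℝ (fun s => (p s).coeff i) (Icc 0 T)) (w : ℝ[X]) {t : ℝ}
    (ht : t ∈ Icc 0 T) :
    HasDerivWithinAt (fun s => ∫ x in a..b, (p s).eval x * w.eval x)
      (∫ x in a..b, derivWithin (fun s => (p s).eval x) (Icc 0 T) t * w.eval x) (Icc 0 T) t := by
  have hc := fun i => (hd i t ht).hasDerivWithinAt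
  let D : ℕ → ℝ := fun i => derivWithin (fun s => (p s).coeff i) (Icc 0 T) t
  have e1 : ∀ x, derivWithin (fun s => (p s).eval x) (Icc 0 T) t =
      (∑ i ∈ Finset.range n, C (D i) * X ^ i).eval x := fun x => by
    refine HasDerivWithinAt.derivWithin ?_ (uniqueDiffOn_Icc hT t ht)
    have h : ∀ s ∈ Icc 0 T, (p s).eval x = ∑ i ∈ Finset.range n, (p s).coeff i * x ^ i :=
      fun s hs => by
        conv_lhs => rw [eq_sum_C_coeff_mul (hp s hs)]
        simp [eval_finsetSum]
    refine HasDerivWithinAt.congr ?_ h (h t ht)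
    simp only [eval_finsetSum, eval_mul, eval_C, eval_pow, eval_X]
    exact HasDerivWithinAt.fun_sum fun i _ => (hc i).mul_const _
  have e2 : ∀ s ∈ Icc 0 T, ∫ x in a..b, (p s).eval x * w.eval x =
      ∑ i ∈ Finset.range n, (p s).coeff i * ∫ x in a..b, (X ^ i : ℝ[X]).eval x * w.eval x :=
    fun s hs => by
      rw [← integral_sum_mul, ← eq_sum_C_coeff_mul (hp s hs)]
  refine HasDerivWithinAt.congr ?_ e2 (e2 t ht)
  simp only [e1]
  rw [integral_sum_mul]
  exact HasDerivWithinAt.fun_sum fun i _ => (hc i).mul_const _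

namespace DGSpace

section

variable {N : ℕ} {𝒯 : Mesh N} {k : ℕ}

theorem exists_poly_eq {S : Set ℝ} (p : ℝ → Fin N → ℝ[X])
    (hp : ∀ t ∈ S, ∀ j, p t j ∈ degreeLT ℝ (k + 1)) :
    ∃ ξ : ℝ → DGSpace 𝒯 k, ∀ t ∈ S, (ξ t).poly = p t := by
  classical
  exact ⟨fun t => if h : t ∈ S then mk (p t) (hp t h) else 0, fun t ht => by
    simp only [dif_pos ht, poly_mk]⟩

variable (𝒯 k) in
/-- The interpolation function at time `t`, on each cell, of the solution with spatial jet `U`. -/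
noncomputable def meshInterp (U : ℕ → ℝ → ℝ → ℝ) (F : Flux) (t : ℝ) (j : Fin N) : ℝ[X] :=
  jetInterp k (𝒯.left j) (𝒯.right j) (fun n x => U n x t) F

variable (𝒯 k) in
/-- The residual `h̄ᵏ θ L` on each cell, where `θ` is the top coefficient for the `n`-th derivative
and `L` is the last function of the chain for the flux `G`. -/
noncomputable def residual (U : ℕ → ℝ → ℝ → ℝ) (F G : Flux) (n : ℕ) (t : ℝ) : DGSpace 𝒯 k :=
  mk (fun j => C (((𝒯.right j - 𝒯.left j) / 2) ^ k *
    jetCoef k (𝒯.left j) (𝒯.right j) (fun n x => U n x t) F n) *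
      chain k (𝒯.left j) (𝒯.right j) G k)
    fun j => C_mul_mem_degreeLT (chain_mem k (𝒯.left_lt_right j) G k) _

theorem integral_residual_mul (U : ℕ → ℝ → ℝ → ℝ) (F G : Flux) (n : ℕ) (t : ℝ) (j : Fin N)
    (w : ℝ[X]) :
    ∫ x in 𝒯.left j..𝒯.right j, ((residual 𝒯 k U F G n t).poly j).eval x * w.eval x =
      ((𝒯.right j - 𝒯.left j) / 2) ^ k *
        jetCoef k (𝒯.left j) (𝒯.right j) (fun n x => U n x t) F n *
        ∫ x in 𝒯.left j..𝒯.right j, (chain k (𝒯.left j) (𝒯.right j) G k).eval x * w.eval x := by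
  rw [← intervalIntegral.integral_const_mul]
  simp only [residual, poly_mk, eval_mul, eval_C, mul_assoc]

theorem integral_sub_eval_eval_mul (p q w : ℝ[X]) (a b : ℝ) :
    ∫ x in a..b, (p - q).eval x * w.eval x =
      (∫ x in a..b, p.eval x * w.eval x) - ∫ x in a..b, q.eval x * w.eval x := by
  rw [← intervalIntegral.integral_sub (intervalIntegrable_eval_mul _ _ _ _)
    (intervalIntegrable_eval_mul _ _ _ _)]
  congr 1; funext x; rw [eval_sub, sub_mul]

variable [NeZero N] {F : Flux} {bc : BC} {T : ℝ} {uh qh : ℝ → Fin N → ℝ[X]}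
  {U : ℕ → ℝ → ℝ → ℝ}

/-- One equation of the scheme, minus the consistency relation of the interpolation functions. -/
theorem integral_sub_meshInterp_mul {n : ℕ} (H : HeatJet (2 * Real.pi) T (n + 1) U) {t : ℝ}
    (ht : t ∈ Icc 0 T) (hb : bc.Match (fun x => U 0 x t) t F) {v : Fin N → ℝ[X]} {j : Fin N}
    {w : ℝ[X]} (hw : w ∈ degreeLT ℝ (k + 1)) {I : ℝ}
    (hI : I = -(∫ x in 𝒯.left j..𝒯.right j, (v j).eval x * w.derivative.eval x)
        + fluxU 𝒯 t v F bc j.succ * w.eval (𝒯.right j)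
        - fluxU 𝒯 t v F bc j.castSucc * w.eval (𝒯.left j)) :
    I - ∫ x in 𝒯.left j..𝒯.right j,
        (meshInterp 𝒯 k (fun n => U (n + 1)) F.swap t j).eval x * w.eval x =
      cellForm 𝒯 F bc (v - meshInterp 𝒯 k U F t) j w +
        ∫ x in 𝒯.left j..𝒯.right j,
          ((residual 𝒯 k U F F.swap (k + 1) t).poly j).eval x * w.eval x := by
  have hab := 𝒯.left_lt_right j
  have hc := 𝒯.cell_subset j
  have h1 := integral_jetInterp_shift_mul (d := fun n x => U n x t) hab
    (fun x hx => (H.deriv_x t ht 0 (by omega) x (hc hx)).mono hc)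
    (H.cont_x hc (by omega) ht) F hw
  have hp : ∀ j, (meshInterp 𝒯 k U F t j).eval (endpt (𝒯.left j) (𝒯.right j) F) =
      U 0 (endpt (𝒯.left j) (𝒯.right j) F) t := fun j =>
    jetInterp_eval_endpt (d := fun n x => U n x t) (𝒯.left_lt_right j)
      (H.cont_x (𝒯.cell_subset j) (by omega) ht) F
  rw [hI, fluxU_eq_add_hatU 𝒯 hb hp, fluxU_eq_add_hatU 𝒯 hb hp, integral_residual_mul, cellForm,
    Pi.sub_apply, integral_sub_eval_eval_mul]
  simp only [meshInterp, Mesh.left, Mesh.right] at h1 ⊢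
  rw [h1]
  ring

/-- The error equation for `q`. -/
theorem sub_meshInterp_eq_opD_add (hS : IsLDGSolution 𝒯 k F bc T uh qh) {n : ℕ}
    (H : HeatJet (2 * Real.pi) T (n + 1) U) {t : ℝ} (ht : t ∈ Icc 0 T)
    (hb : bc.Match (fun x => U 0 x t) t F) {ξ η : DGSpace 𝒯 k}
    (hξ : ξ.poly = uh t - meshInterp 𝒯 k U F t)
    (hη : η.poly = qh t - meshInterp 𝒯 k (fun n => U (n + 1)) F.swap t) :
    η = opD 𝒯 k F bc ξ + residual 𝒯 k U F F.swap (k + 1) t := by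
  refine ext_of_integral_mul_eq fun j w hw => ?_
  have h := integral_sub_meshInterp_mul H ht hb hw (hS.eq_q t ht j w hw)
  rw [hη, Pi.sub_apply, integral_sub_eval_eval_mul, h, ← hξ, ← integral_opD_mul F bc ξ j hw,
    ← intervalIntegral.integral_add (intervalIntegrable_eval_mul _ _ _ _)
      (intervalIntegrable_eval_mul _ _ _ _), poly_add]
  congr 1; funext x; rw [Pi.add_apply, eval_add, add_mul]

/-- The error equation for `u`. -/
theorem hasDerivWithinAt_sub_meshInterp (hS : IsLDGSolution 𝒯 k F bc T uh qh) (hT : 0 < T) {n : ℕ}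
    (H : HeatJet (2 * Real.pi) T (n + 2) U) (hn : k ≤ n) {t : ℝ} (ht : t ∈ Icc 0 T)
    (hb : bc.Match (fun x => U 1 x t) t F.swap) {ξ : ℝ → DGSpace 𝒯 k} {η : DGSpace 𝒯 k}
    (hξ : ∀ s ∈ Icc 0 T, (ξ s).poly = uh s - meshInterp 𝒯 k U F s)
    (hη : η.poly = qh t - meshInterp 𝒯 k (fun n => U (n + 1)) F.swap t) :
    HasDerivWithinAt ξ (-ContinuousLinearMap.adjoint (opD 𝒯 k F bc) η +
      residual 𝒯 k U F F (k + 2) t) (Icc 0 T) t := by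
  refine hasDerivWithinAt_of_inner fun w => ?_
  have e : ∀ s ∈ Icc 0 T, (inner ℝ (ξ s) w : ℝ) = ∑ j,
      ((∫ x in 𝒯.left j..𝒯.right j, (uh s j).eval x * (w.poly j).eval x) -
        ∫ x in 𝒯.left j..𝒯.right j, (meshInterp 𝒯 k U F s j).eval x * (w.poly j).eval x) :=
    fun s hs => by
      rw [inner_def, hξ s hs]
      exact Finset.sum_congr rfl fun j _ => integral_sub_eval_eval_mul _ _ _ _ _
  refine HasDerivWithinAt.congr ?_ e (e t ht)
  have hd := HasDerivWithinAt.fun_sum (u := Finset.univ) fun j _ =>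
    (hasDerivWithinAt_integral_eval_mul (a := 𝒯.left j) (b := 𝒯.right j) hT
      (fun s hs => hS.uh_mem s hs j) (hS.differentiable j) (w.poly j) ht).sub
    (H.hasDerivWithinAt_integral_jetInterp (k := k) (by omega) (𝒯.left_lt_right j)
      (𝒯.cell_subset j) F (w.poly_mem j) ht)
  refine hd.congr_deriv ?_
  rw [inner_add_left, inner_neg_left, inner_adjoint_opD, neg_neg, inner_def,
    ← Finset.sum_add_distrib]
  refine Finset.sum_congr rfl fun j _ => ?_
  have hu := hS.eq_u t ht j _ (w.poly_mem j)
  rw [fluxQ_eq_fluxU_swap] at hu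
  have h := integral_sub_meshInterp_mul (U := fun n => U (n + 1)) (F := F.swap) H.shift ht hb
    (w.poly_mem j) hu
  rw [swap_swap] at h
  rw [hη]
  exact h

/-- The residuals are of high order. -/
theorem norm_residual_le {Λ : ℝ} (hΛ : LegBound k Λ) {M : ℝ} (hM0 : 0 ≤ M) {n m : ℕ} (hm : m ≤ k)
    (H : HeatJet (2 * Real.pi) T (n + m) U) {t : ℝ} (ht : t ∈ Icc 0 T)
    (hM : ∀ x ∈ Icc 0 (2 * Real.pi), ∀ y ∈ Icc 0 (2 * Real.pi),
      |U (n + m) x t - U (n + m) y t| ≤ M * |x - y|) (F G : Flux) :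
    ‖residual 𝒯 k U F G n t‖ ≤
      3 * ((1 + kerConst k Λ) * ((2 * radConst k Λ) ^ k * Λ) * M * 𝒯.size ^ (k + m + 1)) := by
  have hs := 𝒯.size_pos
  have hκ := one_le_kerConst hΛ
  have hr := one_le_radConst hΛ
  have hΛ0 : 0 ≤ (2 * radConst k Λ) ^ k * Λ :=
    (abs_nonneg _).trans (abs_chain_le hΛ zero_lt_one F k (left_mem_Icc.2 zero_le_one))
  have hB : ∀ j, ∀ x ∈ Icc (𝒯.left j) (𝒯.right j),
      |((residual 𝒯 k U F G n t).poly j).eval x| ≤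
        (1 + kerConst k Λ) * ((2 * radConst k Λ) ^ k * Λ) * M * 𝒯.size ^ (k + m + 1) := by
    intro j x hx
    have hc := 𝒯.cell_subset j
    have h := abs_residual_le hΛ (𝒯.left_lt_right j) hM0 hm (d := fun n x => U n x t)
      (fun i hi y hy => (H.deriv_x t ht i hi y (hc hy)).mono hc) (H.cont_x hc (by omega) ht)
      (fun x hx y hy => hM x (hc hx) y (hc hy)) F G hx
    simp only [residual, poly_mk, eval_mul, eval_C]
    refine h.trans ?_
    have := 𝒯.len_le_size j
    have := (𝒯.len_pos j).le
    simp only [Mesh.len] at *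
    gcongr
  refine le_of_sq_le_sq ?_ (by positivity)
  refine (norm_sq_le_of_abs_le hB).trans ?_
  rw [mul_pow 3]
  refine mul_le_mul_of_nonneg_right ?_ (sq_nonneg _)
  linarith [Real.pi_lt_four, Real.pi_le_four]

end

end DGSpace

/-! ### The error as a perturbed discrete heat flow -/

namespace DGSpace

section

variable {N : ℕ} {𝒯 : Mesh N} {k : ℕ} {T : ℝ} {U : ℕ → ℝ → ℝ → ℝ}

/-- The time derivative of a residual is the residual for two more derivatives in space. In
particular the residual in the equation for `u` is the derivative of a residual of higher order. -/
theorem hasDerivWithinAt_residual {n m : ℕ} (H : HeatJet (2 * Real.pi) T n U) (hm : m + 2 ≤ n)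
    (F G : Flux) {t : ℝ} (ht : t ∈ Icc 0 T) :
    HasDerivWithinAt (residual 𝒯 k U F G m) (residual 𝒯 k U F G (m + 2) t) (Icc 0 T) t := by
  refine hasDerivWithinAt_of_inner fun w => ?_
  simp only [inner_def, integral_residual_mul]
  refine HasDerivWithinAt.fun_sum fun j _ => ?_
  have := H.hasDerivWithinAt_coefF k (𝒯.left_lt_right j) (𝒯.cell_subset j) hm (F.alt m) ht
  simp only [jetCoef, Flux.alt_add_two]
  exact (this.const_mul _).mul_const _

/-- The cell averages of the error are those of an element of `V_h`. -/
theorem cellIntegral_eq_integral {n : ℕ} (H : HeatJet (2 * Real.pi) T n U) {F : Flux} {t : ℝ}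
    (ht : t ∈ Icc 0 T) {v : ℝ → ℝ} (hv : ∀ x ∈ Icc 0 (2 * Real.pi), U 0 x t = v x)
    {vh : Fin N → ℝ[X]} {ξ : DGSpace 𝒯 k} (hξ : ξ.poly = vh - meshInterp 𝒯 k U F t) (j : Fin N) :
    cellIntegral 𝒯 v vh j =
      ∫ x in 𝒯.left j..𝒯.right j, ((residual 𝒯 k U F F k t - ξ).poly j).eval x := by
  have hab := 𝒯.left_lt_right j
  have hc := 𝒯.cell_subset j
  have hcont := H.cont_x hc (Nat.zero_le n) ht
  have h1 := integral_sub_jetInterp (k := k) (d := fun n x => U n x t) hab hcont F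
  have h2 := integral_residual_mul (𝒯 := 𝒯) (k := k) U F F k t j 1
  simp only [eval_one, mul_one] at h2
  rw [← h2, intervalIntegral.integral_sub (hcont.intervalIntegrable_of_Icc hab.le)
    (intervalIntegrable_eval _ _ _)] at h1
  have h3 : ξ.poly j = vh j - meshInterp 𝒯 k U F t j := by rw [hξ]; rfl
  have h4 : (residual 𝒯 k U F F k t - ξ).poly j =
      (residual 𝒯 k U F F k t).poly j - ξ.poly j := rfl
  have h5 : cellIntegral 𝒯 v vh j = ∫ x in 𝒯.left j..𝒯.right j, (U 0 x t - (vh j).eval x) := by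
    refine intervalIntegral.integral_congr fun x hx => ?_
    rw [uIcc_of_le hab.le] at hx
    simp only [hv x (hc hx)]
  rw [h5, h4, h3]
  simp only [eval_sub]
  rw [intervalIntegral.integral_sub (hcont.intervalIntegrable_of_Icc hab.le)
      (intervalIntegrable_eval _ _ _),
    intervalIntegral.integral_sub (intervalIntegrable_eval _ _ _)
      ((intervalIntegrable_eval _ _ _).sub (intervalIntegrable_eval _ _ _)),
    intervalIntegral.integral_sub (intervalIntegrable_eval _ _ _)
      (intervalIntegrable_eval _ _ _), ← h1]
  simp only [meshInterp]
  ring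

theorem cellAvg_le [NeZero N] {c : ℝ} (hc : 𝒯.QuasiUniform c) {v : ℝ → ℝ} {vh : Fin N → ℝ[X]}
    {z : DGSpace 𝒯 k} (hz : ∀ j, cellIntegral 𝒯 v vh j =
      ∫ x in 𝒯.left j..𝒯.right j, (z.poly j).eval x) :
    cellAvg 𝒯 v vh ≤ √c * ‖z‖ := by
  have h := sum_mean_sq_le hc z
  simp only [← hz] at h
  rw [cellAvg, ← Real.sqrt_sq (norm_nonneg z), ← Real.sqrt_mul hc.pos.le]
  exact Real.sqrt_le_sqrt h

theorem domainAvg_eq {v : ℝ → ℝ} {vh : Fin N → ℝ[X]}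
    {z : DGSpace 𝒯 k} (hz : ∀ j, cellIntegral 𝒯 v vh j =
      ∫ x in 𝒯.left j..𝒯.right j, (z.poly j).eval x) :
    domainAvg 𝒯 v vh = (2 * Real.pi)⁻¹ * |inner ℝ z (one 𝒯 k)| := by
  rw [domainAvg, Finset.sum_congr rfl fun j _ => hz j, ← inner_one, abs_mul,
    abs_of_pos (by positivity)]

theorem domainAvg_le {v : ℝ → ℝ} {vh : Fin N → ℝ[X]}
    {z : DGSpace 𝒯 k} (hz : ∀ j, cellIntegral 𝒯 v vh j =
      ∫ x in 𝒯.left j..𝒯.right j, (z.poly j).eval x) :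
    domainAvg 𝒯 v vh ≤ |inner ℝ z (one 𝒯 k)| := by
  rw [domainAvg_eq hz]
  exact mul_le_of_le_one_left (abs_nonneg _)
    (inv_le_one_of_one_le₀ (by linarith [Real.pi_gt_three]))

theorem norm_one_le : ‖one 𝒯 k‖ ≤ 3 := by
  refine le_of_sq_le_sq ?_ (by norm_num)
  rw [norm_sq_one]
  linarith [Real.pi_lt_four]

end

section

variable {N : ℕ} [NeZero N] {𝒯 : Mesh N} {k : ℕ} {F : Flux} {bc : BC} {T : ℝ}
  {uh qh : ℝ → Fin N → ℝ[X]} {U : ℕ → ℝ → ℝ → ℝ}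

/-- The error `ξ = u_h - u_I` is a perturbed discrete heat flow, and `q_h - q_I = Dξ + R₂`. A
residual is `h^k` times a Taylor remainder. For `B` and `R₂`, which start from the derivatives of
order `k` and `k + 1`, this remainder has order `k + 1`. For `R₁`, which starts from order `k + 2`,
only `k - 1` further derivatives are available, and it has order `k`. -/
theorem exists_perturbedHeat {Λ : ℝ} (hk : 1 ≤ k) (hΛ : LegBound k Λ)
    (hS : IsLDGSolution 𝒯 k F bc T uh qh) (hT : 0 < T)
    (H : HeatJet (2 * Real.pi) T (2 * k + 1) U) {M : ℝ → ℝ} (hM0 : ∀ t, 0 ≤ M t)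
    (hM : ∀ t ∈ Icc 0 T, ∀ s ∈ Icc 0 t, ∀ j ≤ 2 * k + 1, ∀ x ∈ Icc 0 (2 * Real.pi),
      ∀ y ∈ Icc 0 (2 * Real.pi), |U j x s - U j y s| ≤ M t * |x - y|)
    (hb₀ : ∀ t ∈ Icc 0 T, bc.Match (fun x => U 0 x t) t F)
    (hb₁ : ∀ t ∈ Icc 0 T, bc.Match (fun x => U 1 x t) t F.swap)
    (h0 : uh 0 = meshInterp 𝒯 k U F 0) :
    ∃ ξ : ℝ → DGSpace 𝒯 k,
      (∀ t ∈ Icc 0 T, (ξ t).poly = uh t - meshInterp 𝒯 k U F t) ∧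
      (∀ t ∈ Icc 0 T, (opD 𝒯 k F bc (ξ t) + residual 𝒯 k U F F.swap (k + 1) t).poly =
        qh t - meshInterp 𝒯 k (fun n => U (n + 1)) F.swap t) ∧
      ∀ t ∈ Icc 0 T, PerturbedHeat (opD 𝒯 k F bc) ξ (residual 𝒯 k U F F k)
        (residual 𝒯 k U F F (k + 2)) (residual 𝒯 k U F F.swap (k + 1)) t 𝒯.size
        (3 * ((1 + kerConst k Λ) * ((2 * radConst k Λ) ^ k * Λ) * M t * 𝒯.size ^ (2 * k + 1))) := by
  have hH1 : HeatJet (2 * Real.pi) T (k + 1 + 1) U := H.mono (by omega)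
  have hcell := 𝒯.cell_subset
  obtain ⟨ξ, hξ⟩ := exists_poly_eq (𝒯 := 𝒯) (k := k) (S := Icc 0 T)
    (fun t => uh t - meshInterp 𝒯 k U F t) fun t ht j => sub_mem (hS.uh_mem t ht j)
      (jetInterp_mem (𝒯.left_lt_right j) (H.cont_x (hcell j) (Nat.zero_le _) ht) F)
  obtain ⟨η, hη⟩ := exists_poly_eq (𝒯 := 𝒯) (k := k) (S := Icc 0 T)
    (fun t => qh t - meshInterp 𝒯 k (fun n => U (n + 1)) F.swap t) fun t ht j =>
      sub_mem (hS.qh_mem t ht j)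
        (jetInterp_mem (𝒯.left_lt_right j) (H.cont_x (hcell j) (by omega) ht) F.swap)
  have hq : ∀ t ∈ Icc 0 T, η t = opD 𝒯 k F bc (ξ t) + residual 𝒯 k U F F.swap (k + 1) t :=
    fun t ht => sub_meshInterp_eq_opD_add hS hH1 ht (hb₀ t ht) (hξ t ht) (hη t ht)
  have hd : ∀ t ∈ Icc 0 T, HasDerivWithinAt ξ
      (-ContinuousLinearMap.adjoint (opD 𝒯 k F bc)
        (opD 𝒯 k F bc (ξ t) + residual 𝒯 k U F F.swap (k + 1) t) +
        residual 𝒯 k U F F (k + 2) t) (Icc 0 T) t := fun t ht => by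
    rw [← hq t ht]
    exact hasDerivWithinAt_sub_meshInterp hS hT (H.mono (by omega)) le_rfl ht (hb₁ t ht) hξ
      (hη t ht)
  have hB : ∀ t ∈ Icc 0 T, HasDerivWithinAt (residual 𝒯 k U F F k)
      (residual 𝒯 k U F F (k + 2) t) (Icc 0 T) t := fun t ht =>
    hasDerivWithinAt_residual H (by omega) F F ht
  refine ⟨ξ, hξ, fun t ht => by rw [← hq t ht]; exact hη t ht, fun t ht => ?_⟩
  have hmem : ∀ s ∈ Ico 0 t, s ∈ Icc 0 T ∧ Icc 0 T ∈ nhdsWithin s (Ici s) := fun s hs =>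
    ⟨⟨hs.1, hs.2.le.trans ht.2⟩, Filter.mem_of_superset (Icc_mem_nhdsGE (hs.2.trans_le ht.2))
      (Icc_subset_Icc_left hs.1)⟩
  have hsub : Icc 0 t ⊆ Icc 0 T := Icc_subset_Icc_right ht.2
  have hs0 := 𝒯.size_pos
  refine ⟨fun s hs => ?_, fun s hs => ?_, ?_, fun s hs => ?_, fun s hs => ?_, fun s hs => ?_,
    fun s hs => ?_, fun s hs => ?_⟩
  · exact (hd s (hmem s hs).1).mono_of_mem_nhdsWithin (hmem s hs).2
  · exact (hd s (hsub hs)).continuousWithinAt.mono hsub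
  · exact ext_poly (by rw [hξ 0 ⟨le_rfl, hT.le⟩, h0, sub_self, poly_zero])
  · exact (hB s (hmem s hs).1).mono_of_mem_nhdsWithin (hmem s hs).2
  · exact (hB s (hsub hs)).continuousWithinAt.mono hsub
  · refine (norm_residual_le (m := k - 1) hΛ (hM0 t) (by omega) (H.mono (by omega)) (hsub hs)
      (hM t ht s hs _ (by omega)) F F).trans_eq ?_
    rw [show k + (k - 1) + 1 = 2 * k by omega, pow_succ]
    field_simp
  · refine (norm_residual_le (m := k) hΛ (hM0 t) le_rfl (H.mono (by omega)) (hsub hs)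
      (hM t ht s hs _ (by omega)) F F.swap).trans_eq ?_
    rw [← two_mul k]
  · refine (norm_residual_le (m := k) hΛ (hM0 t) le_rfl (H.mono (by omega)) (hsub hs)
      (hM t ht s hs _ (by omega)) F F).trans_eq ?_
    rw [← two_mul k]

/-- The mean of a perturbed discrete heat flow under mixed boundary conditions. -/
theorem abs_inner_one_le_of_mixed (hk : 1 ≤ k) {g₀ g₁ : ℝ → ℝ} {ξ B R₁ R₂ : ℝ → DGSpace 𝒯 k}
    {t ρ : ℝ} (ht : 0 ≤ t) (hρ : 0 ≤ ρ)
    (P : PerturbedHeat (opD 𝒯 k F (.mixed g₀ g₁)) ξ B R₁ R₂ t 𝒯.size ρ) :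
    √𝒯.size * |inner ℝ (ξ t) (one 𝒯 k)| ≤ ρ * (30 * √𝒯.size + 10 * t) := by
  have hs := 𝒯.size_pos
  have hsπ := 𝒯.size_le
  have hπ := Real.pi_lt_four
  have hπ3 := Real.pi_gt_three
  have hq : √𝒯.size ^ 2 = 𝒯.size := Real.sq_sqrt hs.le
  have hq0 : 0 < √𝒯.size := Real.sqrt_pos.2 hs
  have ht2 : √t ^ 2 = t := Real.sq_sqrt ht
  have ht0 := Real.sqrt_nonneg t
  have hq3 : √𝒯.size ≤ 3 := by nlinarith
  rcases lt_or_ge t 𝒯.size with h | h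
  -- for times shorter than the mesh size the bound of `ξ` itself suffices
  · have h1 := P.norm_le ht hs hρ
    have h2 : t / 𝒯.size ≤ 1 := (div_le_one hs).2 h.le
    have h3 : √t ≤ 3 := by nlinarith
    calc _ ≤ √𝒯.size * (‖ξ t‖ * ‖one 𝒯 k‖) := by gcongr; exact abs_real_inner_le_norm _ _
      _ ≤ √𝒯.size * (ρ * (1 + 2 * 3) * 3) := by
        gcongr
        · exact h1.trans (by gcongr)
        · exact norm_one_le
      _ ≤ _ := by nlinarith [mul_nonneg hρ ht, mul_nonneg hρ hq0.le]
  -- the cut-off length is the diffusion time, as far as the domain allows it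
  · set y := min t (2 * Real.pi) with hy
    have hyh : 𝒯.size ≤ y := le_min h hsπ
    have ht' : 0 < t := hs.trans_le h
    obtain ⟨ℓ, v₁, v₂, hℓ1, hℓ2, hv, hv1, hv2⟩ :=
      exists_cutoff 𝒯 hk F g₀ g₁ (hs.trans_le hyh) (min_le_right _ _)
    have hℓ0 : 0 < ℓ := (hs.trans_le hyh).trans_le hℓ1
    have key := P.abs_inner_le_of_split hs h hρ v₁ v₂
    rw [hv] at key
    have hℓt : ℓ ≤ 2 * t := by linarith [min_le_left t (2 * Real.pi)]
    have hv1' : ‖v₁‖ ≤ √ℓ := Real.le_sqrt_of_sq_le hv1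
    have hv2' : ‖opD 𝒯 k F (.mixed g₀ g₁) v₂‖ ≤ (√ℓ)⁻¹ := by
      rw [← Real.sqrt_inv]; exact Real.le_sqrt_of_sq_le hv2
    -- `log z ≤ 2 √z` absorbs the logarithm
    have hlog : Real.log (t / 𝒯.size) ≤ 2 * (√t / √𝒯.size) := by
      rw [← Real.sqrt_div ht]
      have hp : 0 < t / 𝒯.size := div_pos ht' hs
      have := Real.log_le_sub_one_of_pos (Real.sqrt_pos.2 hp)
      rw [Real.log_sqrt hp.le] at this
      linarith
    have hlog0 : 0 ≤ Real.log (t / 𝒯.size) := Real.log_nonneg ((one_le_div hs).2 h)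
    have hℓt' : √ℓ ≤ 2 * √t := by
      refine Real.sqrt_le_iff.2 ⟨by positivity, ?_⟩
      rw [mul_pow, ht2]; linarith
    have hratio : (√ℓ)⁻¹ * √t ≤ 1 + √t := by
      rcases le_total t (2 * Real.pi) with h' | h'
      · have : √t ≤ √ℓ := Real.sqrt_le_sqrt (by rwa [hy, min_eq_left h'] at hℓ1)
        have h4 := Real.sqrt_pos.2 hℓ0
        have : (√ℓ)⁻¹ * √t ≤ 1 := by rw [inv_mul_le_iff₀ h4]; linarith
        linarith
      · have h4 : 1 ≤ √ℓ := by
          rw [hy, min_eq_right h'] at hℓ1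
          exact Real.one_le_sqrt.2 (by linarith)
        have := mul_le_mul_of_nonneg_right (inv_le_one_of_one_le₀ h4) ht0
        linarith
    calc _ ≤ √𝒯.size * (ρ * (3 * 3 + 2 * 3 * √t + 2 * √t * (2 * (√t / √𝒯.size)) +
          2 * (1 + √t))) := by
          refine mul_le_mul_of_nonneg_left (key.trans (mul_le_mul_of_nonneg_left ?_ hρ)) hq0.le
          have e1 := norm_one_le (𝒯 := 𝒯) (k := k)
          have e2 : ‖v₁‖ * Real.log (t / 𝒯.size) ≤ 2 * √t * (2 * (√t / √𝒯.size)) :=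
            mul_le_mul (hv1'.trans hℓt') hlog hlog0 (by positivity)
          have e3 := (mul_le_mul_of_nonneg_right hv2' ht0).trans hratio
          nlinarith
      _ = ρ * (11 * √𝒯.size + 8 * (√𝒯.size * √t) + 4 * √t ^ 2) := by field_simp; ring
      _ ≤ _ := by
        refine mul_le_mul_of_nonneg_left ?_ hρ
        rw [ht2]
        nlinarith [sq_nonneg (√𝒯.size - √t)]

end

end DGSpace

/-! ### The boundary conditions -/

/-- The boundary condition splits into the one for the flux of `u` and the one for the flux of `q`,
which is the flux of `u` for the opposite choice. -/
theorem BC.Holds.match_auxQ {u : ℝ → ℝ → ℝ} {t : ℝ} {F : Flux} {bc : BC} (h : bc.Holds u t F) :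
    bc.Match (fun x => u x t) t F ∧ bc.Match (fun x => auxQ u x t) t F.swap := by
  cases bc with
  | periodic => cases F <;> exact h
  | mixed g₀ g₁ => cases F <;> first | exact h | exact h.symm

theorem BC.Match.congr {f g : ℝ → ℝ} {t : ℝ} {F : Flux} {bc : BC} (h : bc.Match f t F)
    (hfg : ∀ x ∈ Icc 0 (2 * Real.pi), f x = g x) : bc.Match g t F := by
  have h0 := hfg 0 ⟨le_rfl, by positivity⟩
  have h1 := hfg (2 * Real.pi) ⟨by positivity, le_rfl⟩
  cases bc with
  | periodic => cases F <;> exact h0.symm.trans ((show f 0 = f (2 * Real.pi) from h).trans h1)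
  | mixed g₀ g₁ => cases F <;> first | exact h0.symm.trans h | exact h1.symm.trans h

/-! ### Bounds for the averages -/

namespace DGSpace

/-- The constant in the size of the residuals. -/
noncomputable def residualConst (k : ℕ) (Λ : ℝ) : ℝ :=
  3 * ((1 + kerConst k Λ) * ((2 * radConst k Λ) ^ k * Λ))

theorem residualConst_nonneg {k : ℕ} {Λ : ℝ} (hΛ : LegBound k Λ) : 0 ≤ residualConst k Λ := by
  have hκ := one_le_kerConst hΛ
  have := (abs_nonneg _).trans (abs_chain_le hΛ zero_lt_one .minusPlus k
    (left_mem_Icc.2 zero_le_one))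
  rw [residualConst]
  positivity

section

variable {N : ℕ} [NeZero N] {𝒯 : Mesh N} {k : ℕ} {F : Flux} {bc : BC}
  {ξ B R₁ R₂ : ℝ → DGSpace 𝒯 k} {t c Λ X : ℝ}

theorem norm_sub_le (ht : 0 ≤ t) (hX : 0 ≤ X)
    (P : PerturbedHeat (opD 𝒯 k F bc) ξ B R₁ R₂ t 𝒯.size (X * 𝒯.size)) :
    ‖B t - ξ t‖ ≤ 9 * X * (𝒯.size + t) := by
  have hs := 𝒯.size_pos
  have hsπ := 𝒯.size_le
  have hπ := Real.pi_lt_four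
  have h1 := P.norm_le ht hs (by positivity)
  have h2 := P.boundB t ⟨ht, le_rfl⟩
  have h3 : 𝒯.size * (2 * √t) ≤ 8 * 𝒯.size + t := by
    nlinarith [sq_nonneg (𝒯.size - √t), Real.sq_sqrt ht]
  calc _ ≤ X * 𝒯.size + X * 𝒯.size * (t / 𝒯.size + 2 * √t) :=
        (_root_.norm_sub_le _ _).trans (add_le_add h2 h1)
    _ = X * (𝒯.size + t + 𝒯.size * (2 * √t)) := by field_simp; ring
    _ ≤ X * (9 * (𝒯.size + t)) := by gcongr; linarith
    _ = _ := by ring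

theorem norm_opD_apply_le (hΛ : LegBound k Λ) (hc : 𝒯.QuasiUniform c) (ht : 0 ≤ t) (hX : 0 ≤ X)
    (P : PerturbedHeat (opD 𝒯 k F bc) ξ B R₁ R₂ t 𝒯.size (X * 𝒯.size)) :
    ‖opD 𝒯 k F bc (ξ t)‖ ≤ (2 + 6 * (kerConst k Λ * c)) * X * (1 + t) := by
  have hs := 𝒯.size_pos
  have hκ := one_le_kerConst hΛ
  have hc0 := hc.pos
  have hK : ∀ j, kerConst k Λ / 𝒯.len j ≤ kerConst k Λ * c / 𝒯.size := fun j => by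
    rw [div_eq_mul_inv, mul_div_assoc]
    exact mul_le_mul_of_nonneg_left (hc.inv_len_le j) (by linarith)
  have h1 := P.norm_D_le ht hs (by positivity) (K := 3 * (kerConst k Λ * c))
    ((norm_opD_le hΛ hK F bc).trans_eq (by ring))
  have h2 : √t ≤ 1 + t := by nlinarith [Real.sq_sqrt ht, sq_nonneg (√t - 1)]
  rw [mul_div_assoc, div_self hs.ne', mul_one] at h1
  calc _ ≤ _ := h1
    _ ≤ (2 + 2 * (3 * (kerConst k Λ * c))) * (1 + t) * X := by gcongr
    _ = _ := by ring

theorem abs_inner_opD_one_le (hΛ : LegBound k Λ) (hc : 𝒯.QuasiUniform c) (ht : 0 ≤ t)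
    (hX : 0 ≤ X) (P : PerturbedHeat (opD 𝒯 k F bc) ξ B R₁ R₂ t 𝒯.size (X * 𝒯.size)) :
    |inner ℝ (opD 𝒯 k F bc (ξ t)) (one 𝒯 k)| ≤
      (18 + 4 * √(kerConst k Λ * c)) * X * (1 + t) * √𝒯.size := by
  have hs := 𝒯.size_pos
  have hκ := one_le_kerConst hΛ
  have hc0 := hc.pos
  have hK : ∀ j, kerConst k Λ / 𝒯.len j ≤ kerConst k Λ * c / 𝒯.size := fun j => by
    rw [div_eq_mul_inv, mul_div_assoc]
    exact mul_le_mul_of_nonneg_left (hc.inv_len_le j) (by linarith)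
  have h1 := P.abs_inner_D_le ht hs (by positivity) (one 𝒯 k)
  have h2 : √t ≤ 1 + t := by nlinarith [Real.sq_sqrt ht, sq_nonneg (√t - 1)]
  have h3 := norm_adjoint_opD_one_le hΛ hK F bc
  rw [Real.sqrt_div (by positivity)] at h3
  have hq0 : 0 < √𝒯.size := Real.sqrt_pos.2 hs
  have hq : √𝒯.size ^ 2 = 𝒯.size := Real.sq_sqrt hs.le
  calc _ ≤ _ := h1
    _ ≤ X * √𝒯.size ^ 2 * (6 * (3 * (1 + t)) / √𝒯.size +
          2 * (2 * (√(kerConst k Λ * c) / √𝒯.size)) * (1 + t)) := by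
        rw [hq]
        gcongr
        linarith [norm_one_le (𝒯 := 𝒯) (k := k)]
    _ = _ := by field_simp; ring

theorem abs_inner_sub_one_le_of_periodic (ht : 0 ≤ t) (hX : 0 ≤ X)
    (P : PerturbedHeat (opD 𝒯 k F .periodic) ξ B R₁ R₂ t 𝒯.size (X * 𝒯.size)) :
    |inner ℝ (B t - ξ t) (one 𝒯 k)| ≤ 9 * X * 𝒯.size := by
  have hs := 𝒯.size_pos
  have h1 := P.abs_inner_le_of_D_eq_zero ht (opD_one_periodic F)
  have h2 := P.boundB t ⟨ht, le_rfl⟩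
  have h3 := abs_real_inner_le_norm (B t) (one 𝒯 k)
  have h4 := norm_one_le (𝒯 := 𝒯) (k := k)
  rw [inner_sub_left]
  calc _ ≤ X * 𝒯.size * ‖one 𝒯 k‖ + 2 * (X * 𝒯.size) * ‖one 𝒯 k‖ :=
        (abs_sub _ _).trans (add_le_add (h3.trans (by gcongr)) h1)
    _ = 3 * (X * 𝒯.size) * ‖one 𝒯 k‖ := by ring
    _ ≤ 3 * (X * 𝒯.size) * 3 := by gcongr
    _ = _ := by ring

theorem abs_inner_sub_one_le_of_mixed (hk : 1 ≤ k) {g₀ g₁ : ℝ → ℝ} (ht : 0 ≤ t) (hX : 0 ≤ X)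
    (P : PerturbedHeat (opD 𝒯 k F (.mixed g₀ g₁)) ξ B R₁ R₂ t 𝒯.size (X * 𝒯.size)) :
    |inner ℝ (B t - ξ t) (one 𝒯 k)| ≤ 33 * X * (√𝒯.size + t) * √𝒯.size := by
  have hs := 𝒯.size_pos
  have hq0 : 0 < √𝒯.size := Real.sqrt_pos.2 hs
  have hq : √𝒯.size ^ 2 = 𝒯.size := Real.sq_sqrt hs.le
  have h1 := abs_inner_one_le_of_mixed hk ht (by positivity) P
  have h2 := P.boundB t ⟨ht, le_rfl⟩
  have h3 := abs_real_inner_le_norm (B t) (one 𝒯 k)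
  have h4 := norm_one_le (𝒯 := 𝒯) (k := k)
  have h5 : |inner ℝ (ξ t) (one 𝒯 k)| ≤ X * √𝒯.size * (30 * √𝒯.size + 10 * t) := by
    refine le_of_mul_le_mul_left (h1.trans_eq ?_) hq0
    nth_rw 1 [← hq]
    ring
  rw [inner_sub_left]
  calc _ ≤ X * 𝒯.size * 3 + X * √𝒯.size * (30 * √𝒯.size + 10 * t) :=
        (abs_sub _ _).trans (add_le_add (h3.trans (by gcongr)) h5)
    _ = X * √𝒯.size * (33 * √𝒯.size + 10 * t) := by nth_rw 1 [← hq]; ring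
    _ ≤ X * √𝒯.size * (33 * √𝒯.size + 33 * t) := by gcongr; norm_num
    _ = _ := by ring

end

end DGSpace

end LDG

/-! ### Superconvergence of the averages -/

open LDG LDG.DGSpace

theorem theorem4p3 (k : ℕ) (hk : 1 ≤ k) (c : ℝ) :
    ∃ C : ℝ, ∀ (N : ℕ) [NeZero N] (𝒯 : LDG.Mesh N), 𝒯.QuasiUniform c →
      ∀ (F : LDG.Flux) (bc : LDG.BC) (T : ℝ), 0 < T →
      ∀ (u₀ : ℝ → ℝ) (u : ℝ → ℝ → ℝ), LDG.IsHeatSolution F bc T u₀ u →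
      LDG.supSobolevNorm (2 * k + 2) u T < ⊤ →
      ∀ uh qh : ℝ → Fin N → Polynomial ℝ, LDG.IsLDGSolution 𝒯 k F bc T uh qh →
      (∀ j, uh 0 j = LDG.interpU 𝒯 k k F T u 0 j) →
      ∀ t ∈ Set.Icc 0 T,
        (LDG.cellAvg 𝒯 (fun x => u x t) (uh t) ≤
            C * (𝒯.size + t ^ (3 / 2 : ℝ) + t) * 𝒯.size ^ (2 * k) *
              (LDG.supSobolevNorm (2 * k + 2) u t).toReal ∧
          LDG.cellAvg 𝒯 (fun x => LDG.auxQ u x t) (qh t) ≤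
            C * (1 + t) * 𝒯.size ^ (2 * k) *
              (LDG.supSobolevNorm (2 * k + 2) u t).toReal) ∧
        (bc = LDG.BC.periodic →
          LDG.domainAvg 𝒯 (fun x => u x t) (uh t) ≤
            C * 𝒯.size ^ (2 * k + 1) * (LDG.supSobolevNorm (2 * k + 2) u t).toReal ∧
          LDG.domainAvg 𝒯 (fun x => LDG.auxQ u x t) (qh t) = 0) ∧
        (∀ g₀ g₁ : ℝ → ℝ, bc = LDG.BC.mixed g₀ g₁ →
          LDG.domainAvg 𝒯 (fun x => u x t) (uh t) ≤
            C * (𝒯.size ^ (1 / 2 : ℝ) + t ^ (3 / 2 : ℝ) + t) *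
              𝒯.size ^ (2 * k + 1 / 2 : ℝ) *
              (LDG.supSobolevNorm (2 * k + 2) u t).toReal ∧
          LDG.domainAvg 𝒯 (fun x => LDG.auxQ u x t) (qh t) ≤
            C * (1 + t) * 𝒯.size ^ (2 * k + 1 / 2 : ℝ) *
              (LDG.supSobolevNorm (2 * k + 2) u t).toReal) := by
  obtain ⟨Λ, hΛ⟩ := exists_legBound k
  have hA := residualConst_nonneg hΛ
  have hκ := one_le_kerConst hΛ
  -- The sum of the constants in the bounds for the four averages; `|c|` keeps it nonnegative
  -- for all `c`, although a mesh is quasi-uniform for positive `c` only.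
  refine ⟨residualConst k Λ * (√c * 9 + √c * (2 + 6 * (kerConst k Λ * |c|)) + 33 +
    (18 + 4 * √(kerConst k Λ * c))), ?_⟩
  intro N _ 𝒯 hc F bc T hT u₀ u hu hfin uh qh hS h0 t ht
  have hc0 := hc.pos
  have hs := 𝒯.size_pos
  rw [abs_of_pos hc0]
  obtain ⟨U, hU, H, hlip⟩ := hu.exists_heatJet hT (n := 2 * k + 1) (by omega) hfin
  have hQ : ∀ s ∈ Icc 0 T, ∀ x ∈ Icc 0 (2 * Real.pi), U 1 x s = auxQ u x s :=
    fun s hs x hx => H.eq_auxQ hU (by omega) hx hs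
  have h0mem : (0 : ℝ) ∈ Icc 0 T := ⟨le_rfl, hT.le⟩
  have hinit : uh 0 = meshInterp 𝒯 k U F 0 := funext fun j => by
    rw [h0 j, interpU, H.correction_eq hT hU (fun x hx s hs => hQ s hs x hx) (by omega)
      (𝒯.left_lt_right j) (𝒯.cell_subset j) F h0mem, ← funext fun x => hU x 0 h0mem]
    rfl
  obtain ⟨ξ, hξ, hη, hP⟩ := exists_perturbedHeat (𝒯 := 𝒯) hk hΛ hS hT H
    (M := fun t => (supSobolevNorm (2 * k + 2) u t).toReal) (fun t => ENNReal.toReal_nonneg) hlip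
    (fun s hs => (hu.boundary s hs).match_auxQ.1.congr fun x _ => (hU x s hs).symm)
    (fun s hs => (hu.boundary s hs).match_auxQ.2.congr fun x hx => (hQ s hs x hx).symm) hinit
  have P := hP t ht
  have hMt : 0 ≤ (supSobolevNorm (2 * k + 2) u t).toReal := ENNReal.toReal_nonneg
  generalize (supSobolevNorm (2 * k + 2) u t).toReal = M at P hMt ⊢
  set X := residualConst k Λ * (𝒯.size ^ (2 * k) * M) with hX
  have hX0 : 0 ≤ X := by positivity
  rw [show 3 * ((1 + kerConst k Λ) * ((2 * radConst k Λ) ^ k * Λ) * M * 𝒯.size ^ (2 * k + 1)) =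
    X * 𝒯.size by rw [hX, residualConst]; ring] at P
  -- The cell averages of both errors are those of elements of `V_h`.
  have hcu := cellIntegral_eq_integral H ht (v := fun x => u x t) (fun x _ => hU x t ht) (hξ t ht)
  have hcq : ∀ j, cellIntegral 𝒯 (fun x => auxQ u x t) (qh t) j =
      ∫ x in 𝒯.left j..𝒯.right j, ((-opD 𝒯 k F bc (ξ t)).poly j).eval x := fun j => by
    rw [cellIntegral_eq_integral (H.mono (m := 0 + 1) (by omega)).shift ht
      (v := fun x => auxQ u x t) (fun x hx => hQ t ht x hx) (hη t ht) j]
    congr 1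
    funext x
    rw [show residual 𝒯 k (fun n => U (n + 1)) F.swap F.swap k t =
      residual 𝒯 k U F F.swap (k + 1) t from rfl, sub_add_cancel_right]
  have hsq : 𝒯.size ^ (1 / 2 : ℝ) = √𝒯.size := (Real.sqrt_eq_rpow _).symm
  have hpow : 𝒯.size ^ (2 * k + 1 / 2 : ℝ) = 𝒯.size ^ (2 * k) * √𝒯.size := by
    rw [Real.rpow_add hs, hsq, ← Real.rpow_natCast]
    push_cast
    rfl
  have ht32 : 0 ≤ t ^ (3 / 2 : ℝ) := Real.rpow_nonneg ht.1 _
  have ht0 := ht.1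
  have e1 : 0 ≤ √c * 9 := by positivity
  have e2 : 0 ≤ √c * (2 + 6 * (kerConst k Λ * c)) := by positivity
  have e3 : 0 ≤ 18 + 4 * √(kerConst k Λ * c) := by positivity
  refine ⟨⟨?_, ?_⟩, ?_, ?_⟩
  · refine (cellAvg_le hc hcu).trans ?_
    calc _ ≤ √c * (9 * X * (𝒯.size + t)) := by gcongr; exact norm_sub_le ht0 hX0 P
      _ = √c * 9 * (X * (𝒯.size + t)) := by ring
      _ ≤ (√c * 9 + √c * (2 + 6 * (kerConst k Λ * c)) + 33 + (18 + 4 * √(kerConst k Λ * c))) *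
          (X * (𝒯.size + t ^ (3 / 2 : ℝ) + t)) := by gcongr <;> linarith
      _ = _ := by rw [hX]; ring
  · refine (cellAvg_le hc hcq).trans ?_
    rw [norm_neg]
    calc _ ≤ √c * ((2 + 6 * (kerConst k Λ * c)) * X * (1 + t)) := by
          gcongr; exact norm_opD_apply_le hΛ hc ht0 hX0 P
      _ = √c * (2 + 6 * (kerConst k Λ * c)) * (X * (1 + t)) := by ring
      _ ≤ (√c * 9 + √c * (2 + 6 * (kerConst k Λ * c)) + 33 + (18 + 4 * √(kerConst k Λ * c))) *
          (X * (1 + t)) := by gcongr; linarith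
      _ = _ := by rw [hX]; ring
  · rintro rfl
    constructor
    · refine (domainAvg_le hcu).trans ((abs_inner_sub_one_le_of_periodic ht0 hX0 P).trans ?_)
      calc _ = 9 * (X * 𝒯.size) := by ring
        _ ≤ (√c * 9 + √c * (2 + 6 * (kerConst k Λ * c)) + 33 + (18 + 4 * √(kerConst k Λ * c))) *
            (X * 𝒯.size) := by gcongr; linarith
        _ = _ := by rw [hX]; ring
    · rw [domainAvg_eq hcq, inner_neg_left, inner_opD_one, hatU_periodic]
      simp
  · rintro g₀ g₁ rfl
    rw [hpow, hsq]
    constructor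
    · refine (domainAvg_le hcu).trans ((abs_inner_sub_one_le_of_mixed hk ht0 hX0 P).trans ?_)
      calc _ = 33 * (X * (√𝒯.size + t) * √𝒯.size) := by ring
        _ ≤ (√c * 9 + √c * (2 + 6 * (kerConst k Λ * c)) + 33 + (18 + 4 * √(kerConst k Λ * c))) *
            (X * (√𝒯.size + t ^ (3 / 2 : ℝ) + t) * √𝒯.size) := by gcongr <;> linarith
        _ = _ := by rw [hX]; ring
    · refine (domainAvg_le hcq).trans ?_
      rw [inner_neg_left, abs_neg]
      refine (abs_inner_opD_one_le hΛ hc ht0 hX0 P).trans ?_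
      calc _ = (18 + 4 * √(kerConst k Λ * c)) * (X * (1 + t) * √𝒯.size) := by ring
        _ ≤ (√c * 9 + √c * (2 + 6 * (kerConst k Λ * c)) + 33 + (18 + 4 * √(kerConst k Λ * c))) *
            (X * (1 + t) * √𝒯.size) :=
            mul_le_mul_of_nonneg_right (by linarith) (by positivity)
        _ = _ := by rw [hX]; ring
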